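/- Setting. Let $\mathcal A=\{1,\dots,m\}$ be a finite alphabet. A substitution is a map $\zeta$ from $\mathcal A$ to non-empty finite words, extended to words and to two-sided sequences by concatenation; its matrix is ${\sf S}_\zeta(i,j)=$ number of letters $i$ in $\zeta(j)$. Let $\mathbf a=(\zeta_n)_{n\ge1}$ be a sequence of substitutions such that, for each $n$, every letter occurs in some word $\zeta_n(b)$ and some $\zeta_n(b)$ has length at least $2$. Put $\zeta^{[n]}=\zeta_1\circ\dots\circ\zeta_n$ ($\zeta^{[0]}=\mathrm{id}$), ${\sf S}_n={\sf S}_{\zeta_n}$, ${\sf S}^{[n]}={\sf S}_{\zeta^{[n]}}={\sf S}_1\cdots{\sf S}_n$, and let $\|\cdot\|$ be the matrix 1-norm (maximal absolute column sum). Let $X_{\mathbf a}\subset\mathcal A^{\mathbb Z}$ be the set of two-sided sequences each of whose finite subwords is a subword of $\zeta^{[n]}(b)$ for some $b\in\mathcal A$, $n\ge1$, let $T$ be the left shift, and let $\sigma^n\mathbf a=(\zeta_{n+j})_{j\ge1}$. Assume: - (A1′) there is a finite word $\mathbf q=\mathbf q_1\dots\mathbf q_r$ of substitutions with ${\sf S}_{\mathbf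 q_1}\cdots{\sf S}_{\mathbf q_r}$ strictly positive such that for every $\varepsilon\in(0,1)$ there is $n_0$ such that for all $n\ge n_0$ the word $\mathbf q$ is a subword of $\zeta_{\lfloor n(1-\varepsilon)\rfloor+1},\dots,\zeta_n$; - (A2) the limit $\lambda_{\mathbf a}=\lim_{n\to\infty}\frac1n\log\|{\sf S}^{[n]}\|$ exists and is finite; - (A3) $\lim_{n\to\infty}\frac1n\log(1+\|{\sf S}_n\|)=0$; - $X_{\mathbf a}$ contains no $T$-periodic point; - $\mathbf a$ is recognizable: for all $n\ge1$ and $x\in X_{\mathbf a}$ there is only one pair $(y,k)$ with $x=T^k(\zeta^{[n]}(y))$, $y\in X_{\sigma^n\mathbf a}$, $0\le k<|\zeta^{[n]}(y_0)|$. Let $\mu$ be the (unique) $T$-invariant Borel probability measure on $X_{\mathbf a}$, let $\vec s=(s_b)_{b\in\mathcal A}$ be a vector with positive coordinates, and let $(\mathfrak X^{\vec s}_{\mathbf a},\widetilde\mu,h_t)$ be the suspension flow over $(X_{\mathbf a},\mu,T)$ with roof function $x\mapsto s_{x_0}$, where $\mathfrak X^{\vec s}_{\mathbf a}=\{(x,t):x\in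 X_{\mathbf a},\ 0\le t<s_{x_0}\}$ and $\widetilde\mu$ is the restriction of $\mu\times$Lebesgue. For $f\in L^2(\widetilde\mu)$ the spectral measure $\sigma_f$ is the finite positive Borel measure on $\mathbb R$ with $\int e^{2\pi i\omega t}\,d\sigma_f(\omega)=\langle f\circ h_t,f\rangle_{L^2(\widetilde\mu)}$ for all $t\in\mathbb R$. A cylindrical function is a function of the form $f(x,t)=\psi_{x_0}(t)$, where $\psi_b:[0,s_b]\to\mathbb C$ is Lipschitz for each $b\in\mathcal A$. For a substitution $\zeta$ with $\zeta(b)=u^b_1\dots u^b_{|\zeta(b)|}$ and $\xi\in\mathbb R^m$, let $\mathscr M_\zeta(\xi)$ be the $m\times m$ matrix with entries $$\mathscr M_\zeta(\xi)_{b,c}=\sum_{j\,:\,u^b_j=c}\exp\Bigl(-2\pi i\sum_{k=1}^{j-1}\xi_{u^b_k}\Bigr),$$ and let $\mathscr M_{\mathbf a}(\xi,n)=\mathscr M_{\zeta_n}\bigl(({\sf S}^{[n-1]})^t\xi\bigr)\cdots\mathscr M_{\zeta_2}\bigl({\sf S}_1^t\xi\bigr)\,\mathscr M_{\zeta_1}(\xi)$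 for $n\ge1$. Let $\chi^+_{\mathbf a,\xi}=\limsup_{n\to\infty}\frac1n\log\|\mathscr M_{\mathbf a}(\xi,n)\|\in[-\infty,\infty]$, with $\log0=-\infty$. Then: (i) $\chi^+_{\mathbf a,\omega\vec s}\le\frac12\lambda_{\mathbf a}$ for Lebesgue-a.e. $\omega\in\mathbb R$; and for every cylindrical function $f$, $\chi^+_{\mathbf a,\omega\vec s}\ge\frac12\lambda_{\mathbf a}$ for $\sigma_f$-a.e. $\omega\in\mathbb R$. (ii) If $\chi^+_{\mathbf a,\omega\vec s}<\frac12\lambda_{\mathbf a}$ for Lebesgue-a.e. $\omega\in\mathbb R$, then for every cylindrical function $f$ the spectral measure $\sigma_f$ is singular with respect to Lebesgue measure. (iii) If $\chi^+_{\mathbf a,\omega\vec s}<\frac12\lambda_{\mathbf a}$ for Lebesgue-a.e. $\omega\in\mathbb R$ and, moreover, for every $\ell\ge1$ the function $\omega\mapsto\det\mathscr M_{\mathbf a}(\omega\vec s,\ell)$ is not identically zero on $\mathbb R$, then the flow $(\mathfrak X^{\vec s}_{\mathbf a},\widetilde\mu,h_t)$ has purely singular spectrum: $\sigma_f$ is singular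 with respect to Lebesgue measure for every $f\in L^2(\widetilde\mu)$. -/

import Mathlib

open MeasureTheory Filter Topology

namespace SAdic

noncomputable section

/-- A substitution on the alphabet `A`: a map from letters to non-empty finite words. -/
@[ext]
structure Substitution (A : Type*) where
  /-- the word `ζ(b)` -/
  word : A → List A
  word_ne_nil : ∀ b, word b ≠ []

namespace Substitution

variable {A : Type*}

/-- The identity substitution `b ↦ b`. -/
def one : Substitution A where
  word b := [b]
  word_ne_nil b := by simp

/-- Composition: `(ζ ∘ η)(b) = ζ(η(b))`, where `ζ` acts on words by concatenation. -/
def comp (ζ η : Substitution A) : Substitution A where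
  word b := (η.word b).flatMap ζ.word
  word_ne_nil b := by
    obtain ⟨c, hc⟩ := List.exists_mem_of_ne_nil _ (η.word_ne_nil b)
    intro h
    exact ζ.word_ne_nil c (List.flatMap_eq_nil_iff.1 h c hc)

/-- The class `𝔄`: every letter occurs in some `ζ(b)`, and some `ζ(b)` has length at least two. -/
def IsAdmissible (ζ : Substitution A) : Prop :=
  (∀ c, ∃ b, c ∈ ζ.word b) ∧ ∃ b, 1 < (ζ.word b).length

/-- The substitution matrix: `S_ζ(i, j)` is the number of letters `i` in the word `ζ(j)`. -/
def matrix [DecidableEq A] (ζ : Substitution A) : Matrix A A ℝ :=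
  Matrix.of fun i j => (((ζ.word j).count i : ℕ) : ℝ)

theorem lt_length_flatMap_range (w : ℕ → List A) (hw : ∀ i, w i ≠ []) (k : ℕ) :
    k < ((List.range (k + 1)).flatMap w).length := by
  induction k with
  | zero => simpa [List.length_pos_iff] using hw 0
  | succ k ih =>
    rw [List.range_succ, List.flatMap_append, List.length_append]
    have := List.length_pos_iff.2 (hw (k + 1))
    simp only [List.flatMap_cons, List.flatMap_nil, List.append_nil]
    omega

/-- The action on two-sided sequences,
`ζ(… x₋₁ . x₀ x₁ …) = … ζ(x₋₁) . ζ(x₀) ζ(x₁) …`. For `k ≥ 0` the letter at position `k` is the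
`k`-th letter of `ζ(x₀) ζ(x₁) ⋯ ζ(x_k)`; the letter at position `-(k+1)` is the `k`-th letter of
the left half read from right to left. -/
def apply (ζ : Substitution A) (x : ℤ → A) : ℤ → A
  | Int.ofNat k =>
    ((List.range (k + 1)).flatMap fun i : ℕ => ζ.word (x (i : ℤ)))[k]'
      (lt_length_flatMap_range _ (fun _ => ζ.word_ne_nil _) k)
  | Int.negSucc k =>
    ((List.range (k + 1)).flatMap fun i : ℕ => (ζ.word (x (Int.negSucc i))).reverse)[k]'
      (lt_length_flatMap_range _ (fun _ => by simpa using ζ.word_ne_nil _) k)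

end Substitution

variable {A : Type*}

/-- For a sequence of substitutions `a = (ζ₁, ζ₂, …)`, with `ζ_{k+1} = a k`, this is the
composition `ζ^{[n]} = ζ₁ ∘ ⋯ ∘ ζ_n`. -/
def iter (a : ℕ → Substitution A) : ℕ → Substitution A
  | 0 => Substitution.one
  | n + 1 => (iter a n).comp (a n)

/-- `T^k`, where `T` is the left shift on two-sided sequences. -/
def shift (k : ℤ) (x : ℤ → A) : ℤ → A := fun n => x (n + k)

/-- The `S`-adic space `X_a`: the two-sided sequences all of whose finite subwords are subwords of
`ζ^{[n]}(b)` for some letter `b` and some `n ≥ 1`. -/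
def space (a : ℕ → Substitution A) : Set (ℤ → A) :=
  {x | ∀ (i : ℤ) (l : ℕ), ∃ n ≥ 1, ∃ b,
    (List.ofFn fun j : Fin l => x (i + (j : ℕ))) <:+: (iter a n).word b}

/-- `X_a` contains no periodic point of the shift. -/
def IsAperiodic (a : ℕ → Substitution A) : Prop :=
  ∀ x ∈ space a, ∀ p : ℕ, 0 < p → shift p x ≠ x

/-- Recognizability: for all `n ≥ 1` and `x ∈ X_a` the representation `x = T^k(ζ^{[n]}(y))` with
`y ∈ X_{σ^n a}` and `0 ≤ k < |ζ^{[n]}(y₀)|` is unique. -/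
def IsRecognizable (a : ℕ → Substitution A) : Prop :=
  ∀ n ≥ 1, ∀ x ∈ space a, ∀ y ∈ space (fun j => a (n + j)), ∀ z ∈ space (fun j => a (n + j)),
    ∀ k l : ℕ, k < ((iter a n).word (y 0)).length → l < ((iter a n).word (z 0)).length →
      x = shift k ((iter a n).apply y) → x = shift l ((iter a n).apply z) → y = z ∧ k = l

section Matrices

variable [Fintype A]

/-- The matrix 1-norm: the maximal absolute column sum. -/
def matrixNorm {R : Type*} [NormedRing R] (M : Matrix A A R) : NNReal :=
  Finset.univ.sup fun j => ∑ i, ‖M i j‖₊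

variable [DecidableEq A]

/-- Condition (A1'): there is a word `q = q₁ … q_r` of substitutions with strictly positive matrix
`S_q = S_{q₁} ⋯ S_{q_r}` such that for every `ε ∈ (0, 1)` and all large `n`, the word `q` is a
subword of `ζ_{⌊n(1-ε)⌋+1}, …, ζ_n`. -/
def ConditionA1' (a : ℕ → Substitution A) : Prop :=
  ∃ q : List (Substitution A), q ≠ [] ∧ (∀ i j, 0 < (q.map Substitution.matrix).prod i j) ∧
    ∀ ε : ℝ, 0 < ε → ε < 1 → ∃ n₀ : ℕ, ∀ n ≥ n₀,
      ∃ k : ℕ, ⌊(n : ℝ) * (1 - ε)⌋₊ ≤ k ∧ k + q.length ≤ n ∧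
        ∀ (i : ℕ) (hi : i < q.length), a (k + i) = q[i]

/-- Condition (A2), with `lam` the value of the limit:
`(1/n) log ‖S^{[n]}‖ → lam`, where `S^{[n]}` is the matrix of `ζ^{[n]}`. -/
def ConditionA2 (a : ℕ → Substitution A) (lam : ℝ) : Prop :=
  Tendsto (fun n : ℕ => Real.log (matrixNorm (iter a n).matrix) / n) atTop (𝓝 lam)

/-- Condition (A3): `(1/n) log (1 + ‖S_n‖) → 0`. -/
def ConditionA3 (a : ℕ → Substitution A) : Prop :=
  Tendsto (fun n : ℕ => Real.log (1 + matrixNorm (a n).matrix) / ((n : ℝ) + 1)) atTop (𝓝 0)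

/-- The matrix function `ℳ_ζ(ξ)`: if `ζ(b) = u₁ … u_r`, its `(b, c)` entry is
`∑_{j : u_j = c} exp(-2πi (ξ_{u₁} + ⋯ + ξ_{u_{j-1}}))`. -/
def spectralMatrix (ζ : Substitution A) (ξ : A → ℝ) : Matrix A A ℂ :=
  Matrix.of fun b c => ∑ j : Fin (ζ.word b).length,
    if (ζ.word b)[j] = c then
      Complex.exp (-2 * Real.pi * Complex.I * ((((ζ.word b).take j).map ξ).sum : ℝ))
    else 0

/-- The spectral cocycle
`ℳ_a(ξ, n) = ℳ_{ζ_n}((S^{[n-1]})ᵗ ξ) ⋯ ℳ_{ζ₂}((S_{ζ₁})ᵗ ξ) ℳ_{ζ₁}(ξ)`. -/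
def cocycle (a : ℕ → Substitution A) (ξ : A → ℝ) : ℕ → Matrix A A ℂ
  | 0 => 1
  | n + 1 => spectralMatrix (a n) (Matrix.mulVec (iter a n).matrix.transpose ξ) * cocycle a ξ n

/-- The pointwise upper Lyapunov exponent `χ⁺_{a,ξ} = limsup (1/n) log ‖ℳ_a(ξ, n)‖`, an extended
real number, with `log 0 = -∞`. -/
def upperLyapunov (a : ℕ → Substitution A) (ξ : A → ℝ) : EReal :=
  limsup (fun n : ℕ => ENNReal.log (matrixNorm (cocycle a ξ n) : ENNReal) / (n : EReal)) atTop

end Matrices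

/-- `μ` is a shift-invariant Borel probability measure on `X_a`. -/
structure IsInvariantProbability [MeasurableSpace A] (a : ℕ → Substitution A)
    (μ : Measure (ℤ → A)) : Prop where
  prob : IsProbabilityMeasure μ
  invariant : MeasurePreserving (shift 1) μ μ
  ae_mem : ∀ᵐ x ∂μ, x ∈ space a

/-- The Birkhoff sums of the roof function `x ↦ s_{x₀}`: `∑_{0 ≤ i < n} s_{x_i}` for `n ≥ 0` and
`-∑_{n ≤ i < 0} s_{x_i}` for `n < 0`. -/
def roofSum (s : A → ℝ) (x : ℤ → A) (n : ℤ) : ℝ :=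
  ∑ i ∈ Finset.Ico 0 n, s (x i) - ∑ i ∈ Finset.Ico n 0, s (x i)

/-- The suspension flow `h_t` under the roof function `x ↦ s_{x₀}`: the point `(x, u)` moves up
with unit speed, `(x, s_{x₀})` being identified with `(T x, 0)`. So
`h_t(x, u) = (T^n x, u + t - S_n(x))`, where `n` is the largest integer whose roof sum `S_n(x)`
is at most `u + t`. -/
def flow (s : A → ℝ) (t : ℝ) (p : (ℤ → A) × ℝ) : (ℤ → A) × ℝ :=
  let n : ℤ := sSup {n : ℤ | roofSum s p.1 n ≤ p.2 + t}
  (shift n p.1, p.2 + t - roofSum s p.1 n)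

/-- The flow-invariant measure of the suspension of `μ`: the restriction of `μ × Lebesgue` to the
region `0 ≤ t < s_{x₀}`. -/
def suspensionMeasure [MeasurableSpace A] (s : A → ℝ) (μ : Measure (ℤ → A)) :
    Measure ((ℤ → A) × ℝ) :=
  (μ.prod volume).restrict {p | 0 ≤ p.2 ∧ p.2 < s (p.1 0)}

/-- `ψ_b` is Lipschitz on `[0, s_b]` for every letter `b`. -/
def IsLipFamily (s : A → ℝ) (ψ : A → ℝ → ℂ) : Prop :=
  ∀ b, ∃ K : NNReal, LipschitzOnWith K (ψ b) (Set.Icc 0 (s b))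

/-- The cylindrical function `f(x, t) = ∑_b 1_{[b]}(x) ψ_b(t)`. -/
def cylindrical (ψ : A → ℝ → ℂ) (p : (ℤ → A) × ℝ) : ℂ := ψ (p.1 0) p.2

/-- `σ` is the spectral measure of `f` for the flow `h` on `(Y, ν)`: the finite positive Borel
measure on `ℝ` with `∫ exp(2πiωt) dσ(ω) = ⟨f ∘ h_t, f⟩` in `L²(ν)` for all real `t`. -/
def IsSpectralMeasure {Y : Type*} [MeasurableSpace Y] (ν : Measure Y) (h : ℝ → Y → Y)
    (f : Y → ℂ) (σ : Measure ℝ) : Prop :=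
  IsFiniteMeasure σ ∧ ∀ t : ℝ,
    ∫ ω : ℝ, Complex.exp (2 * Real.pi * Complex.I * ω * t) ∂σ =
      ∫ y, f (h t y) * (starRingEnd ℂ) (f y) ∂ν

/-- The flow `h` on `(Y, ν)` has purely singular spectrum: the spectral measure of every function
in `L²(ν)` is singular with respect to Lebesgue measure. -/
def HasPurelySingularSpectrum {Y : Type*} [MeasurableSpace Y] (ν : Measure Y)
    (h : ℝ → Y → Y) : Prop :=
  ∀ f : Y → ℂ, MemLp f 2 ν → ∀ σ : Measure ℝ, IsSpectralMeasure ν h f σ → σ ⟂ₘ volume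

end

end SAdic

/-!
The proof links three quantities: the growth of the spectral cocycle at a frequency `ω`, the growth
of the twisted integrals `∫₀^R exp(-2πiωt) f(h_t y) dt`, and the mass that the spectral measure of
`f` gives to the interval of radius `1/(6R)` around `ω`. That mass is at most `4/R²` times the mean
square of the twisted integral (`measure_closedBall_le`, by positivity of the Fejér kernel).

*Upper bound for Lebesgue almost every frequency* (`ae_upperLyapunov_le`). An entry of the cocycle
at time `n` is a trigonometric polynomial in `ω` with separated frequencies and coefficients `0` or
`1`, with one term for each letter of a word of length at most `‖S^{[n]}‖`. Its Gaussian mean square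
is therefore `O(‖S^{[n]}‖)`, and the Borel–Cantelli lemma gives the exponent `lam / 2`.

*Lower bound for spectral almost every frequency* (`ae_le_upperLyapunov`). The integral of a
cylindrical function along an orbit is a twisted sum over a word of the space, up to the two
incomplete letters at its ends. Such a word splits into words `ζ^{[k]}(c)` of decreasing levels, on
which the twisted sums are entries of the cocycle applied to a vector. Conditions (A1'), (A2), (A3)
give all words of level `k` a length of at least `exp(k lam - o(k))` and the words `ζ_k(c)` a length
of at most `exp(o(k))` (`HasGrowth`); so an exponent below `lam / 2` makes the twisted integrals
`o(R^{1/2})` along a sequence of times (`eventually_normSq_twistedIntegral_le`), and the spectral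
measure of the intervals of radius `r` around `ω` is then `o(r)`. By the differentiation theorem
these `ω` form a null set for the spectral measure (`ae_notMem_of_measure_closedBall_le`).
Singularity of the spectral measures of cylindrical functions follows at once.

*Arbitrary square-integrable functions* (`hasPurelySingularSpectrum`). By recognizability each point
of the space has a well-defined label of level `l`: a letter `c` and a position in the word
`ζ^{[l]}(c)`. The argument above applies to bounded functions of the label and of the height, with
the sequence `σ^l a` in place of `a` (`isAdapted_label`); where the cocycle at time `l` is
invertible, its exponent for `σ^l a` is no larger than the exponent for `a`
(`upperLyapunov_shift_lt`), and its determinant, being analytic in `ω`, vanishes almost nowhere.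
These functions are dense in `L²`, as most points lie far from the ends of the words of a high
level (`exists_labelled_approx`). If `g` is such a function, then the density of the spectral
measure of `f` has Gaussian integral at most a constant times `‖f - g‖²`
(`lintegral_gauss_mul_rnDeriv_le`, by Fatou's lemma and an averaged Plancherel bound); hence it
vanishes almost everywhere.
-/

namespace SAdic

noncomputable section

/-! ### Twisted sums over words and the spectral cocycle -/

/-- The phase `exp(-2πix)`. -/
def phase (x : ℝ) : ℂ := Complex.exp (-2 * Real.pi * Complex.I * (x : ℝ))

theorem phase_zero : phase 0 = 1 := by simp [phase]

theorem phase_add (x y : ℝ) : phase (x + y) = phase x * phase y := by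
  rw [phase, phase, phase, ← Complex.exp_add]; push_cast; ring_nf

theorem norm_phase (x : ℝ) : ‖phase x‖ = 1 := by
  have : -2 * Real.pi * Complex.I * (x : ℝ) = ((-2 * Real.pi * x : ℝ) : ℂ) * Complex.I := by
    push_cast; ring
  rw [phase, this, Complex.norm_exp_ofReal_mul_I]

theorem conj_phase (x : ℝ) : (starRingEnd ℂ) (phase x) = phase (-x) := by
  rw [phase, phase, ← Complex.exp_conj]
  simp [Complex.conj_ofNat]

theorem continuous_phase : Continuous phase := by unfold phase; fun_prop

theorem continuous_phase_mul (y : ℝ) : Continuous fun x : ℝ => phase (x * y) :=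
  continuous_phase.comp (continuous_id.mul continuous_const)

/-- The twisted sum `∑_j exp(-2πi (τ(w₁) + ⋯ + τ(w_{j-1}))) v(w_j)` over a word `w`, where `τ`
gives the lengths of the letters and `v` their weights. -/
def twist {L : Type*} (τ : L → ℝ) (v : L → ℂ) : List L → ℂ
  | [] => 0
  | d :: w => v d + phase (τ d) * twist τ v w

section Twist

variable {A L : Type*} (τ : L → ℝ) (v : L → ℂ)

theorem twist_append (w w' : List L) :
    twist τ v (w ++ w') = twist τ v w + phase (w.map τ).sum * twist τ v w' := by
  induction w with
  | nil => simp [twist, phase_zero]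
  | cons d w ih =>
    simp only [List.cons_append, twist, ih, List.map_cons, List.sum_cons, phase_add]
    ring

theorem twist_flatMap (β : A → List L) (w : List A) :
    twist τ v (w.flatMap β) =
      twist (fun c => ((β c).map τ).sum) (fun c => twist τ v (β c)) w := by
  induction w with
  | nil => simp [twist]
  | cons d w ih => simp only [List.flatMap_cons, twist_append, twist, ih]

theorem norm_twist_append_le (w w' : List L) :
    ‖twist τ v (w ++ w')‖ ≤ ‖twist τ v w‖ + ‖twist τ v w'‖ := by
  rw [twist_append]
  refine (norm_add_le _ _).trans ?_
  rw [norm_mul, norm_phase, one_mul]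

theorem norm_twist_right_le (w w' : List L) :
    ‖twist τ v w'‖ ≤ ‖twist τ v (w ++ w')‖ + ‖twist τ v w‖ := by
  have h : phase (w.map τ).sum * twist τ v w' = twist τ v (w ++ w') - twist τ v w := by
    rw [twist_append]; ring
  have h2 : ‖twist τ v w'‖ = ‖phase (w.map τ).sum * twist τ v w'‖ := by
    rw [norm_mul, norm_phase, one_mul]
  rw [h2, h]
  exact norm_sub_le _ _

theorem norm_twist_le_mul_length {V : ℝ} (w : List L) (hv : ∀ d ∈ w, ‖v d‖ ≤ V) :
    ‖twist τ v w‖ ≤ w.length * V := by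
  induction w with
  | nil => simp [twist]
  | cons d w ih =>
    have h1 := ih fun d hd => hv d (List.mem_cons_of_mem _ hd)
    have h2 := hv d List.mem_cons_self
    have h3 := norm_add_le (v d) (phase (τ d) * twist τ v w)
    rw [norm_mul, norm_phase, one_mul] at h3
    simp only [twist, List.length_cons]
    push_cast
    linarith

theorem twist_eq_sum [Fintype L] [DecidableEq L] (w : List L) :
    twist τ v w = ∑ d, twist τ (Pi.single d 1) w * v d := by
  induction w with
  | nil => simp [twist]
  | cons d w ih =>
    simp only [twist, add_mul, Finset.sum_add_distrib, mul_assoc, ← Finset.mul_sum, ← ih]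
    congr 1
    rw [Finset.sum_eq_single d]
    · simp
    · intro b _ hb
      simp [hb.symm]
    · simp

theorem sum_fin_eq_twist [DecidableEq L] (w : List L) (c : L) :
    ∑ j : Fin w.length, (if w[j] = c then phase ((w.take j).map τ).sum else 0) =
      twist τ (Pi.single c 1) w := by
  induction w with
  | nil => simp [twist]
  | cons d w ih =>
    rw [twist, ← ih]
    simp only [List.length_cons]
    rw [Fin.sum_univ_succ, Finset.mul_sum]
    congr 1
    · simp [Pi.single_apply, phase_zero]
    · refine Finset.sum_congr rfl fun j _ => ?_
      have h1 : (d :: w)[j.succ] = w[j] := by simp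
      have h2 : (d :: w).take j.succ = d :: w.take j := by simp
      rw [h1, h2, List.map_cons, List.sum_cons, phase_add]
      split_ifs <;> simp

end Twist

section Iter

variable {A : Type*}

theorem Substitution.comp_assoc (ζ η θ : Substitution A) :
    (ζ.comp η).comp θ = ζ.comp (η.comp θ) := by
  ext1
  funext b
  simp [Substitution.comp, List.flatMap_assoc]

theorem Substitution.comp_one (ζ : Substitution A) : ζ.comp Substitution.one = ζ := by
  ext1
  funext b
  simp [Substitution.comp, Substitution.one]

theorem iter_add (a : ℕ → Substitution A) (l n : ℕ) :
    iter a (l + n) = (iter a l).comp (iter (fun j => a (l + j)) n) := by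
  induction n with
  | zero => exact (Substitution.comp_one _).symm
  | succ n ih => rw [← add_assoc, iter, ih, Substitution.comp_assoc]; rfl

end Iter

section Norm

variable {A : Type*} [Fintype A] {R : Type*} [NormedRing R]

theorem norm_apply_le_matrixNorm (M : Matrix A A R) (i j : A) : ‖M i j‖ ≤ matrixNorm M := by
  have h1 : ‖M i j‖₊ ≤ ∑ i, ‖M i j‖₊ :=
    Finset.single_le_sum (f := fun i => ‖M i j‖₊) (fun _ _ => zero_le) (Finset.mem_univ i)
  have h2 : ∑ i, ‖M i j‖₊ ≤ matrixNorm M :=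
    Finset.le_sup (f := fun j => ∑ i, ‖M i j‖₊) (Finset.mem_univ j)
  exact_mod_cast h1.trans h2

theorem matrixNorm_le_sum (M : Matrix A A R) :
    (matrixNorm M : ℝ) ≤ ∑ j, ∑ i, ‖M i j‖ := by
  have : matrixNorm M ≤ ∑ j, ∑ i, ‖M i j‖₊ := by
    refine Finset.sup_le fun j _ => ?_
    exact Finset.single_le_sum (f := fun j => ∑ i, ‖M i j‖₊) (fun _ _ => zero_le)
      (Finset.mem_univ j)
  have h := NNReal.coe_le_coe.2 this
  push_cast at h
  exact h

theorem matrixNorm_mul_le (M N : Matrix A A R) :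
    matrixNorm (M * N) ≤ matrixNorm M * matrixNorm N := by
  refine Finset.sup_le fun j _ => ?_
  calc ∑ i, ‖(M * N) i j‖₊ ≤ ∑ i, ∑ k, ‖M i k‖₊ * ‖N k j‖₊ := by
        refine Finset.sum_le_sum fun i _ => ?_
        rw [Matrix.mul_apply]
        exact (nnnorm_sum_le _ _).trans (Finset.sum_le_sum fun k _ => nnnorm_mul_le _ _)
    _ = ∑ k, (∑ i, ‖M i k‖₊) * ‖N k j‖₊ := by
        rw [Finset.sum_comm]; simp only [Finset.sum_mul]
    _ ≤ ∑ k, matrixNorm M * ‖N k j‖₊ := by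
        refine Finset.sum_le_sum fun k _ => mul_le_mul_left ?_ _
        exact Finset.le_sup (f := fun k => ∑ i, ‖M i k‖₊) (Finset.mem_univ k)
    _ = matrixNorm M * ∑ k, ‖N k j‖₊ := by rw [Finset.mul_sum]
    _ ≤ _ := by
        refine mul_le_mul_right ?_ _
        exact Finset.le_sup (f := fun k => ∑ i, ‖N i k‖₊) (Finset.mem_univ j)

end Norm

section Matrices

variable {A : Type*} [Fintype A] [DecidableEq A]

omit [Fintype A] in
theorem spectralMatrix_apply (ζ : Substitution A) (ξ : A → ℝ) (b c : A) :
    spectralMatrix ζ ξ b c = twist ξ (Pi.single c 1) (ζ.word b) :=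
  sum_fin_eq_twist ξ (ζ.word b) c

theorem twist_word (ζ : Substitution A) (ξ : A → ℝ) (v : A → ℂ) (b : A) :
    twist ξ v (ζ.word b) = ∑ c, spectralMatrix ζ ξ b c * v c := by
  rw [twist_eq_sum]
  simp only [spectralMatrix_apply]

theorem sum_map_eq_sum_count (w : List A) (ξ : A → ℝ) :
    (w.map ξ).sum = ∑ i, (w.count i : ℝ) * ξ i := by
  induction w with
  | nil => simp
  | cons d w ih =>
    rw [List.map_cons, List.sum_cons, ih]
    have : ∀ i, (((d :: w).count i : ℕ) : ℝ) * ξ i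
        = (if d = i then ξ i else 0) + (w.count i : ℝ) * ξ i := by
      intro i
      rw [List.count_cons]
      by_cases h : d = i
      · subst h; simp; ring
      · simp [h]
    simp only [this, Finset.sum_add_distrib]
    simp

theorem transpose_mulVec_eq (ζ : Substitution A) (ξ : A → ℝ) (c : A) :
    Matrix.mulVec ζ.matrix.transpose ξ c = ((ζ.word c).map ξ).sum := by
  rw [sum_map_eq_sum_count]
  rfl

theorem transpose_mulVec_eq' (ζ : Substitution A) (ξ : A → ℝ) :
    Matrix.mulVec ζ.matrix.transpose ξ = fun c => ((ζ.word c).map ξ).sum :=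
  funext (transpose_mulVec_eq ζ ξ)

theorem spectralMatrix_comp (ζ η : Substitution A) (ξ : A → ℝ) :
    spectralMatrix (ζ.comp η) ξ =
      spectralMatrix η (Matrix.mulVec ζ.matrix.transpose ξ) * spectralMatrix ζ ξ := by
  ext b c
  rw [spectralMatrix_apply, Matrix.mul_apply, transpose_mulVec_eq']
  change twist _ _ ((η.word b).flatMap ζ.word) = _
  rw [twist_flatMap, twist_word]
  simp only [spectralMatrix_apply]

omit [Fintype A] in
theorem spectralMatrix_one (ξ : A → ℝ) :
    spectralMatrix (Substitution.one : Substitution A) ξ = 1 := by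
  ext b c
  rw [spectralMatrix_apply]
  simp [Substitution.one, twist, Pi.single_apply, Matrix.one_apply]

/-- The spectral cocycle is the matrix function of the composed substitution. -/
theorem cocycle_eq (a : ℕ → Substitution A) (ξ : A → ℝ) (n : ℕ) :
    cocycle a ξ n = spectralMatrix (iter a n) ξ := by
  induction n with
  | zero => exact (spectralMatrix_one ξ).symm
  | succ n ih => rw [cocycle, ih, iter, spectralMatrix_comp]

theorem cocycle_add (a : ℕ → Substitution A) (ξ : A → ℝ) (l n : ℕ) :
    cocycle a ξ (l + n) =
      cocycle (fun j => a (l + j)) (Matrix.mulVec (iter a l).matrix.transpose ξ) n *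
        cocycle a ξ l := by
  rw [cocycle_eq, cocycle_eq, cocycle_eq, iter_add, spectralMatrix_comp]

theorem count_flatMap (w : List A) (β : A → List A) (i : A) :
    ((w.flatMap β).count i : ℝ) = ∑ d, ((β d).count i : ℝ) * (w.count d : ℝ) := by
  have h := sum_map_eq_sum_count w fun d => ((β d).count i : ℝ)
  rw [List.count_flatMap, Nat.cast_list_sum, List.map_map]
  simp only [mul_comm] at h ⊢
  exact h

theorem Substitution.matrix_comp (ζ η : Substitution A) :
    (ζ.comp η).matrix = ζ.matrix * η.matrix := by
  ext i j
  exact count_flatMap _ _ _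

omit [Fintype A] in
theorem Substitution.matrix_one : (Substitution.one : Substitution A).matrix = 1 := by
  ext i j
  simp only [Substitution.matrix, Substitution.one, Matrix.of_apply, Matrix.one_apply]
  by_cases h : i = j
  · simp [h]
  · simp [h, Ne.symm h]

theorem iter_matrix (a : ℕ → Substitution A) (n : ℕ) :
    (iter a n).matrix = ((List.range n).map fun i => (a i).matrix).prod := by
  induction n with
  | zero => exact Substitution.matrix_one
  | succ n ih => rw [iter, Substitution.matrix_comp, ih, List.range_succ]; simp

theorem sum_count_eq_length (w : List A) : ∑ i, w.count i = w.length := by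
  have h := sum_map_eq_sum_count w fun _ => 1
  simp only [mul_one, List.map_const', List.sum_replicate, nsmul_eq_mul] at h
  exact_mod_cast h.symm

theorem sum_nnnorm_matrix (ζ : Substitution A) (j : A) :
    ∑ i, ‖ζ.matrix i j‖₊ = ((ζ.word j).length : NNReal) := by
  rw [← sum_count_eq_length]
  push_cast
  refine Finset.sum_congr rfl fun i _ => ?_
  simp [Substitution.matrix]

theorem length_le_matrixNorm (ζ : Substitution A) (b : A) :
    ((ζ.word b).length : ℝ) ≤ matrixNorm ζ.matrix := by
  have h : ((ζ.word b).length : NNReal) ≤ matrixNorm ζ.matrix := by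
    rw [← sum_nnnorm_matrix]
    exact Finset.le_sup (f := fun j => ∑ i, ‖ζ.matrix i j‖₊) (Finset.mem_univ b)
  exact_mod_cast h

theorem exists_length_eq_matrixNorm [Nonempty A] (ζ : Substitution A) :
    ∃ b, (matrixNorm ζ.matrix : ℝ) = (ζ.word b).length := by
  obtain ⟨b, -, hb⟩ := Finset.exists_mem_eq_sup Finset.univ Finset.univ_nonempty
    fun j => ∑ i, ‖ζ.matrix i j‖₊
  refine ⟨b, ?_⟩
  rw [sum_nnnorm_matrix] at hb
  rw [matrixNorm, hb]
  simp

theorem one_le_matrixNorm [Nonempty A] (ζ : Substitution A) : 1 ≤ (matrixNorm ζ.matrix : ℝ) := by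
  obtain ⟨b⟩ := ‹Nonempty A›
  refine le_trans ?_ (length_le_matrixNorm ζ b)
  exact_mod_cast List.length_pos_iff.2 (ζ.word_ne_nil b)

theorem norm_twist_word_le (ζ : Substitution A) (ξ : A → ℝ) (v : A → ℂ) {V : ℝ}
    (hv : ∀ c, ‖v c‖ ≤ V) (b : A) :
    ‖twist ξ v (ζ.word b)‖ ≤ Fintype.card A * matrixNorm (spectralMatrix ζ ξ) * V := by
  rw [twist_word]
  refine (norm_sum_le _ _).trans ?_
  calc ∑ c, ‖spectralMatrix ζ ξ b c * v c‖ ≤ ∑ _c : A, matrixNorm (spectralMatrix ζ ξ) * V := by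
        refine Finset.sum_le_sum fun c _ => ?_
        rw [norm_mul]
        exact mul_le_mul (norm_apply_le_matrixNorm _ _ _) (hv c) (norm_nonneg _)
          (NNReal.coe_nonneg _)
    _ = _ := by simp [mul_assoc]

end Matrices

/-! ### Upper Lyapunov exponents as exponential bounds -/

theorem log_div_natCast_le_iff (x : NNReal) {n : ℕ} (hn : 0 < n) (β : ℝ) :
    ENNReal.log (x : ENNReal) / (n : EReal) ≤ (β : EReal) ↔ (x : ℝ) ≤ Real.exp (n * β) := by
  have hn' : (0 : EReal) < (n : EReal) := by exact_mod_cast hn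
  rw [EReal.div_le_iff_le_mul hn' (EReal.natCast_ne_top n), ← EReal.exp_le_exp_iff,
    ENNReal.exp_log]
  have : ((n : EReal) * (β : EReal)) = ((n * β : ℝ) : EReal) := by
    rw [EReal.coe_mul]; rfl
  rw [this, EReal.exp_coe, ENNReal.le_ofReal_iff_toReal_le ENNReal.coe_ne_top (Real.exp_pos _).le]
  simp

section

variable {A : Type*} [Fintype A] [DecidableEq A] (a : ℕ → Substitution A) (ξ : A → ℝ)

theorem upperLyapunov_le_of_eventually_le {β : ℝ}
    (h : ∀ᶠ n : ℕ in atTop, (matrixNorm (cocycle a ξ n) : ℝ) ≤ Real.exp (n * β)) :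
    upperLyapunov a ξ ≤ (β : EReal) := by
  refine limsup_le_of_le (by isBoundedDefault) ?_
  filter_upwards [h, eventually_gt_atTop 0] with n hn h0
  exact (log_div_natCast_le_iff _ h0 β).2 hn

theorem exists_eventually_le_of_upperLyapunov_lt {β : ℝ}
    (h : upperLyapunov a ξ < (β : EReal)) :
    ∃ β' < β, ∀ᶠ n : ℕ in atTop, (matrixNorm (cocycle a ξ n) : ℝ) ≤ Real.exp (n * β') := by
  obtain ⟨β', h1, h2⟩ := EReal.lt_iff_exists_real_btwn.1 h
  refine ⟨β', by exact_mod_cast h2, ?_⟩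
  filter_upwards [eventually_lt_of_limsup_lt h1, eventually_gt_atTop 0] with n hn h0
  exact (log_div_natCast_le_iff _ h0 β').1 hn.le

/-- An eventual exponential bound on the cocycle holds for all times up to a constant factor. -/
theorem exists_forall_le_of_upperLyapunov_lt {β : ℝ}
    (h : upperLyapunov a ξ < (β : EReal)) :
    ∃ β' < β, ∃ C : ℝ, ∀ n : ℕ, (matrixNorm (cocycle a ξ n) : ℝ) ≤ C * Real.exp (n * β') := by
  obtain ⟨β', hβ, h⟩ := exists_eventually_le_of_upperLyapunov_lt a ξ h
  obtain ⟨N, hN⟩ := eventually_atTop.1 h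
  refine ⟨β', hβ, 1 + ∑ n ∈ Finset.range N,
    (matrixNorm (cocycle a ξ n) : ℝ) / Real.exp (n * β'), fun n => ?_⟩
  have hpos : ∀ n ∈ Finset.range N,
      0 ≤ (matrixNorm (cocycle a ξ n) : ℝ) / Real.exp (n * β') :=
    fun n _ => div_nonneg (NNReal.coe_nonneg _) (Real.exp_pos _).le
  rw [← div_le_iff₀ (Real.exp_pos _)]
  by_cases hn : n < N
  · have := Finset.single_le_sum hpos (Finset.mem_range.2 hn)
    linarith
  · have h1 : (matrixNorm (cocycle a ξ n) : ℝ) / Real.exp (n * β') ≤ 1 :=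
      (div_le_one (Real.exp_pos _)).2 (hN n (not_lt.1 hn))
    have := Finset.sum_nonneg hpos
    linarith

end

/-! ### Mean squares of trigonometric polynomials with a Gaussian weight -/

/-- The Gaussian weight `exp(-πx²)`, which is its own Fourier transform. -/
def gauss (x : ℝ) : ℝ := Real.exp (-Real.pi * x ^ 2)

theorem gauss_pos (x : ℝ) : 0 < gauss x := Real.exp_pos _

theorem continuous_gauss : Continuous gauss := by unfold gauss; fun_prop

theorem integrable_gauss : Integrable gauss := integrable_exp_neg_mul_sq Real.pi_pos

theorem integral_gauss : ∫ x, gauss x = 1 := by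
  have := integral_gaussian Real.pi
  rw [div_self Real.pi_ne_zero, Real.sqrt_one] at this
  exact this

theorem integrable_phase_mul_gauss (τ : ℝ) :
    Integrable fun ω : ℝ => phase (ω * τ) * (gauss ω : ℂ) := by
  refine integrable_gauss.ofReal.bdd_mul (c := 1) (continuous_phase_mul τ).aestronglyMeasurable ?_
  exact ae_of_all _ fun ω => (norm_phase _).le

theorem integral_phase_mul_gauss (τ : ℝ) :
    ∫ ω : ℝ, phase (ω * τ) * (gauss ω : ℂ) = (gauss τ : ℂ) := by
  have h := fourierIntegral_gaussian (b := (Real.pi : ℂ)) (by simpa using Real.pi_pos)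
    ((-2 * Real.pi * τ : ℝ) : ℂ)
  have hpi : (Real.pi : ℂ) ≠ 0 := by exact_mod_cast Real.pi_ne_zero
  rw [div_self hpi, Complex.one_cpow, one_mul] at h
  have h2 : (gauss τ : ℂ) = Complex.exp (-((-2 * Real.pi * τ : ℝ) : ℂ) ^ 2 / (4 * Real.pi)) := by
    rw [gauss, Complex.ofReal_exp]
    congr 1
    push_cast
    field_simp
    ring
  rw [h2, ← h]
  refine integral_congr_ae (ae_of_all _ fun ω => ?_)
  simp only [phase, gauss, Complex.ofReal_exp]
  push_cast
  congr 2
  ring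

theorem normSq_sum_phase {ι : Type*} [Fintype ι] (c : ι → ℂ) (τ : ι → ℝ) (ω : ℝ) :
    ((‖∑ i, c i * phase (ω * τ i)‖ ^ 2 : ℝ) : ℂ) =
      ∑ i, ∑ j, c i * (starRingEnd ℂ) (c j) * phase (ω * (τ i - τ j)) := by
  rw [Complex.ofReal_pow, ← Complex.mul_conj', map_sum, Finset.sum_mul_sum]
  refine Finset.sum_congr rfl fun i _ => Finset.sum_congr rfl fun j _ => ?_
  rw [map_mul, conj_phase, mul_sub, sub_eq_add_neg, phase_add]
  ring

theorem integrable_normSq_mul_gauss {ι : Type*} [Fintype ι] (c : ι → ℂ) (τ : ι → ℝ) :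
    Integrable fun ω : ℝ => ‖∑ i, c i * phase (ω * τ i)‖ ^ 2 * gauss ω := by
  have hcont : Continuous fun ω : ℝ => ‖∑ i, c i * phase (ω * τ i)‖ ^ 2 :=
    (continuous_norm.comp
      (continuous_finsetSum _ fun i _ => continuous_const.mul (continuous_phase_mul _))).pow 2
  refine integrable_gauss.bdd_mul (c := (∑ i, ‖c i‖) ^ 2) hcont.aestronglyMeasurable
    (ae_of_all _ fun ω => ?_)
  rw [Real.norm_of_nonneg (sq_nonneg _)]
  gcongr
  refine (norm_sum_le _ _).trans (Finset.sum_le_sum fun i _ => ?_)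
  rw [norm_mul, norm_phase, mul_one]

theorem integral_normSq_mul_gauss_le {ι : Type*} [Fintype ι] (c : ι → ℂ) (hc : ∀ i, ‖c i‖ ≤ 1)
    (τ : ι → ℝ) :
    ∫ ω : ℝ, ‖∑ i, c i * phase (ω * τ i)‖ ^ 2 * gauss ω ≤ ∑ i, ∑ j, gauss (τ i - τ j) := by
  have h1 : ((∫ ω : ℝ, ‖∑ i, c i * phase (ω * τ i)‖ ^ 2 * gauss ω : ℝ) : ℂ) =
      ∑ i, ∑ j, c i * (starRingEnd ℂ) (c j) * (gauss (τ i - τ j) : ℂ) := by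
    rw [← integral_complex_ofReal]
    have : ∀ ω : ℝ, ((‖∑ i, c i * phase (ω * τ i)‖ ^ 2 * gauss ω : ℝ) : ℂ) =
        ∑ i, ∑ j, c i * (starRingEnd ℂ) (c j) * (phase (ω * (τ i - τ j)) * (gauss ω : ℂ)) := by
      intro ω
      rw [Complex.ofReal_mul, normSq_sum_phase, Finset.sum_mul]
      simp only [Finset.sum_mul, mul_assoc]
    have hint : ∀ i j, Integrable fun ω : ℝ =>
        c i * (starRingEnd ℂ) (c j) * (phase (ω * (τ i - τ j)) * (gauss ω : ℂ)) :=
      fun i j => (integrable_phase_mul_gauss _).const_mul _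
    simp only [this]
    rw [integral_finsetSum _ fun i _ => integrable_finsetSum _ fun j _ => hint i j]
    refine Finset.sum_congr rfl fun i _ => ?_
    rw [integral_finsetSum _ fun j _ => hint i j]
    refine Finset.sum_congr rfl fun j _ => ?_
    rw [integral_const_mul, integral_phase_mul_gauss]
  have h2 : 0 ≤ ∫ ω : ℝ, ‖∑ i, c i * phase (ω * τ i)‖ ^ 2 * gauss ω :=
    integral_nonneg fun ω => mul_nonneg (sq_nonneg _) (gauss_pos _).le
  rw [← Real.norm_of_nonneg h2, ← Complex.norm_real, h1]
  refine (norm_sum_le _ _).trans (Finset.sum_le_sum fun i _ => ?_)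
  refine (norm_sum_le _ _).trans (Finset.sum_le_sum fun j _ => ?_)
  rw [norm_mul, norm_mul, Complex.norm_real, Real.norm_of_nonneg (gauss_pos _).le,
    RCLike.norm_conj]
  have := mul_le_one₀ (hc i) (norm_nonneg _) (hc j)
  exact mul_le_of_le_one_left (gauss_pos _).le this

/-- Sums of the Gaussian over the differences of a `δ`-separated sequence are bounded. -/
theorem exists_sum_gauss_le {δ : ℝ} (hδ : 0 < δ) :
    ∃ C : ℝ, 0 ≤ C ∧ ∀ (N : ℕ) (τ : Fin N → ℝ),
      (∀ i j : Fin N, δ * |((i : ℕ) : ℝ) - ((j : ℕ) : ℝ)| ≤ |τ i - τ j|) →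
        ∀ i, ∑ j, gauss (τ i - τ j) ≤ C := by
  set r : ℝ := Real.exp (-(Real.pi * δ ^ 2)) with hr
  have hr0 : 0 < r := Real.exp_pos _
  have hr1 : r < 1 := by
    rw [hr, Real.exp_lt_one_iff]
    have := Real.pi_pos
    have : 0 < Real.pi * δ ^ 2 := by positivity
    linarith
  have hsum : Summable fun k : ℤ => r ^ k.natAbs := by
    rw [summable_int_iff_summable_nat_and_neg]
    constructor <;> simpa using summable_geometric_of_lt_one hr0.le hr1
  refine ⟨∑' k : ℤ, r ^ k.natAbs, tsum_nonneg fun k => by positivity, fun N τ hτ i => ?_⟩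
  let e : Fin N ↪ ℤ := ⟨fun j => (i : ℤ) - (j : ℤ), fun j k h => by
    have h : (i : ℤ) - (j : ℤ) = (i : ℤ) - (k : ℤ) := h
    ext; omega⟩
  calc ∑ j, gauss (τ i - τ j) ≤ ∑ j, r ^ (e j).natAbs := by
        refine Finset.sum_le_sum fun j _ => ?_
        rw [hr, ← Real.exp_nat_mul, gauss, Real.exp_le_exp]
        have h1 : (((e j).natAbs : ℕ) : ℝ) = |((i : ℕ) : ℝ) - ((j : ℕ) : ℝ)| := by
          rw [Nat.cast_natAbs]
          change (((|(i : ℤ) - (j : ℤ)| : ℤ)) : ℝ) = _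
          push_cast; rfl
        have h2 : (((e j).natAbs : ℕ) : ℝ) ≤ (((e j).natAbs : ℕ) : ℝ) ^ 2 := by
          exact_mod_cast Nat.le_self_pow two_ne_zero _
        have h3 := hτ i j
        rw [← h1] at h3
        have h4 : δ ^ 2 * (((e j).natAbs : ℕ) : ℝ) ^ 2 ≤ (τ i - τ j) ^ 2 := by
          rw [← sq_abs (τ i - τ j), ← mul_pow]
          gcongr
        have h5 : δ ^ 2 * (((e j).natAbs : ℕ) : ℝ) ≤ (τ i - τ j) ^ 2 :=
          (mul_le_mul_of_nonneg_left h2 (sq_nonneg δ)).trans h4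
        have h6 := mul_le_mul_of_nonneg_left h5 Real.pi_pos.le
        linarith
    _ = ∑ k ∈ Finset.univ.map e, r ^ k.natAbs := by rw [Finset.sum_map]
    _ ≤ _ := hsum.sum_le_tsum _ fun k _ => by positivity

theorem mul_sub_le_sum_take_sub {A : Type*} {s : A → ℝ} {δ : ℝ} (hs : ∀ b, δ ≤ s b)
    (w : List A) {i j : ℕ} (hij : i ≤ j) (hj : j ≤ w.length) :
    δ * ((j : ℝ) - i) ≤ ((w.take j).map s).sum - ((w.take i).map s).sum := by
  induction j, hij using Nat.le_induction with
  | base => simp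
  | succ k hk ih =>
    have h1 := ih (by omega)
    have hk' : k < w.length := by omega
    rw [List.take_succ_eq_append_getElem hk', List.map_append, List.sum_append]
    have := hs w[k]
    push_cast
    simp only [List.map_cons, List.map_nil, List.sum_cons, List.sum_nil, add_zero]
    linarith

section

variable {A : Type*} [Fintype A] [DecidableEq A]

omit [Fintype A] in
theorem spectralMatrix_smul_apply (ζ : Substitution A) (s : A → ℝ) (ω : ℝ) (b c : A) :
    spectralMatrix ζ (ω • s) b c =
      ∑ j : Fin (ζ.word b).length, (if (ζ.word b)[j] = c then (1 : ℂ) else 0) *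
        phase (ω * (((ζ.word b).take j).map s).sum) := by
  rw [spectralMatrix, Matrix.of_apply]
  refine Finset.sum_congr rfl fun j _ => ?_
  have : (((ζ.word b).take j).map (ω • s)).sum = ω * (((ζ.word b).take j).map s).sum := by
    rw [← List.sum_map_mul_left]; rfl
  rw [this]
  by_cases h : (ζ.word b)[j] = c
  · rw [if_pos h, if_pos h, one_mul]; rfl
  · rw [if_neg h, if_neg h, zero_mul]

omit [Fintype A] in
theorem integrable_normSq_spectralMatrix (ζ : Substitution A) (s : A → ℝ) (b c : A) :
    Integrable fun ω : ℝ => ‖spectralMatrix ζ (ω • s) b c‖ ^ 2 * gauss ω := by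
  simp only [spectralMatrix_smul_apply]
  exact integrable_normSq_mul_gauss _ _

omit [Fintype A] in
/-- The mean square of each entry of `ℳ_ζ(ωs)` grows at most linearly with the length of `ζ`. -/
theorem exists_integral_normSq_spectralMatrix_le {s : A → ℝ} {δ : ℝ} (hδ : 0 < δ)
    (hs : ∀ b, δ ≤ s b) :
    ∃ C : ℝ, 0 ≤ C ∧ ∀ (ζ : Substitution A) (b c : A),
      ∫ ω : ℝ, ‖spectralMatrix ζ (ω • s) b c‖ ^ 2 * gauss ω ≤ C * (ζ.word b).length := by
  obtain ⟨C, hC0, hC⟩ := exists_sum_gauss_le hδ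
  refine ⟨C, hC0, fun ζ b c => ?_⟩
  have hsep : ∀ i j : Fin (ζ.word b).length, δ * |((i : ℕ) : ℝ) - ((j : ℕ) : ℝ)| ≤
      |(((ζ.word b).take i).map s).sum - (((ζ.word b).take j).map s).sum| := by
    intro i j
    rcases le_total (i : ℕ) (j : ℕ) with h | h
    · have h1 := mul_sub_le_sum_take_sub hs (ζ.word b) h j.2.le
      have h2 : ((i : ℕ) : ℝ) ≤ ((j : ℕ) : ℝ) := by exact_mod_cast h
      rw [abs_sub_comm, abs_of_nonneg (sub_nonneg.2 h2), abs_sub_comm]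
      exact h1.trans (le_abs_self _)
    · have h1 := mul_sub_le_sum_take_sub hs (ζ.word b) h i.2.le
      have h2 : ((j : ℕ) : ℝ) ≤ ((i : ℕ) : ℝ) := by exact_mod_cast h
      rw [abs_of_nonneg (sub_nonneg.2 h2)]
      exact h1.trans (le_abs_self _)
  have h1 := integral_normSq_mul_gauss_le
    (fun j : Fin (ζ.word b).length => if (ζ.word b)[j] = c then (1 : ℂ) else 0)
    (fun i => by split_ifs <;> simp) fun j => (((ζ.word b).take j).map s).sum
  have h2 := Finset.sum_le_card_nsmul Finset.univ _ C fun i _ =>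
    hC _ (fun j : Fin (ζ.word b).length => (((ζ.word b).take j).map s).sum) hsep i
  rw [Finset.card_univ, Fintype.card_fin, nsmul_eq_mul, mul_comm] at h2
  simp only [spectralMatrix_smul_apply]
  exact h1.trans h2

/-- For Lebesgue-almost every `ω`, the cocycle grows at most at half the rate of the lengths: its
mean square over `ω` is of the order of the length, so Borel--Cantelli applies. -/
theorem ae_upperLyapunov_le (a : ℕ → Substitution A) (lam : ℝ) (hA2 : ConditionA2 a lam)
    [Nonempty A] (s : A → ℝ) (hs : ∀ b, 0 < s b) :
    ∀ᵐ ω : ℝ, upperLyapunov a (ω • s) ≤ ((lam / 2 : ℝ) : EReal) := by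
  obtain ⟨b₀, hb₀⟩ := Finite.exists_min s
  obtain ⟨C, hC0, hC⟩ := exists_integral_normSq_spectralMatrix_le (hs b₀) hb₀
  set K : ℝ := (Fintype.card A : ℝ) with hK
  have hK0 : 0 ≤ K := Nat.cast_nonneg _
  have key : ∀ ε : ℝ, 0 < ε → ∀ᵐ ω : ℝ, upperLyapunov a (ω • s) ≤ ((lam / 2 + ε : ℝ) : EReal) := by
    intro ε hε
    have hlen : ∀ᶠ n : ℕ in atTop,
        (matrixNorm (iter a n).matrix : ℝ) ≤ Real.exp (n * (lam + ε / 2)) := by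
      have h1 : ∀ᶠ n : ℕ in atTop,
          Real.log (matrixNorm (iter a n).matrix) / n < lam + ε / 2 :=
        hA2.eventually_lt_const (by linarith)
      filter_upwards [h1, eventually_gt_atTop 0] with n hn h0
      have h0' : (0 : ℝ) < n := by exact_mod_cast h0
      rw [div_lt_iff₀ h0'] at hn
      have hp : 0 < (matrixNorm (iter a n).matrix : ℝ) :=
        zero_lt_one.trans_le (one_le_matrixNorm _)
      rw [← Real.log_le_iff_le_exp hp, mul_comm]
      exact hn.le
    set h : ℕ → ℝ → ℝ := fun n ω =>
      ∑ b, ∑ c, ‖spectralMatrix (iter a n) (ω • s) b c‖ ^ 2 * gauss ω with hh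
    have hint : ∀ n, Integrable (h n) := fun n =>
      integrable_finsetSum _ fun b _ => integrable_finsetSum _ fun c _ =>
        integrable_normSq_spectralMatrix _ s b c
    have hnonneg : ∀ n ω, 0 ≤ h n ω := fun n ω => Finset.sum_nonneg fun b _ =>
      Finset.sum_nonneg fun c _ => mul_nonneg (sq_nonneg _) (gauss_pos _).le
    have hbound : ∀ n, ∫ ω, h n ω ≤ K * (K * (C * matrixNorm (iter a n).matrix)) := by
      intro n
      rw [hh, integral_finsetSum _ fun b _ => integrable_finsetSum _ fun c _ =>
        integrable_normSq_spectralMatrix _ s b c]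
      have : ∀ b ∈ (Finset.univ : Finset A),
          ∫ ω, ∑ c, ‖spectralMatrix (iter a n) (ω • s) b c‖ ^ 2 * gauss ω ≤
            K * (C * matrixNorm (iter a n).matrix) := by
        intro b _
        rw [integral_finsetSum _ fun c _ => integrable_normSq_spectralMatrix _ s b c]
        refine (Finset.sum_le_card_nsmul _ _ (C * matrixNorm (iter a n).matrix)
          fun c _ => ?_).trans ?_
        · exact (hC _ b c).trans
            (mul_le_mul_of_nonneg_left (length_le_matrixNorm _ _) hC0)
        · simp [hK]
      refine (Finset.sum_le_card_nsmul _ _ _ this).trans ?_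
      simp [hK]
    set F : ℕ → ℝ → ENNReal := fun n ω =>
      ENNReal.ofReal (Real.exp (-(n * (lam + ε))) * h n ω) with hF
    have hFint : ∀ n, ∫⁻ ω, F n ω ≤
        ENNReal.ofReal (Real.exp (-(n * (lam + ε))) *
          (K * (K * (C * matrixNorm (iter a n).matrix)))) := by
      intro n
      rw [hF, ← ofReal_integral_eq_lintegral_ofReal ((hint n).const_mul _)
        (ae_of_all _ fun ω => mul_nonneg (Real.exp_pos _).le (hnonneg n ω)), integral_const_mul]
      exact ENNReal.ofReal_le_ofReal (mul_le_mul_of_nonneg_left (hbound n) (Real.exp_pos _).le)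
    have hsum : Summable fun n : ℕ => Real.exp (-(n * (lam + ε))) *
          (K * (K * (C * matrixNorm (iter a n).matrix))) := by
      have hgeo : Summable fun n : ℕ => K * (K * C) * Real.exp (-(ε / 2)) ^ n :=
        (summable_geometric_of_lt_one (Real.exp_pos _).le
          (by rw [Real.exp_lt_one_iff]; linarith)).mul_left _
      refine Summable.of_norm_bounded_eventually_nat hgeo ?_
      filter_upwards [hlen] with n hn
      rw [Real.norm_of_nonneg (by positivity), ← Real.exp_nat_mul]
      calc Real.exp (-(n * (lam + ε))) * (K * (K * (C * matrixNorm (iter a n).matrix)))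
          ≤ Real.exp (-(n * (lam + ε))) * (K * (K * (C * Real.exp (n * (lam + ε / 2))))) := by
            gcongr
        _ = K * (K * C) * (Real.exp (-(n * (lam + ε))) * Real.exp (n * (lam + ε / 2))) := by ring
        _ = _ := by rw [← Real.exp_add]; ring_nf
    have hae : ∀ᵐ ω : ℝ, ∑' n, F n ω < ⊤ := by
      have hmeas : ∀ n, AEMeasurable (F n) volume := fun n =>
        ((hint n).const_mul _).aemeasurable.ennreal_ofReal
      refine ae_lt_top' (AEMeasurable.tsum hmeas) ?_
      rw [lintegral_tsum hmeas]
      refine ne_top_of_le_ne_top ?_ (ENNReal.tsum_le_tsum hFint)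
      exact hsum.tsum_ofReal_ne_top
    filter_upwards [hae] with ω hω
    have htend := ENNReal.tendsto_atTop_zero_of_tsum_ne_top hω.ne
    have hev : ∀ᶠ n in atTop, F n ω < ENNReal.ofReal (gauss ω) :=
      htend.eventually_lt_const (ENNReal.ofReal_pos.2 (gauss_pos ω))
    have hK2 : ∀ᶠ n : ℕ in atTop, K * K ≤ Real.exp (n * (ε / 2)) := by
      have : Tendsto (fun n : ℕ => Real.exp (n * (ε / 2))) atTop atTop :=
        Real.tendsto_exp_atTop.comp
          (tendsto_natCast_atTop_atTop.atTop_mul_const (by linarith))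
      exact this.eventually_ge_atTop _
    refine upperLyapunov_le_of_eventually_le _ _ ?_
    filter_upwards [hev, hK2] with n hn hn2
    have h1 : Real.exp (-(n * (lam + ε))) * h n ω < gauss ω :=
      (ENNReal.ofReal_lt_ofReal_iff (gauss_pos ω)).1 hn
    have h2 : ∀ b c, ‖cocycle a (ω • s) n b c‖ ≤ Real.exp (n * (lam / 2 + ε / 2)) := by
      intro b c
      rw [cocycle_eq]
      have h3 : ‖spectralMatrix (iter a n) (ω • s) b c‖ ^ 2 * gauss ω ≤ h n ω := by
        have hnn : ∀ b c, 0 ≤ ‖spectralMatrix (iter a n) (ω • s) b c‖ ^ 2 * gauss ω :=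
          fun b c => mul_nonneg (sq_nonneg _) (gauss_pos _).le
        refine (Finset.single_le_sum (fun c _ => hnn b c) (Finset.mem_univ c)).trans ?_
        exact Finset.single_le_sum
          (f := fun b => ∑ c, ‖spectralMatrix (iter a n) (ω • s) b c‖ ^ 2 * gauss ω)
          (fun b _ => Finset.sum_nonneg fun c _ => hnn b c) (Finset.mem_univ b)
      have h4 : Real.exp (-(n * (lam + ε))) *
          ‖spectralMatrix (iter a n) (ω • s) b c‖ ^ 2 * gauss ω < 1 * gauss ω := by
        rw [one_mul, mul_assoc]
        exact (mul_le_mul_of_nonneg_left h3 (Real.exp_pos _).le).trans_lt h1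
      have h5 := lt_of_mul_lt_mul_right h4 (gauss_pos ω).le
      rw [Real.exp_neg, inv_mul_lt_iff₀ (Real.exp_pos _), mul_one] at h5
      refine le_of_sq_le_sq ?_ (Real.exp_pos _).le
      rw [← Real.exp_nat_mul]
      refine h5.le.trans (le_of_eq ?_)
      push_cast; ring_nf
    refine (matrixNorm_le_sum _).trans ?_
    calc ∑ c, ∑ b, ‖cocycle a (ω • s) n b c‖
        ≤ ∑ _c : A, ∑ _b : A, Real.exp (n * (lam / 2 + ε / 2)) :=
          Finset.sum_le_sum fun c _ => Finset.sum_le_sum fun b _ => h2 b c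
      _ = K * K * Real.exp (n * (lam / 2 + ε / 2)) := by simp [hK, mul_assoc]
      _ ≤ Real.exp (n * (ε / 2)) * Real.exp (n * (lam / 2 + ε / 2)) := by gcongr
      _ = Real.exp (n * (lam / 2 + ε)) := by rw [← Real.exp_add]; ring_nf
  have hall : ∀ᵐ ω : ℝ, ∀ k : ℕ,
      upperLyapunov a (ω • s) ≤ ((lam / 2 + 1 / ((k : ℝ) + 1) : ℝ) : EReal) :=
    ae_all_iff.2 fun k => key _ (by positivity)
  filter_upwards [hall] with ω hω
  have ht : Tendsto (fun k : ℕ => ((lam / 2 + 1 / ((k : ℝ) + 1) : ℝ) : EReal)) atTop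
      (𝓝 ((lam / 2 : ℝ) : EReal)) := by
    refine (continuous_coe_real_ereal.tendsto _).comp ?_
    simpa using tendsto_const_nhds.add (tendsto_one_div_add_atTop_nhds_zero_nat (𝕜 := ℝ))
  exact ge_of_tendsto' ht hω

end

/-! ### Growth of the lengths of the substituted words -/

/-- The growth properties of a sequence of substitutions on which the estimates rest: the words
`ζ^{[k]}(b)` become arbitrarily long, with exponential rate at least `lam` uniformly in `b`, while
the lengths of the individual substitutions are subexponential. -/
structure HasGrowth {A : Type*} (a : ℕ → Substitution A) (lam : ℝ) : Prop where
  lam_nonneg : 0 ≤ lam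
  length_large : ∀ M : ℝ, ∀ᶠ k : ℕ in atTop, ∀ b, M ≤ ((iter a k).word b).length
  exp_le_length : ∀ ε : ℝ, 0 < ε → ∀ᶠ k : ℕ in atTop, ∀ b,
    Real.exp (k * (lam - ε)) ≤ ((iter a k).word b).length
  length_subexp : ∀ ε : ℝ, 0 < ε → ∃ C : ℝ, 0 ≤ C ∧ ∀ (k : ℕ) (b : A),
    (((a k).word b).length : ℝ) ≤ C * Real.exp (k * ε)

section

variable {A : Type*}

theorem Substitution.length_comp (ζ η : Substitution A) (b : A) :
    ((ζ.comp η).word b).length = ((η.word b).map fun c => (ζ.word c).length).sum := by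
  change ((η.word b).flatMap ζ.word).length = _
  rw [List.length_flatMap]

theorem Substitution.length_le_length_comp (ζ η : Substitution A) {b c : A}
    (h : c ∈ η.word b) : (ζ.word c).length ≤ ((ζ.comp η).word b).length := by
  rw [Substitution.length_comp]
  exact List.single_le_sum (fun _ _ => Nat.zero_le _) _ (List.mem_map_of_mem h)

theorem Substitution.length_comp_le (ζ η : Substitution A) {B : ℕ}
    (hB : ∀ c, (ζ.word c).length ≤ B) (b : A) :
    ((ζ.comp η).word b).length ≤ (η.word b).length * B := by
  rw [Substitution.length_comp]
  refine (List.sum_le_card_nsmul _ B ?_).trans ?_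
  · intro x hx
    obtain ⟨c, -, rfl⟩ := List.mem_map.1 hx
    exact hB c
  · simp

theorem le_length_iter_of_le (a : ℕ → Substitution A) {M : ℝ} {k n : ℕ} (hkn : k ≤ n)
    (h : ∀ b, M ≤ ((iter a k).word b).length) (b : A) : M ≤ ((iter a n).word b).length := by
  obtain ⟨r, rfl⟩ := Nat.exists_eq_add_of_le hkn
  rw [iter_add]
  obtain ⟨c, hc⟩ := List.exists_mem_of_ne_nil _
    ((iter (fun j => a (k + j)) r).word_ne_nil b)
  refine (h c).trans ?_
  exact_mod_cast Substitution.length_le_length_comp _ _ hc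

theorem HasGrowth.shift [Finite A] {a : ℕ → Substitution A} {lam : ℝ} (h : HasGrowth a lam)
    (l : ℕ) : HasGrowth (fun j => a (l + j)) lam := by
  obtain ⟨B, hB⟩ : ∃ B : ℕ, ∀ c, ((iter a l).word c).length ≤ B := by
    obtain ⟨B, hB⟩ := (Set.finite_range fun c => ((iter a l).word c).length).bddAbove
    exact ⟨B, fun c => hB ⟨c, rfl⟩⟩
  have hle : ∀ k b, (((iter a (l + k)).word b).length : ℝ) ≤
      ((iter (fun j => a (l + j)) k).word b).length * ((B : ℝ) + 1) := by
    intro k b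
    rw [iter_add]
    have h1 := Substitution.length_comp_le (iter a l) (iter (fun j => a (l + j)) k)
      (fun c => (hB c).trans (Nat.le_succ B)) b
    exact_mod_cast h1
  have hB1 : (0 : ℝ) < (B : ℝ) + 1 := by positivity
  refine ⟨h.lam_nonneg, fun M => ?_, fun ε hε => ?_, fun ε hε => ?_⟩
  · have h1 := (tendsto_add_atTop_nat l).eventually (h.length_large (M * ((B : ℝ) + 1)))
    filter_upwards [h1] with k hk b
    have h2 := hk b
    rw [add_comm k l] at h2
    exact le_of_mul_le_mul_right (h2.trans (hle k b)) hB1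
  · have h1 := (tendsto_add_atTop_nat l).eventually (h.exp_le_length (ε / 2) (by linarith))
    have h3 : Tendsto (fun k : ℕ => Real.exp (k * (ε / 2) + l * (lam - ε / 2))) atTop atTop :=
      Real.tendsto_exp_atTop.comp (tendsto_atTop_add_const_right _ _
        (tendsto_natCast_atTop_atTop.atTop_mul_const (by linarith)))
    filter_upwards [h1, h3.eventually_ge_atTop ((B : ℝ) + 1)] with k hk hk3 b
    have h2 := hk b
    rw [add_comm k l] at h2
    refine le_of_mul_le_mul_right (le_trans ?_ (h2.trans (hle k b))) hB1
    refine (mul_le_mul_of_nonneg_left hk3 (Real.exp_pos _).le).trans ?_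
    rw [← Real.exp_add, Real.exp_le_exp]
    push_cast
    linarith
  · obtain ⟨C, hC0, hC⟩ := h.length_subexp ε hε
    refine ⟨C * Real.exp (l * ε), by positivity, fun k b => (hC (l + k) b).trans (le_of_eq ?_)⟩
    rw [mul_assoc, ← Real.exp_add]
    push_cast
    ring_nf

/-- With `β < lam / 2`, the square of a sum of order `∑_{j < k} exp(jβ)` is negligible against the
lengths of the words at level `k`. For `β < 0`, which covers `lam = 0`, the sum is bounded. -/
theorem HasGrowth.eventually_sq_le {a : ℕ → Substitution A} {lam : ℝ} (h : HasGrowth a lam)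
    {β : ℝ} (hβ : β < lam / 2) (P C : ℝ) (hP : 0 ≤ P) (hC : 0 ≤ C) {η : ℝ} (hη : 0 < η) :
    ∀ᶠ k : ℕ in atTop, ∀ b,
      (P + ∑ j ∈ Finset.range k, C * Real.exp (j * β)) ^ 2 ≤ η * ((iter a k).word b).length := by
  rcases lt_or_ge β 0 with hneg | hpos
  · set T : ℝ := ∑' j : ℕ, C * Real.exp (j * β)
    have hsum : Summable fun j : ℕ => C * Real.exp (j * β) := by
      simp only [Real.exp_nat_mul]
      exact (summable_geometric_of_lt_one (Real.exp_pos _).le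
        (Real.exp_lt_one_iff.2 hneg)).mul_left _
    filter_upwards [h.length_large ((P + T) ^ 2 / η)] with k hk b
    have h1 := hk b
    rw [div_le_iff₀ hη, mul_comm] at h1
    refine le_trans ?_ h1
    have h2 : ∑ j ∈ Finset.range k, C * Real.exp (j * β) ≤ T :=
      hsum.sum_le_tsum _ fun j _ => by positivity
    have h3 : 0 ≤ ∑ j ∈ Finset.range k, C * Real.exp (j * β) :=
      Finset.sum_nonneg fun j _ => by positivity
    gcongr
  · set γ : ℝ := (lam - 2 * β) / 2 with hγ
    have hγ0 : 0 < γ := by rw [hγ]; linarith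
    have hlim : Tendsto (fun k : ℕ => (P + C * k) ^ 2 * Real.exp (-γ * k)) atTop (𝓝 0) := by
      have hr : ∀ n : ℕ, Tendsto (fun k : ℕ => (k : ℝ) ^ n * Real.exp (-γ * k)) atTop (𝓝 0) := by
        intro n
        have h1 := Real.tendsto_pow_mul_exp_neg_atTop_nhds_zero n
        have h2 : Tendsto (fun k : ℕ => (γ : ℝ) * k) atTop atTop :=
          tendsto_natCast_atTop_atTop.const_mul_atTop hγ0
        have h3 := (h1.comp h2).const_mul ((γ ^ n)⁻¹)
        rw [mul_zero] at h3
        refine h3.congr fun k => ?_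
        simp only [Function.comp, mul_pow, neg_mul]
        field_simp
      have h0 := (hr 0).const_mul (P ^ 2)
      have h1 := (hr 1).const_mul (2 * P * C)
      have h2 := (hr 2).const_mul (C ^ 2)
      have h3 := (h0.add h1).add h2
      simp only [mul_zero, add_zero] at h3
      refine h3.congr fun k => ?_
      ring
    filter_upwards [h.exp_le_length γ hγ0, hlim.eventually_lt_const hη] with k hk hk2 b
    have h1 : ∑ j ∈ Finset.range k, C * Real.exp (j * β) ≤ C * k * Real.exp (k * β) := by
      refine (Finset.sum_le_card_nsmul _ _ (C * Real.exp (k * β)) fun j hj => ?_).trans ?_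
      · have : (j : ℝ) ≤ k := by exact_mod_cast (Finset.mem_range.1 hj).le
        gcongr
      · simp only [Finset.card_range, nsmul_eq_mul]
        exact le_of_eq (by ring)
    have h3 : 0 ≤ ∑ j ∈ Finset.range k, C * Real.exp (j * β) :=
      Finset.sum_nonneg fun j _ => by positivity
    have h4 : P ≤ P * Real.exp (k * β) :=
      le_mul_of_one_le_right hP (Real.one_le_exp (by positivity))
    calc (P + ∑ j ∈ Finset.range k, C * Real.exp (j * β)) ^ 2
        ≤ ((P + C * k) * Real.exp (k * β)) ^ 2 := by
          gcongr
          linarith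
      _ = (P + C * k) ^ 2 * Real.exp (-γ * k) * Real.exp (k * (lam - γ)) := by
          rw [mul_pow, ← Real.exp_nat_mul, mul_assoc ((P + C * k) ^ 2), ← Real.exp_add]
          congr 2
          rw [hγ]
          push_cast
          ring
      _ ≤ η * ((iter a k).word b).length :=
          mul_le_mul hk2.le (hk b) (Real.exp_pos _).le hη.le

end

section

variable {A : Type*} [Fintype A] [DecidableEq A]

/-- Composing with an admissible substitution lengthens at least one word. -/
theorem sum_length_comp_ge (ζ η : Substitution A) (h : η.IsAdmissible) :
    ∑ b, ((ζ.word b).length : ℝ) + 1 ≤ ∑ b, (((ζ.comp η).word b).length : ℝ) := by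
  have h1 : ∀ b, (((ζ.comp η).word b).length : ℝ) =
      ∑ c, ((η.word b).count c : ℝ) * ((ζ.word c).length : ℝ) := by
    intro b
    rw [← sum_map_eq_sum_count, Substitution.length_comp, Nat.cast_list_sum, List.map_map]
    rfl
  simp only [h1]
  rw [Finset.sum_comm]
  simp only [← Finset.sum_mul]
  set N : A → ℝ := fun c => ∑ b, ((η.word b).count c : ℝ) with hN
  have hN1 : ∀ c, 1 ≤ N c := by
    intro c
    obtain ⟨b, hb⟩ := h.1 c
    have h2 : (1 : ℝ) ≤ ((η.word b).count c : ℝ) := by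
      exact_mod_cast List.count_pos_iff.2 hb
    exact h2.trans (Finset.single_le_sum (f := fun b => ((η.word b).count c : ℝ))
      (fun _ _ => Nat.cast_nonneg _) (Finset.mem_univ b))
  have hl1 : ∀ c, (1 : ℝ) ≤ (ζ.word c).length := fun c => by
    exact_mod_cast List.length_pos_iff.2 (ζ.word_ne_nil c)
  have hNsum : ∑ _c : A, (1 : ℝ) + 1 ≤ ∑ c, N c := by
    rw [hN, Finset.sum_comm]
    have h2 : ∀ b, ∑ c, ((η.word b).count c : ℝ) = (η.word b).length := by
      intro b
      rw [← sum_count_eq_length]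
      push_cast; rfl
    simp only [h2]
    obtain ⟨b, hb⟩ := h.2
    rw [← Finset.add_sum_erase _ _ (Finset.mem_univ b),
      ← Finset.add_sum_erase (a := b) _ (fun b => ((η.word b).length : ℝ)) (Finset.mem_univ b)]
    have h3 : (2 : ℝ) ≤ (η.word b).length := by exact_mod_cast hb
    have h4 : ∑ _c ∈ Finset.univ.erase b, (1 : ℝ) ≤
        ∑ c ∈ Finset.univ.erase b, ((η.word c).length : ℝ) :=
      Finset.sum_le_sum fun c _ => by exact_mod_cast List.length_pos_iff.2 (η.word_ne_nil c)
    linarith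
  have h5 : ∑ c, (N c - 1) ≤ ∑ c, (N c - 1) * ((ζ.word c).length : ℝ) :=
    Finset.sum_le_sum fun c _ => le_mul_of_one_le_right (by linarith [hN1 c]) (hl1 c)
  simp only [sub_mul, one_mul, Finset.sum_sub_distrib] at h5
  linarith

theorem tendsto_matrixNorm_iter [Nonempty A] (a : ℕ → Substitution A)
    (h : ∀ n, (a n).IsAdmissible) :
    Tendsto (fun n => (matrixNorm (iter a n).matrix : ℝ)) atTop atTop := by
  have h1 : ∀ n : ℕ, (n : ℝ) ≤ ∑ b, (((iter a n).word b).length : ℝ) := by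
    intro n
    induction n with
    | zero => simpa using Finset.sum_nonneg fun _ _ => Nat.cast_nonneg _
    | succ n ih =>
      have := sum_length_comp_ge (iter a n) (a n) (h n)
      push_cast
      rw [iter]
      linarith
  have hc : (0 : ℝ) < Fintype.card A := by exact_mod_cast Fintype.card_pos
  have h2 : ∀ n : ℕ, (n : ℝ) / Fintype.card A ≤ matrixNorm (iter a n).matrix := by
    intro n
    rw [div_le_iff₀ hc]
    refine (h1 n).trans ?_
    refine (Finset.sum_le_card_nsmul _ _ _ fun b _ => length_le_matrixNorm (iter a n) b).trans ?_
    simp [mul_comm]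
  exact tendsto_atTop_mono h2 (tendsto_natCast_atTop_atTop.atTop_div_const hc)

/-- Under condition (A1'), all words at level `n` are at least as long as all words at a level
`k` with `k ≥ ⌊n(1-ε)⌋`. -/
theorem ConditionA1'.exists_length_le {a : ℕ → Substitution A} (h : ConditionA1' a) {ε : ℝ}
    (hε : 0 < ε) (hε1 : ε < 1) :
    ∀ᶠ n : ℕ in atTop, ∃ k : ℕ, ⌊(n : ℝ) * (1 - ε)⌋₊ ≤ k ∧
      ∀ b c, ((iter a k).word c).length ≤ ((iter a n).word b).length := by
  obtain ⟨q, -, hpos, hq⟩ := h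
  obtain ⟨n₀, hn₀⟩ := hq ε hε hε1
  filter_upwards [eventually_ge_atTop n₀] with n hn
  obtain ⟨k, hk1, hk2, hk3⟩ := hn₀ n hn
  refine ⟨k, hk1, fun b c => ?_⟩
  have hmat : (iter (fun j => a (k + j)) q.length).matrix = (q.map Substitution.matrix).prod := by
    rw [iter_matrix]
    congr 1
    refine List.ext_getElem (by simp) fun i h1 h2 => ?_
    simp only [List.length_map] at h2
    simp [hk3 i h2]
  have hmem : ∀ d e, e ∈ (iter (fun j => a (k + j)) q.length).word d := by
    intro d e
    have h1 := hpos e d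
    rw [← hmat] at h1
    have h2 : (0 : ℝ) < (((iter (fun j => a (k + j)) q.length).word d).count e : ℕ) := h1
    exact List.count_pos_iff.1 (by exact_mod_cast h2)
  have h1 : ∀ d, (((iter a k).word c).length : ℝ) ≤ ((iter a (k + q.length)).word d).length := by
    intro d
    rw [iter_add]
    exact_mod_cast Substitution.length_le_length_comp _ _ (hmem d c)
  exact_mod_cast le_length_iter_of_le a hk2 h1 b

theorem hasGrowth_of_conditions [Nonempty A] {a : ℕ → Substitution A} {lam : ℝ}
    (hadm : ∀ n, (a n).IsAdmissible) (hA1 : ConditionA1' a) (hA2 : ConditionA2 a lam)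
    (hA3 : ConditionA3 a) : HasGrowth a lam := by
  have hlam : 0 ≤ lam :=
    ge_of_tendsto' hA2 fun n =>
      div_nonneg (Real.log_nonneg (one_le_matrixNorm _)) (Nat.cast_nonneg _)
  refine ⟨hlam, fun M => ?_, fun ε hε => ?_, fun ε hε => ?_⟩
  · obtain ⟨K, hK⟩ := eventually_atTop.1 ((tendsto_matrixNorm_iter a hadm).eventually_ge_atTop M)
    have h1 : Tendsto (fun n : ℕ => ⌊(n : ℝ) * (1 - 1 / 2)⌋₊) atTop atTop :=
      tendsto_nat_floor_atTop.comp (tendsto_natCast_atTop_atTop.atTop_mul_const (by norm_num))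
    filter_upwards [hA1.exists_length_le (ε := 1 / 2) (by norm_num) (by norm_num),
      h1.eventually_ge_atTop K] with n ⟨k, hk, hn⟩ hK' b
    obtain ⟨c, hc⟩ := exists_length_eq_matrixNorm (iter a k)
    have h2 := hK k (hK'.trans hk)
    rw [hc] at h2
    exact h2.trans (by exact_mod_cast hn b c)
  · rcases le_or_gt lam ε with hle | hlt
    · refine Eventually.of_forall fun k b => ?_
      have h1 : (1 : ℝ) ≤ ((iter a k).word b).length := by
        exact_mod_cast List.length_pos_iff.2 ((iter a k).word_ne_nil b)
      refine le_trans (Real.exp_le_one_iff.2 ?_) h1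
      exact mul_nonpos_of_nonneg_of_nonpos (Nat.cast_nonneg _) (by linarith)
    · have hlam0 : 0 < lam := hε.trans hlt
      -- Descending from level `n` to a level above `n (1 - δ)` costs at most `n δ lam = n ε / 2`
      -- in the exponent.
      set δ : ℝ := ε / (2 * lam) with hδ
      have hδ0 : 0 < δ := by positivity
      have hδ1 : δ < 1 := by rw [hδ, div_lt_one (by positivity)]; linarith
      have hδl : δ * lam = ε / 2 := by rw [hδ]; field_simp
      have h1 : Tendsto (fun n : ℕ => ⌊(n : ℝ) * (1 - δ)⌋₊) atTop atTop :=
        tendsto_nat_floor_atTop.comp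
          (tendsto_natCast_atTop_atTop.atTop_mul_const (by linarith))
      have h2 : ∀ᶠ k : ℕ in atTop,
          Real.exp (k * (lam - ε / 4)) ≤ matrixNorm (iter a k).matrix := by
        filter_upwards [hA2.eventually_const_lt (show lam - ε / 4 < lam by linarith),
          eventually_gt_atTop 0] with k hk hk0
        have hk0' : (0 : ℝ) < k := by exact_mod_cast hk0
        rw [lt_div_iff₀ hk0'] at hk
        rw [← Real.le_log_iff_exp_le (zero_lt_one.trans_le (one_le_matrixNorm _)), mul_comm]
        exact hk.le
      obtain ⟨K, hK⟩ := eventually_atTop.1 h2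
      have h3 : Tendsto (fun n : ℕ => (n : ℝ) * (ε / 4)) atTop atTop :=
        tendsto_natCast_atTop_atTop.atTop_mul_const (by linarith)
      filter_upwards [hA1.exists_length_le hδ0 hδ1, h1.eventually_ge_atTop K,
        h3.eventually_ge_atTop lam] with n ⟨k, hk, hn⟩ hK' hn3 b
      obtain ⟨c, hc⟩ := exists_length_eq_matrixNorm (iter a k)
      have h4 := hK k (hK'.trans hk)
      rw [hc] at h4
      refine le_trans ?_ (h4.trans (by exact_mod_cast hn b c))
      rw [Real.exp_le_exp]
      have h5 : (n : ℝ) * (1 - δ) - 1 ≤ k := by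
        have h6 := Nat.lt_floor_add_one ((n : ℝ) * (1 - δ))
        have h7 : ((⌊(n : ℝ) * (1 - δ)⌋₊ : ℕ) : ℝ) ≤ k := by exact_mod_cast hk
        linarith
      have h8 : ((n : ℝ) * (1 - δ) - 1) * (lam - ε / 4) ≤ k * (lam - ε / 4) :=
        mul_le_mul_of_nonneg_right h5 (by linarith)
      refine le_trans ?_ h8
      have h9 : 0 ≤ (n : ℝ) * δ * ε := by positivity
      have h10 : (n : ℝ) * (δ * lam) = n * (ε / 2) := by rw [hδl]
      nlinarith
  · have h1 : ∀ᶠ n : ℕ in atTop,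
        Real.log (1 + matrixNorm (a n).matrix) / ((n : ℝ) + 1) < ε :=
      hA3.eventually_lt_const hε
    obtain ⟨N, hN⟩ := eventually_atTop.1 h1
    refine ⟨Real.exp ε + ∑ n ∈ Finset.range N, (matrixNorm (a n).matrix : ℝ),
      add_nonneg (Real.exp_pos _).le (Finset.sum_nonneg fun _ _ => NNReal.coe_nonneg _),
      fun k b => (length_le_matrixNorm (a k) b).trans ?_⟩
    have hS : 0 ≤ ∑ n ∈ Finset.range N, (matrixNorm (a n).matrix : ℝ) :=
      Finset.sum_nonneg fun _ _ => NNReal.coe_nonneg _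
    have he : 1 ≤ Real.exp (k * ε) := Real.one_le_exp (by positivity)
    by_cases hk : k < N
    · have h2 : (matrixNorm (a k).matrix : ℝ) ≤
          ∑ n ∈ Finset.range N, (matrixNorm (a n).matrix : ℝ) :=
        Finset.single_le_sum (f := fun n => (matrixNorm (a n).matrix : ℝ))
          (fun _ _ => NNReal.coe_nonneg _) (Finset.mem_range.2 hk)
      have h3 := Real.exp_pos ε
      have h4 := le_mul_of_one_le_right (add_nonneg h3.le hS) he
      linarith
    · have h2 := hN k (not_lt.1 hk)
      have hp : (0 : ℝ) < 1 + matrixNorm (a k).matrix := by positivity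
      rw [div_lt_iff₀ (by positivity), Real.log_lt_iff_lt_exp hp] at h2
      have h3 : Real.exp (ε * ((k : ℝ) + 1)) = Real.exp ε * Real.exp (k * ε) := by
        rw [← Real.exp_add]; ring_nf
      rw [h3] at h2
      have h4 : 0 ≤ (∑ n ∈ Finset.range N, (matrixNorm (a n).matrix : ℝ)) * Real.exp (k * ε) :=
        mul_nonneg hS (Real.exp_pos _).le
      rw [add_mul]
      linarith

end

/-! ### The suspension flow -/

section Roof

variable {A : Type*} (s : A → ℝ) (x : ℤ → A)

theorem shift_shift (k l : ℤ) : shift k (shift l x) = shift (k + l) x := by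
  funext n
  simp [shift, add_assoc]

theorem shift_zero : shift 0 x = x := by
  funext n
  simp [shift]

theorem roofSum_zero : roofSum s x 0 = 0 := by simp [roofSum]

theorem roofSum_add_one (n : ℤ) : roofSum s x (n + 1) = roofSum s x n + s (x n) := by
  unfold roofSum
  rcases le_or_gt 0 n with hn | hn
  · rw [Finset.Ico_eq_empty_of_le (a := n + 1) (by omega), Finset.Ico_eq_empty_of_le (a := n) hn]
    have : Finset.Ico 0 (n + 1) = insert n (Finset.Ico 0 n) := by
      ext k; simp only [Finset.mem_Ico, Finset.mem_insert]; omega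
    rw [this, Finset.sum_insert (by simp)]
    simp only [Finset.sum_empty]
    ring
  · rw [Finset.Ico_eq_empty_of_le (b := n + 1) (by omega),
      Finset.Ico_eq_empty_of_le (b := n) hn.le]
    have : Finset.Ico n 0 = insert n (Finset.Ico (n + 1) 0) := by
      ext k; simp only [Finset.mem_Ico, Finset.mem_insert]; omega
    rw [this, Finset.sum_insert (by simp)]
    simp only [Finset.sum_empty]
    ring

theorem roofSum_one : roofSum s x 1 = s (x 0) := by
  have := roofSum_add_one s x 0
  rw [roofSum_zero, zero_add, zero_add] at this
  exact this

theorem roofSum_shift (k n : ℤ) :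
    roofSum s (shift k x) n = roofSum s x (n + k) - roofSum s x k := by
  induction n using Int.induction_on with
  | zero => simp [roofSum_zero]
  | succ n ih =>
    rw [roofSum_add_one, ih, add_right_comm, roofSum_add_one]
    simp only [shift]
    ring
  | pred n ih =>
    have h1 := roofSum_add_one s (shift k x) (-(n : ℤ) - 1)
    have h2 := roofSum_add_one s x (-(n : ℤ) - 1 + k)
    have e1 : -(n : ℤ) - 1 + 1 = -(n : ℤ) := by ring
    have e2 : -(n : ℤ) - 1 + k + 1 = -(n : ℤ) + k := by ring
    rw [e1] at h1
    rw [e2] at h2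
    have h3 : shift k x (-(n : ℤ) - 1) = x (-(n : ℤ) - 1 + k) := rfl
    rw [h3] at h1
    linarith

/-- The index of the level of the orbit of `(x, 0)` at time `τ`: the largest `n` whose roof sum
is at most `τ`. -/
def levelIndex (τ : ℝ) : ℤ := sSup {n : ℤ | roofSum s x n ≤ τ}

/-- The position of `(x, 0)` at time `τ` under the suspension flow. -/
def orbit (τ : ℝ) : (ℤ → A) × ℝ :=
  (shift (levelIndex s x τ) x, τ - roofSum s x (levelIndex s x τ))

theorem flow_eq_orbit (t : ℝ) (p : (ℤ → A) × ℝ) : flow s t p = orbit s p.1 (p.2 + t) := rfl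

variable {s x} {δ : ℝ} (hδ : 0 < δ) (hs : ∀ b, δ ≤ s b)

include hs in
theorem mul_sub_le_roofSum_sub {k n : ℤ} (h : k ≤ n) :
    δ * ((n : ℝ) - k) ≤ roofSum s x n - roofSum s x k := by
  induction n, h using Int.leInduction with
  | base => simp
  | succ n _ ih =>
    rw [roofSum_add_one]
    have := hs (x n)
    push_cast
    linarith

include hδ hs

theorem strictMono_roofSum : StrictMono (roofSum s x) :=
  strictMono_int_of_lt_succ fun n => by
    rw [roofSum_add_one]
    linarith [hs (x n)]

theorem levelIndex_spec (τ : ℝ) :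
    roofSum s x (levelIndex s x τ) ≤ τ ∧ τ < roofSum s x (levelIndex s x τ + 1) := by
  obtain ⟨M, hM⟩ := exists_nat_gt (|τ| / δ)
  rw [div_lt_iff₀ hδ] at hM
  have hne : {n : ℤ | roofSum s x n ≤ τ}.Nonempty := by
    refine ⟨-(M : ℤ), ?_⟩
    have h1 := mul_sub_le_roofSum_sub (x := x) hs (k := -(M : ℤ)) (n := 0) (by omega)
    rw [roofSum_zero] at h1
    push_cast at h1
    have h2 := neg_abs_le τ
    show roofSum s x (-(M : ℤ)) ≤ τ
    linarith
  have hbdd : BddAbove {n : ℤ | roofSum s x n ≤ τ} := by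
    refine ⟨M, fun n hn => ?_⟩
    by_contra hlt
    have h1 := (strictMono_roofSum hδ hs (x := x)).monotone (not_le.1 hlt).le
    have h2 := mul_sub_le_roofSum_sub (x := x) hs (k := 0) (n := M) (by omega)
    rw [roofSum_zero] at h2
    push_cast at h2
    have h3 : roofSum s x n ≤ τ := hn
    have h4 := le_abs_self τ
    linarith
  refine ⟨Int.csSup_mem hne hbdd, ?_⟩
  by_contra hle
  have h1 : levelIndex s x τ + 1 ≤ levelIndex s x τ := le_csSup hbdd (not_lt.1 hle)
  omega

theorem levelIndex_eq {τ : ℝ} {n : ℤ} (h1 : roofSum s x n ≤ τ) (h2 : τ < roofSum s x (n + 1)) :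
    levelIndex s x τ = n := by
  obtain ⟨h3, h4⟩ := levelIndex_spec hδ hs (x := x) τ
  have hm := strictMono_roofSum hδ hs (x := x)
  have h5 := hm.lt_iff_lt.1 (h3.trans_lt h2)
  have h6 := hm.lt_iff_lt.1 (h1.trans_lt h4)
  omega

theorem orbit_eq {τ : ℝ} {n : ℤ} (h1 : roofSum s x n ≤ τ) (h2 : τ < roofSum s x (n + 1)) :
    orbit s x τ = (shift n x, τ - roofSum s x n) := by
  rw [orbit, levelIndex_eq hδ hs h1 h2]

theorem orbit_mem (τ : ℝ) : 0 ≤ (orbit s x τ).2 ∧ (orbit s x τ).2 < s ((orbit s x τ).1 0) := by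
  obtain ⟨h3, h4⟩ := levelIndex_spec hδ hs (x := x) τ
  rw [roofSum_add_one] at h4
  have h5 : (orbit s x τ).1 0 = x (levelIndex s x τ) := by simp [orbit, shift]
  rw [h5]
  simp only [orbit]
  constructor <;> linarith

theorem orbit_shift (k : ℤ) (τ : ℝ) : orbit s (shift k x) (τ - roofSum s x k) = orbit s x τ := by
  obtain ⟨h3, h4⟩ := levelIndex_spec hδ hs (x := x) τ
  set n := levelIndex s x τ with hn
  have e1 : n - k + k = n := by ring
  have e2 : n - k + 1 + k = n + 1 := by ring
  rw [orbit_eq hδ hs (n := n - k), orbit_eq hδ hs h3 h4, shift_shift, roofSum_shift, e1]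
  · congr 1
    ring
  · rw [roofSum_shift, e1]; linarith
  · rw [roofSum_shift, e2]; linarith

theorem orbit_of_mem {u : ℝ} (h0 : 0 ≤ u) (h1 : u < s (x 0)) : orbit s x u = (x, u) := by
  rw [orbit_eq hδ hs (n := 0) (by rwa [roofSum_zero]) (by rwa [zero_add, roofSum_one]),
    roofSum_zero, sub_zero, shift_zero]

theorem flow_flow (t t' : ℝ) (p : (ℤ → A) × ℝ) : flow s t' (flow s t p) = flow s (t + t') p := by
  rw [flow_eq_orbit, flow_eq_orbit, flow_eq_orbit]
  change orbit s (shift (levelIndex s p.1 (p.2 + t)) p.1)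
    (p.2 + t - roofSum s p.1 (levelIndex s p.1 (p.2 + t)) + t') = _
  rw [← orbit_shift hδ hs (levelIndex s p.1 (p.2 + t)) (p.2 + (t + t'))]
  congr 1
  ring

end Roof

section Measure

variable {A : Type*} [MeasurableSpace A]

theorem measurable_shift (k : ℤ) : Measurable (shift k : (ℤ → A) → ℤ → A) :=
  measurable_pi_lambda _ fun n => measurable_pi_apply (n + k)

variable [DiscreteMeasurableSpace A] (s : A → ℝ)

theorem measurable_roofSum (n : ℤ) : Measurable fun x : ℤ → A => roofSum s x n := by
  have h : ∀ i : ℤ, Measurable fun x : ℤ → A => s (x i) := fun i =>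
    (Measurable.of_discrete (f := s)).comp (measurable_pi_apply i)
  exact (Finset.measurable_sum _ fun i _ => h i).sub (Finset.measurable_sum _ fun i _ => h i)

theorem measurableSet_suspension :
    MeasurableSet {p : (ℤ → A) × ℝ | 0 ≤ p.2 ∧ p.2 < s (p.1 0)} := by
  have h : Measurable fun p : (ℤ → A) × ℝ => s (p.1 0) :=
    (Measurable.of_discrete (f := s)).comp ((measurable_pi_apply 0).comp measurable_fst)
  exact (measurableSet_le measurable_const measurable_snd).inter
    (measurableSet_lt measurable_snd h)

variable {s} {δ : ℝ} (hδ : 0 < δ) (hs : ∀ b, δ ≤ s b)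
include hδ hs

theorem measurable_levelIndex : Measurable fun p : (ℤ → A) × ℝ => levelIndex s p.1 p.2 := by
  refine measurable_to_countable' fun n => ?_
  have : (fun p : (ℤ → A) × ℝ => levelIndex s p.1 p.2) ⁻¹' {n} =
      {p | roofSum s p.1 n ≤ p.2} ∩ {p | p.2 < roofSum s p.1 (n + 1)} := by
    ext p
    constructor
    · rintro rfl
      exact levelIndex_spec hδ hs p.2
    · rintro ⟨h1, h2⟩
      exact levelIndex_eq hδ hs h1 h2
  rw [this]
  exact (measurableSet_le ((measurable_roofSum s n).comp measurable_fst) measurable_snd).inter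
    (measurableSet_lt measurable_snd ((measurable_roofSum s _).comp measurable_fst))

theorem measurable_orbit : Measurable fun p : (ℤ → A) × ℝ => orbit s p.1 p.2 := by
  have h1 : Measurable fun q : ((ℤ → A) × ℝ) × ℤ =>
      ((shift q.2 q.1.1, q.1.2 - roofSum s q.1.1 q.2) : (ℤ → A) × ℝ) := by
    refine measurable_from_prod_countable_left fun n => ?_
    exact ((measurable_shift n).comp measurable_fst).prodMk
      (measurable_snd.sub ((measurable_roofSum s n).comp measurable_fst))
  exact h1.comp (measurable_id.prodMk (measurable_levelIndex hδ hs))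

theorem measurable_flow_uncurry : Measurable fun q : ((ℤ → A) × ℝ) × ℝ => flow s q.2 q.1 := by
  have h : Measurable fun q : ((ℤ → A) × ℝ) × ℝ => (q.1.1, q.1.2 + q.2) := by fun_prop
  exact (measurable_orbit hδ hs).comp h

theorem measurable_flow (t : ℝ) : Measurable (flow s t) := by
  have h : Measurable fun p : (ℤ → A) × ℝ => (p, t) := by fun_prop
  have h' := (measurable_flow_uncurry hδ hs).comp h
  exact h'

omit hδ hs in
theorem lintegral_suspension (μ : Measure (ℤ → A)) [SFinite μ] {F : (ℤ → A) × ℝ → ENNReal}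
    (hF : Measurable F) :
    ∫⁻ p, F p ∂(suspensionMeasure s μ) = ∫⁻ x, (∫⁻ u in Set.Ico 0 (s (x 0)), F (x, u)) ∂μ := by
  set R : Set ((ℤ → A) × ℝ) := {p | 0 ≤ p.2 ∧ p.2 < s (p.1 0)} with hR
  have hRm : MeasurableSet R := measurableSet_suspension s
  have h1 : ∀ (x : ℤ → A) (u : ℝ),
      R.indicator F (x, u) = (Set.Ico 0 (s (x 0))).indicator (fun u => F (x, u)) u := by
    intro x u
    by_cases h : u ∈ Set.Ico 0 (s (x 0))
    · have h' : (x, u) ∈ R := h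
      rw [Set.indicator_of_mem h', Set.indicator_of_mem h]
    · have h' : (x, u) ∉ R := h
      rw [Set.indicator_of_notMem h', Set.indicator_of_notMem h]
  have h2 : suspensionMeasure s μ = (μ.prod volume).restrict R := rfl
  rw [h2, ← lintegral_indicator hRm, lintegral_prod _ (hF.indicator hRm).aemeasurable]
  refine lintegral_congr fun x => ?_
  rw [← lintegral_indicator measurableSet_Ico]
  exact lintegral_congr fun u => h1 x u

omit hδ hs in
theorem isFiniteMeasure_suspensionMeasure [Finite A] (μ : Measure (ℤ → A))
    [IsFiniteMeasure μ] : IsFiniteMeasure (suspensionMeasure s μ) := by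
  obtain ⟨B, hB⟩ := (Set.finite_range s).bddAbove
  refine ⟨?_⟩
  rw [← lintegral_one, lintegral_suspension μ measurable_const]
  refine (lintegral_mono (g := fun _ => ENNReal.ofReal B) fun x => ?_).trans_lt ?_
  · rw [setLIntegral_one, Real.volume_Ico, sub_zero]
    exact ENNReal.ofReal_le_ofReal (hB ⟨x 0, rfl⟩)
  · rw [lintegral_const]
    exact ENNReal.mul_lt_top ENNReal.ofReal_lt_top (measure_lt_top _ _)

omit hδ hs in
theorem ae_suspensionMeasure (μ : Measure (ℤ → A)) [SFinite μ] {P : (ℤ → A) → Prop}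
    (h : ∀ᵐ x ∂μ, P x) :
    ∀ᵐ p ∂(suspensionMeasure s μ), P p.1 ∧ 0 ≤ p.2 ∧ p.2 < s (p.1 0) := by
  have h1 : ∀ᵐ p ∂(μ.prod (volume : Measure ℝ)), P p.1 :=
    Measure.quasiMeasurePreserving_fst.ae h
  exact (ae_restrict_of_ae h1).and (ae_restrict_mem (measurableSet_suspension s))

/-- The suspension flow preserves the measure: the time-`t` displacement changes the integral
over the fibre of `x` by the coboundary `G(Tx) - G(x)`, with `G(x)` the integral along the first
`t` units of the orbit. -/
theorem measurePreserving_flow {μ : Measure (ℤ → A)} [IsFiniteMeasure μ]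
    (hinv : MeasurePreserving (shift 1) μ μ) {t : ℝ} (ht : 0 ≤ t) :
    MeasurePreserving (flow s t) (suspensionMeasure s μ) (suspensionMeasure s μ) := by
  refine ⟨measurable_flow hδ hs t, ?_⟩
  ext B hB
  rw [Measure.map_apply (measurable_flow hδ hs t) hB, ← lintegral_indicator_one hB,
    ← lintegral_indicator_one ((measurable_flow hδ hs t) hB)]
  have hind : Measurable (B.indicator (1 : (ℤ → A) × ℝ → ENNReal)) :=
    measurable_one.indicator hB
  have hind' : Measurable ((flow s t ⁻¹' B).indicator (1 : (ℤ → A) × ℝ → ENNReal)) :=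
    measurable_one.indicator ((measurable_flow hδ hs t) hB)
  rw [lintegral_suspension μ hind, lintegral_suspension μ hind']
  set f : (ℤ → A) → ℝ → ENNReal := fun x τ => B.indicator 1 (orbit s x τ) with hf
  have hfm : Measurable fun p : (ℤ → A) × ℝ => f p.1 p.2 := by
    have h := hind.comp (measurable_orbit hδ hs)
    exact h
  have hfx : ∀ x, Measurable (f x) := by
    intro x
    have h := hfm.comp (measurable_prodMk_left (x := x))
    exact h
  set G : (ℤ → A) → ENNReal := fun x => ∫⁻ τ in Set.Ico 0 t, f x τ with hG
  have hGm : Measurable G := by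
    have h := hfm.lintegral_prod_right' (ν := volume.restrict (Set.Ico 0 t))
    exact h
  have hGfin : ∫⁻ x, G x ∂μ ≠ ⊤ := by
    refine ne_top_of_le_ne_top ?_
      (lintegral_mono (g := fun _ => ENNReal.ofReal t) fun x => ?_)
    · rw [lintegral_const]
      exact (ENNReal.mul_lt_top ENNReal.ofReal_lt_top (measure_lt_top _ _)).ne
    · refine (lintegral_mono (g := fun _ => 1) fun τ => ?_).trans ?_
      · exact Set.indicator_le_self' (fun _ _ => zero_le) _
      · rw [setLIntegral_one, Real.volume_Ico, sub_zero]
  have hshift : ∀ (g : ℝ → ENNReal) (_ : Measurable g) (α β r : ℝ),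
      ∫⁻ u in Set.Ico α β, g (u + r) = ∫⁻ τ in Set.Ico (α + r) (β + r), g τ := by
    intro g hg α β r
    rw [← (measurePreserving_add_right volume r).setLIntegral_comp_preimage measurableSet_Ico hg]
    rw [Set.preimage_add_const_Ico, add_sub_cancel_right, add_sub_cancel_right]
  have hsplit : ∀ (g : ℝ → ENNReal) (α β : ℝ), 0 ≤ α → α ≤ β →
      ∫⁻ τ in Set.Ico 0 β, g τ = (∫⁻ τ in Set.Ico 0 α, g τ) + ∫⁻ τ in Set.Ico α β, g τ := by
    intro g α β h0 h1
    rw [← Set.Ico_union_Ico_eq_Ico h0 h1,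
      lintegral_union measurableSet_Ico Set.Ico_disjoint_Ico_same]
  have hL : ∀ x, ∫⁻ u in Set.Ico 0 (s (x 0)),
      (flow s t ⁻¹' B).indicator (1 : (ℤ → A) × ℝ → ENNReal) (x, u) =
        ∫⁻ τ in Set.Ico t (t + s (x 0)), f x τ := by
    intro x
    have := hshift (f x) (hfx x) 0 (s (x 0)) t
    rw [zero_add, add_comm (s (x 0))] at this
    exact this
  have hR : ∀ x, ∫⁻ u in Set.Ico 0 (s (x 0)), B.indicator (1 : (ℤ → A) × ℝ → ENNReal) (x, u) =
      ∫⁻ τ in Set.Ico 0 (s (x 0)), f x τ := by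
    intro x
    refine setLIntegral_congr_fun measurableSet_Ico fun u hu => ?_
    simp only [hf]
    rw [orbit_of_mem hδ hs hu.1 hu.2]
  simp only [hL, hR]
  have hcob : ∀ x, G x + ∫⁻ τ in Set.Ico t (t + s (x 0)), f x τ =
      G (shift 1 x) + ∫⁻ τ in Set.Ico 0 (s (x 0)), f x τ := by
    intro x
    have hs0 : 0 ≤ s (x 0) := hδ.le.trans (hs _)
    have h0 := hsplit (f x) t (t + s (x 0)) ht (by linarith)
    rw [hsplit (f x) (s (x 0)) (t + s (x 0)) hs0 (by linarith)] at h0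
    change _ = G x + _ at h0
    rw [← h0, add_comm]
    congr 1
    have h1 := hshift (f x) (hfx x) 0 t (s (x 0))
    rw [zero_add] at h1
    rw [← h1]
    refine lintegral_congr fun u => ?_
    simp only [hf]
    rw [← orbit_shift hδ hs 1 (u + s (x 0)), roofSum_one, add_sub_cancel_right]
  have hint := lintegral_congr (μ := μ) hcob
  rw [lintegral_add_left hGm, lintegral_add_left (f := fun x => G (shift 1 x))
      (hGm.comp (measurable_shift 1)),
    hinv.lintegral_comp hGm] at hint
  exact (ENNReal.add_right_inj hGfin).1 hint

end Measure

/-! ### Spectral measures and twisted integrals -/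

/-- `h` is a jointly measurable semiflow that preserves `ν`. -/
structure IsMeasureFlow {Y : Type*} [MeasurableSpace Y] (ν : Measure Y) (h : ℝ → Y → Y) :
    Prop where
  measurable : Measurable fun q : Y × ℝ => h q.2 q.1
  preserving : ∀ t, 0 ≤ t → MeasurePreserving (h t) ν ν
  add : ∀ t t' y, h t' (h t y) = h (t + t') y

/-- The twisted integral `∫₀^R exp(-2πiωt) f(h_t y) dt`. -/
def twistedIntegral {Y : Type*} (h : ℝ → Y → Y) (f : Y → ℂ) (R ω : ℝ) (y : Y) : ℂ :=
  ∫ t in Set.Ioc 0 R, phase (ω * t) * f (h t y)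

/-- The correlation `⟨f ∘ h_t, f ∘ h_{t'}⟩`. -/
def correlation {Y : Type*} [MeasurableSpace Y] (ν : Measure Y) (h : ℝ → Y → Y) (f : Y → ℂ)
    (z : ℝ × ℝ) : ℂ :=
  ∫ y, f (h z.1 y) * (starRingEnd ℂ) (f (h z.2 y)) ∂ν

/-- The square `(0, R]²` with Lebesgue measure. -/
def squareMeasure (R : ℝ) : Measure (ℝ × ℝ) :=
  (volume.restrict (Set.Ioc 0 R)).prod (volume.restrict (Set.Ioc 0 R))

instance (R : ℝ) : IsFiniteMeasure (squareMeasure R) := by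
  unfold squareMeasure; infer_instance

theorem ae_squareMeasure (R : ℝ) : ∀ᵐ z ∂(squareMeasure R), 0 < z.1 ∧ 0 < z.2 := by
  have h : ∀ᵐ t ∂(volume.restrict (Set.Ioc (0 : ℝ) R)), 0 < t :=
    (ae_restrict_mem measurableSet_Ioc).mono fun t ht => ht.1
  exact (Measure.quasiMeasurePreserving_fst.ae h).and (Measure.quasiMeasurePreserving_snd.ae h)

theorem normSq_setIntegral (R : ℝ) (g : ℝ → ℂ) :
    ((‖∫ t in Set.Ioc 0 R, g t‖ ^ 2 : ℝ) : ℂ) =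
      ∫ z, g z.1 * (starRingEnd ℂ) (g z.2) ∂(squareMeasure R) := by
  rw [squareMeasure, integral_prod_mul (f := g) (g := fun t => (starRingEnd ℂ) (g t)),
    integral_conj, Complex.ofReal_pow, Complex.mul_conj']

theorem normSq_twistedIntegral {Y : Type*} (h : ℝ → Y → Y) (f : Y → ℂ) (R ω : ℝ) (y : Y) :
    ((‖twistedIntegral h f R ω y‖ ^ 2 : ℝ) : ℂ) =
      ∫ z, phase (ω * (z.1 - z.2)) * (f (h z.1 y) * (starRingEnd ℂ) (f (h z.2 y)))
        ∂(squareMeasure R) := by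
  rw [twistedIntegral, normSq_setIntegral]
  refine integral_congr_ae (ae_of_all _ fun z => ?_)
  simp only
  rw [map_mul, conj_phase, mul_sub, sub_eq_add_neg, phase_add]
  ring

section

variable {Y : Type*} [MeasurableSpace Y] {ν : Measure Y} {h : ℝ → Y → Y}
  {f : Y → ℂ}

theorem integrable_normSq (hf2 : MemLp f 2 ν) : Integrable (fun y => ‖f y‖ ^ 2) ν :=
  hf2.integrable_norm_pow (p := 2) two_ne_zero

variable (hh : IsMeasureFlow ν h) (hf : Measurable f) (hf2 : MemLp f 2 ν)

include hh

theorem IsMeasureFlow.measurable_time (t : ℝ) : Measurable (h t) := by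
  have h1 : Measurable fun y : Y => (y, t) := by fun_prop
  have h2 := hh.measurable.comp h1
  exact h2

theorem integral_comp_flow {E : Type*} [NormedAddCommGroup E] [NormedSpace ℝ E]
    {g : Y → E} (hg : StronglyMeasurable g) {t : ℝ} (ht : 0 ≤ t) :
    ∫ y, g (h t y) ∂ν = ∫ y, g y ∂ν := by
  conv_rhs => rw [← (hh.preserving t ht).map_eq]
  rw [integral_map (hh.measurable_time t).aemeasurable hg.aestronglyMeasurable]

theorem integrable_normSq_flow (hf2 : MemLp f 2 ν) {t : ℝ} (ht : 0 ≤ t) :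
    Integrable (fun y => ‖f (h t y)‖ ^ 2) ν := by
  have h1 := (hh.preserving t ht).integrable_comp_of_integrable (integrable_normSq hf2)
  exact h1

include hf

theorem integral_normSq_flow {t : ℝ} (ht : 0 ≤ t) :
    ∫ y, ‖f (h t y)‖ ^ 2 ∂ν = ∫ y, ‖f y‖ ^ 2 ∂ν :=
  integral_comp_flow hh (g := fun y => ‖f y‖ ^ 2) (hf.norm.pow_const 2).stronglyMeasurable ht

theorem measurable_correlation_integrand :
    Measurable fun q : (ℝ × ℝ) × Y => f (h q.1.1 q.2) * (starRingEnd ℂ) (f (h q.1.2 q.2)) := by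
  have h1 : Measurable fun q : (ℝ × ℝ) × Y => (q.2, q.1.1) := by fun_prop
  have h2 : Measurable fun q : (ℝ × ℝ) × Y => (q.2, q.1.2) := by fun_prop
  have h3 := hf.comp (hh.measurable.comp h1)
  have h4 := hf.comp (hh.measurable.comp h2)
  have h5 := h3.mul (Complex.continuous_conj.measurable.comp h4)
  exact h5

variable [IsFiniteMeasure ν]

theorem measurable_correlation : StronglyMeasurable (correlation ν h f) := by
  have h1 := (measurable_correlation_integrand hh hf).stronglyMeasurable
  have h2 := h1.integral_prod_right' (ν := ν)
  exact h2

include hf2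

omit [IsFiniteMeasure ν] in
theorem integrable_correlation {t t' : ℝ} (ht : 0 ≤ t) (ht' : 0 ≤ t') :
    Integrable (fun y => f (h t y) * (starRingEnd ℂ) (f (h t' y))) ν := by
  have h1 := (integrable_normSq_flow hh hf2 ht).add (integrable_normSq_flow hh hf2 ht')
  refine (h1.div_const 2).mono' ?_ (ae_of_all _ fun y => ?_)
  · have h2 := hf.comp (hh.measurable_time t)
    have h3 := hf.comp (hh.measurable_time t')
    have h4 := h2.mul (Complex.continuous_conj.measurable.comp h3)
    exact h4.aestronglyMeasurable
  · rw [norm_mul, RCLike.norm_conj]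
    simp only [Pi.add_apply]
    nlinarith [sq_nonneg (‖f (h t y)‖ - ‖f (h t' y)‖)]

omit [IsFiniteMeasure ν] in
theorem norm_correlation_le {z : ℝ × ℝ} (h1 : 0 ≤ z.1) (h2 : 0 ≤ z.2) :
    ‖correlation ν h f z‖ ≤ ∫ y, ‖f y‖ ^ 2 ∂ν := by
  have i1 := integrable_normSq_flow hh hf2 h1
  have i2 := integrable_normSq_flow hh hf2 h2
  refine (norm_integral_le_integral_norm _).trans ?_
  have h3 : ∫ y, ‖f (h z.1 y) * (starRingEnd ℂ) (f (h z.2 y))‖ ∂ν ≤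
      ∫ y, (‖f (h z.1 y)‖ ^ 2 + ‖f (h z.2 y)‖ ^ 2) / 2 ∂ν := by
    refine integral_mono (integrable_correlation hh hf hf2 h1 h2).norm
      ((i1.add i2).div_const 2) fun y => ?_
    simp only
    rw [norm_mul, RCLike.norm_conj]
    nlinarith [sq_nonneg (‖f (h z.1 y)‖ - ‖f (h z.2 y)‖)]
  refine h3.trans (le_of_eq ?_)
  rw [integral_div, integral_add i1 i2, integral_normSq_flow hh hf h1,
    integral_normSq_flow hh hf h2]
  ring

theorem integrable_correlation_prod (R : ℝ) :
    Integrable (fun q : (ℝ × ℝ) × Y => f (h q.1.1 q.2) * (starRingEnd ℂ) (f (h q.1.2 q.2)))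
      ((squareMeasure R).prod ν) := by
  have hm := measurable_correlation_integrand hh hf
  rw [integrable_prod_iff hm.aestronglyMeasurable]
  constructor
  · filter_upwards [ae_squareMeasure R] with z hz
    exact integrable_correlation hh hf hf2 hz.1.le hz.2.le
  · refine Integrable.mono' (integrable_const (∫ y, ‖f y‖ ^ 2 ∂ν)) ?_ ?_
    · have h2 := hm.norm.stronglyMeasurable.integral_prod_right' (ν := ν)
      exact h2.aestronglyMeasurable
    · filter_upwards [ae_squareMeasure R] with z hz
      rw [Real.norm_of_nonneg (integral_nonneg fun y => norm_nonneg _)]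
      have i1 := integrable_normSq_flow hh hf2 hz.1.le
      have i2 := integrable_normSq_flow hh hf2 hz.2.le
      have h3 : ∫ y, ‖f (h z.1 y) * (starRingEnd ℂ) (f (h z.2 y))‖ ∂ν ≤
          ∫ y, (‖f (h z.1 y)‖ ^ 2 + ‖f (h z.2 y)‖ ^ 2) / 2 ∂ν := by
        refine integral_mono (integrable_correlation hh hf hf2 hz.1.le hz.2.le).norm
          ((i1.add i2).div_const 2) fun y => ?_
        simp only
        rw [norm_mul, RCLike.norm_conj]
        nlinarith [sq_nonneg (‖f (h z.1 y)‖ - ‖f (h z.2 y)‖)]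
      refine h3.trans (le_of_eq ?_)
      rw [integral_div, integral_add i1 i2, integral_normSq_flow hh hf hz.1.le,
        integral_normSq_flow hh hf hz.2.le]
      ring

theorem integrable_phase_correlation_prod (R ω : ℝ) :
    Integrable (fun q : (ℝ × ℝ) × Y =>
      phase (ω * (q.1.1 - q.1.2)) * (f (h q.1.1 q.2) * (starRingEnd ℂ) (f (h q.1.2 q.2))))
      ((squareMeasure R).prod ν) := by
  refine (integrable_correlation_prod hh hf hf2 R).bdd_mul (c := 1) ?_
    (ae_of_all _ fun q => (norm_phase _).le)
  have : Continuous fun z : ℝ × ℝ => phase (ω * (z.1 - z.2)) :=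
    continuous_phase.comp (by fun_prop)
  exact (this.measurable.comp measurable_fst).aestronglyMeasurable

theorem integrable_normSq_twistedIntegral (R ω : ℝ) :
    Integrable (fun y => ‖twistedIntegral h f R ω y‖ ^ 2) ν := by
  have h1 := (integrable_phase_correlation_prod hh hf hf2 R ω).integral_prod_right.re
  simp only [← normSq_twistedIntegral] at h1
  exact h1

/-- The mean square of the twisted integral in terms of the correlations. -/
theorem integral_normSq_twistedIntegral (R ω : ℝ) :
    ((∫ y, ‖twistedIntegral h f R ω y‖ ^ 2 ∂ν : ℝ) : ℂ) =
      ∫ z, phase (ω * (z.1 - z.2)) * correlation ν h f z ∂(squareMeasure R) := by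
  rw [← integral_complex_ofReal]
  simp only [normSq_twistedIntegral]
  have hswap := integral_integral_swap (f := fun (z : ℝ × ℝ) (y : Y) =>
    phase (ω * (z.1 - z.2)) * (f (h z.1 y) * (starRingEnd ℂ) (f (h z.2 y))))
    (integrable_phase_correlation_prod hh hf hf2 R ω)
  rw [← hswap]
  refine integral_congr_ae (ae_of_all _ fun z => ?_)
  simp only
  rw [integral_const_mul, correlation]

theorem ae_integrableOn_flow (R : ℝ) :
    ∀ᵐ y ∂ν, IntegrableOn (fun t => f (h t y)) (Set.Ioc 0 R) := by
  have hm : Measurable fun q : ℝ × Y => f (h q.1 q.2) := by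
    have h1 := hf.comp (hh.measurable.comp measurable_swap)
    exact h1
  have hint : Integrable (fun q : ℝ × Y => f (h q.1 q.2))
      ((volume.restrict (Set.Ioc 0 R)).prod ν) := by
    have hf1 : Integrable f ν := hf2.integrable (by norm_num)
    have hpos : ∀ᵐ t ∂(volume.restrict (Set.Ioc (0 : ℝ) R)), 0 < t :=
      (ae_restrict_mem measurableSet_Ioc).mono fun t ht => ht.1
    rw [integrable_prod_iff hm.aestronglyMeasurable]
    constructor
    · filter_upwards [hpos] with t ht
      exact (hh.preserving t ht.le).integrable_comp_of_integrable hf1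
    · refine Integrable.congr (integrable_const (∫ y, ‖f y‖ ∂ν)) ?_
      filter_upwards [hpos] with t ht
      exact (integral_comp_flow hh hf.norm.stronglyMeasurable ht.le).symm
  exact hint.prod_left_ae

/-- The mean square of the twisted integral is a seminorm squared, hence quasi-additive. -/
theorem integral_normSq_twistedIntegral_le_add {g : Y → ℂ} (hg : Measurable g) (hg2 : MemLp g 2 ν)
    (R ω : ℝ) :
    ∫ y, ‖twistedIntegral h f R ω y‖ ^ 2 ∂ν ≤
      2 * (∫ y, ‖twistedIntegral h (f - g) R ω y‖ ^ 2 ∂ν) +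
        2 * ∫ y, ‖twistedIntegral h g R ω y‖ ^ 2 ∂ν := by
  have i1 := integrable_normSq_twistedIntegral hh (hf.sub hg) (hf2.sub hg2) R ω
  have i2 := integrable_normSq_twistedIntegral hh hg hg2 R ω
  rw [← integral_const_mul, ← integral_const_mul,
    ← integral_add (i1.const_mul 2) (i2.const_mul 2)]
  refine integral_mono_ae (integrable_normSq_twistedIntegral hh hf hf2 R ω)
    ((i1.const_mul 2).add (i2.const_mul 2)) ?_
  have hphase : ∀ u : ℝ → ℂ, IntegrableOn u (Set.Ioc 0 R) →
      IntegrableOn (fun t => phase (ω * t) * u t) (Set.Ioc 0 R) := fun u hu =>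
    Integrable.bdd_mul (c := 1) hu (continuous_phase.comp (by fun_prop)).aestronglyMeasurable
      (ae_of_all _ fun q => (norm_phase _).le)
  filter_upwards [ae_integrableOn_flow hh hf hf2 R, ae_integrableOn_flow hh hg hg2 R] with y h1 h2
  have h3 : twistedIntegral h f R ω y =
      twistedIntegral h (f - g) R ω y + twistedIntegral h g R ω y := by
    rw [twistedIntegral, twistedIntegral, twistedIntegral,
      ← integral_add (hphase (fun t => (f - g) (h t y)) (h1.sub h2)) (hphase _ h2)]
    refine integral_congr_ae (ae_of_all _ fun t => ?_)
    simp only [Pi.sub_apply]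
    ring
  have h4 := norm_add_le (twistedIntegral h (f - g) R ω y) (twistedIntegral h g R ω y)
  rw [← h3] at h4
  have h5 := pow_le_pow_left₀ (norm_nonneg _) h4 2
  refine h5.trans ?_
  nlinarith [sq_nonneg (‖twistedIntegral h (f - g) R ω y‖ - ‖twistedIntegral h g R ω y‖)]

theorem integrable_phase_gauss_correlation (R : ℝ) :
    Integrable (Function.uncurry fun (ω : ℝ) (z : ℝ × ℝ) =>
      phase (ω * (z.1 - z.2)) * (gauss ω : ℂ) * correlation ν h f z)
      (volume.prod (squareMeasure R)) := by
  have hphase : Measurable fun q : ℝ × (ℝ × ℝ) => phase (q.1 * (q.2.1 - q.2.2)) :=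
    (continuous_phase.comp (by fun_prop)).measurable
  have h1 : Integrable (fun q : ℝ × (ℝ × ℝ) => (gauss q.1 : ℂ) * correlation ν h f q.2)
      (volume.prod (squareMeasure R)) := by
    refine Integrable.mul_prod integrable_gauss.ofReal ?_
    refine Integrable.mono' (integrable_const (∫ y, ‖f y‖ ^ 2 ∂ν))
      (measurable_correlation hh hf).aestronglyMeasurable ?_
    filter_upwards [ae_squareMeasure R] with z hz
    exact norm_correlation_le hh hf hf2 hz.1.le hz.2.le
  have h2 := h1.bdd_mul (c := 1) hphase.aestronglyMeasurable
    (ae_of_all _ fun q => (norm_phase _).le)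
  refine h2.congr (ae_of_all _ fun q => ?_)
  simp only [Function.uncurry, mul_assoc]

theorem integral_phase_gauss_correlation (R ω : ℝ) :
    ∫ z, phase (ω * (z.1 - z.2)) * (gauss ω : ℂ) * correlation ν h f z ∂(squareMeasure R) =
      ((gauss ω * ∫ y, ‖twistedIntegral h f R ω y‖ ^ 2 ∂ν : ℝ) : ℂ) := by
  rw [Complex.ofReal_mul, integral_normSq_twistedIntegral hh hf hf2, ← integral_const_mul]
  refine integral_congr_ae (ae_of_all _ fun z => ?_)
  simp only
  ring

theorem integrable_gauss_normSq_twistedIntegral (R : ℝ) :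
    Integrable fun ω => gauss ω * ∫ y, ‖twistedIntegral h f R ω y‖ ^ 2 ∂ν := by
  have h1 := (integrable_phase_gauss_correlation hh hf hf2 R).integral_prod_left
  simp only [Function.uncurry, integral_phase_gauss_correlation hh hf hf2] at h1
  exact h1.re

/-- With Gaussian weight, the mean square of the twisted integrals over all frequencies is at
most `R ‖f‖²` (an averaged form of Plancherel's theorem). -/
theorem lintegral_gauss_normSq_twistedIntegral_le {R : ℝ} (hR : 0 ≤ R) :
    ∫⁻ ω : ℝ, ENNReal.ofReal (gauss ω * ∫ y, ‖twistedIntegral h f R ω y‖ ^ 2 ∂ν) ≤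
      ENNReal.ofReal (R * ∫ y, ‖f y‖ ^ 2 ∂ν) := by
  set F : ℝ := ∫ y, ‖f y‖ ^ 2 ∂ν with hF
  have hF0 : 0 ≤ F := integral_nonneg fun y => sq_nonneg _
  have hint := integrable_phase_gauss_correlation hh hf hf2 R
  have hint' := integrable_gauss_normSq_twistedIntegral hh hf hf2 R
  have hnonneg : ∀ ω, 0 ≤ gauss ω * ∫ y, ‖twistedIntegral h f R ω y‖ ^ 2 ∂ν := fun ω =>
    mul_nonneg (gauss_pos ω).le (integral_nonneg fun y => sq_nonneg _)
  rw [← ofReal_integral_eq_lintegral_ofReal hint' (ae_of_all _ hnonneg)]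
  refine ENNReal.ofReal_le_ofReal ?_
  have h3 : ((∫ ω, gauss ω * ∫ y, ‖twistedIntegral h f R ω y‖ ^ 2 ∂ν : ℝ) : ℂ) =
      ∫ z, (gauss (z.1 - z.2) : ℂ) * correlation ν h f z ∂(squareMeasure R) := by
    rw [← integral_complex_ofReal]
    simp only [← integral_phase_gauss_correlation hh hf hf2]
    rw [integral_integral_swap hint]
    refine integral_congr_ae (ae_of_all _ fun z => ?_)
    simp only
    rw [integral_mul_const, integral_phase_mul_gauss]
  rw [← Real.norm_of_nonneg (integral_nonneg hnonneg), ← Complex.norm_real, h3]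
  have hg : Integrable (fun z : ℝ × ℝ => gauss (z.1 - z.2)) (squareMeasure R) := by
    refine Integrable.mono' (integrable_const 1)
      (continuous_gauss.comp (by fun_prop)).aestronglyMeasurable (ae_of_all _ fun z => ?_)
    rw [Real.norm_of_nonneg (gauss_pos _).le, gauss, Real.exp_le_one_iff]
    have := Real.pi_pos
    nlinarith [sq_nonneg (z.1 - z.2)]
  have h4 : ‖∫ z, (gauss (z.1 - z.2) : ℂ) * correlation ν h f z ∂(squareMeasure R)‖ ≤
      ∫ z, gauss (z.1 - z.2) * F ∂(squareMeasure R) := by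
    refine norm_integral_le_of_norm_le (hg.mul_const F) ?_
    filter_upwards [ae_squareMeasure R] with z hz
    rw [norm_mul, Complex.norm_real, Real.norm_of_nonneg (gauss_pos _).le]
    exact mul_le_mul_of_nonneg_left (norm_correlation_le hh hf hf2 hz.1.le hz.2.le)
      (gauss_pos _).le
  refine h4.trans ?_
  rw [integral_mul_const]
  refine mul_le_mul_of_nonneg_right ?_ hF0
  rw [squareMeasure, integral_prod _ hg]
  have h5 : ∀ t : ℝ, ∫ t' in Set.Ioc 0 R, gauss (t - t') ≤ 1 := by
    intro t
    have h6 : Integrable fun t' : ℝ => gauss (t - t') := integrable_gauss.comp_sub_left t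
    refine (setIntegral_le_integral h6 (ae_of_all _ fun _ => (gauss_pos _).le)).trans ?_
    rw [integral_sub_left_eq_self gauss volume t, integral_gauss]
  refine (integral_mono_of_nonneg (g := fun _ => (1 : ℝ)) (ae_of_all _ fun t => ?_)
    (integrable_const 1) (ae_of_all _ h5)).trans ?_
  · exact integral_nonneg fun _ => (gauss_pos _).le
  · simp [hR]

variable {σ : Measure ℝ} [IsFiniteMeasure σ]
  (hσ : ∀ t : ℝ, 0 ≤ t → ∫ ω : ℝ, Complex.exp (2 * Real.pi * Complex.I * ω * t) ∂σ =
    ∫ y, f (h t y) * (starRingEnd ℂ) (f y) ∂ν)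

include hσ

omit hf2 [IsFiniteMeasure σ] [IsFiniteMeasure ν] in
theorem correlation_eq {z : ℝ × ℝ} (h1 : 0 ≤ z.1) (h2 : 0 ≤ z.2) :
    correlation ν h f z = ∫ u, phase (-u * (z.1 - z.2)) ∂σ := by
  have key : ∀ t t' : ℝ, 0 ≤ t' → t' ≤ t →
      correlation ν h f (t, t') = ∫ u, phase (-u * (t - t')) ∂σ := by
    intro t t' ht' htt
    have h3 : ∫ u : ℝ, phase (-u * (t - t')) ∂σ =
        ∫ y, f (h (t - t') y) * (starRingEnd ℂ) (f y) ∂ν := by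
      rw [← hσ (t - t') (sub_nonneg.2 htt)]
      refine integral_congr_ae (ae_of_all _ fun u => ?_)
      simp only [phase]
      push_cast
      congr 1
      ring
    rw [h3, correlation]
    have hm : Measurable fun y => f (h (t - t') y) * (starRingEnd ℂ) (f y) :=
      (hf.comp (hh.measurable_time _)).mul (Complex.continuous_conj.measurable.comp hf)
    rw [← integral_comp_flow hh hm.stronglyMeasurable ht']
    simp only [hh.add]
    congr 2
    funext y
    congr 4
    ring
  obtain ⟨t, t'⟩ := z
  rcases le_total t' t with hle | hle
  · exact key t t' h2 hle
  · have h3 := congrArg (starRingEnd ℂ) (key t' t h1 hle)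
    rw [correlation, ← integral_conj, ← integral_conj] at h3
    rw [correlation]
    refine Eq.trans ?_ (h3.trans ?_)
    · refine integral_congr_ae (ae_of_all _ fun y => ?_)
      simp only [map_mul, Complex.conj_conj]
      ring
    · refine integral_congr_ae (ae_of_all _ fun u => ?_)
      simp only [conj_phase]
      congr 1
      ring

/-- The mean square of the twisted integral is the integral of a Fejér kernel against the spectral
measure. -/
theorem integral_normSq_twistedIntegral_eq_spectral (R ω : ℝ) :
    ∫ y, ‖twistedIntegral h f R ω y‖ ^ 2 ∂ν =
      ∫ u, ‖∫ t in Set.Ioc 0 R, phase ((ω - u) * t)‖ ^ 2 ∂σ := by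
  rw [← Complex.ofReal_inj, integral_normSq_twistedIntegral hh hf hf2, ← integral_complex_ofReal]
  have h1 : ∀ u : ℝ, ((‖∫ t in Set.Ioc 0 R, phase ((ω - u) * t)‖ ^ 2 : ℝ) : ℂ) =
      ∫ z, phase ((ω - u) * (z.1 - z.2)) ∂(squareMeasure R) := by
    intro u
    rw [normSq_setIntegral]
    refine integral_congr_ae (ae_of_all _ fun z => ?_)
    simp only
    rw [conj_phase, ← phase_add]
    congr 1
    ring
  simp only [h1]
  have hint : Integrable (Function.uncurry fun (u : ℝ) (z : ℝ × ℝ) =>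
      phase ((ω - u) * (z.1 - z.2))) (σ.prod (squareMeasure R)) := by
    refine Integrable.mono' (integrable_const 1)
      (continuous_phase.comp (by fun_prop)).aestronglyMeasurable (ae_of_all _ fun q => ?_)
    exact (norm_phase _).le
  rw [integral_integral_swap hint]
  refine integral_congr_ae ?_
  filter_upwards [ae_squareMeasure R] with z hz
  rw [correlation_eq hh hf hσ hz.1.le hz.2.le, ← integral_const_mul]
  refine integral_congr_ae (ae_of_all _ fun u => ?_)
  simp only
  rw [← phase_add]
  congr 1
  ring

omit hh hf hf2 [IsFiniteMeasure ν] hσ in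
theorem half_le_norm_integral_phase {R v : ℝ} (hR : 0 < R) (hv : |v| ≤ 1 / (6 * R)) :
    R / 2 ≤ ‖∫ t in Set.Ioc 0 R, phase (v * t)‖ := by
  refine le_trans ?_ (Complex.re_le_norm _)
  have hint : Integrable (fun t => phase (v * t)) (volume.restrict (Set.Ioc 0 R)) := by
    refine Integrable.mono' (integrable_const 1)
      (continuous_phase.comp (by fun_prop)).aestronglyMeasurable (ae_of_all _ fun q => ?_)
    exact (norm_phase _).le
  have hre : (∫ t in Set.Ioc 0 R, phase (v * t)).re = ∫ t in Set.Ioc 0 R, (phase (v * t)).re :=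
    (integral_re hint).symm
  have hbound : ∀ t ∈ Set.Ioc 0 R, (1 / 2 : ℝ) ≤ (phase (v * t)).re := by
    intro t ht
    have h1 : phase (v * t) = Complex.exp ((-2 * Real.pi * (v * t) : ℝ) * Complex.I) := by
      rw [phase]; congr 1; push_cast; ring
    rw [h1, Complex.exp_ofReal_mul_I_re, ← Real.cos_abs, ← Real.cos_pi_div_three]
    have h2 : |v * t| ≤ 1 / 6 := by
      rw [abs_mul, abs_of_pos ht.1]
      calc |v| * t ≤ 1 / (6 * R) * R := by
            gcongr
            · exact ht.1.le
            · exact ht.2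
        _ = 1 / 6 := by field_simp
    have h3 : |-2 * Real.pi * (v * t)| ≤ Real.pi / 3 := by
      rw [abs_mul, abs_mul, abs_neg, abs_two, abs_of_pos Real.pi_pos]
      have := mul_le_mul_of_nonneg_left h2 (show 0 ≤ 2 * Real.pi by positivity)
      linarith
    exact Real.cos_le_cos_of_nonneg_of_le_pi (abs_nonneg _) (by linarith [Real.pi_pos]) h3
  rw [hre]
  have h4 := setIntegral_mono_on (integrable_const (1 / 2 : ℝ)) hint.re measurableSet_Ioc hbound
  refine le_trans (le_of_eq ?_) h4
  simp [hR.le]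
  ring

/-- The spectral measure of small intervals is controlled by twisted integrals. -/
theorem measure_closedBall_le {R : ℝ} (hR : 0 < R) (ω : ℝ) :
    σ (Metric.closedBall ω (1 / (6 * R))) ≤
      ENNReal.ofReal (4 / R ^ 2 * ∫ y, ‖twistedIntegral h f R ω y‖ ^ 2 ∂ν) := by
  set B := Metric.closedBall ω (1 / (6 * R)) with hB
  have hBm : MeasurableSet B := Metric.isClosed_closedBall.measurableSet
  set k : ℝ → ℝ := fun u => ‖∫ t in Set.Ioc 0 R, phase ((ω - u) * t)‖ ^ 2 with hk
  have hkm : StronglyMeasurable k := by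
    have h1 : StronglyMeasurable fun q : ℝ × ℝ => phase ((ω - q.1) * q.2) :=
      (continuous_phase.comp (by fun_prop)).stronglyMeasurable
    have h2 := (h1.integral_prod_right' (ν := volume.restrict (Set.Ioc 0 R))).norm.pow 2
    exact h2
  have hkb : ∀ u, ‖k u‖ ≤ R ^ 2 := by
    intro u
    simp only [hk]
    rw [Real.norm_of_nonneg (sq_nonneg _)]
    gcongr
    have h1 := norm_setIntegral_le_of_norm_le_const (s := Set.Ioc 0 R) (μ := volume)
      (f := fun t => phase ((ω - u) * t)) (C := 1) (by simp) fun t _ => (norm_phase _).le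
    simpa [hR.le] using h1
  have hki : Integrable k σ :=
    Integrable.mono' (integrable_const (R ^ 2)) hkm.aestronglyMeasurable (ae_of_all _ hkb)
  rw [integral_normSq_twistedIntegral_eq_spectral hh hf hf2 hσ]
  have h1 : σ.real B * (R / 2) ^ 2 ≤ ∫ u, k u ∂σ := by
    have h2 : ∫ u in B, (R / 2) ^ 2 ∂σ ≤ ∫ u in B, k u ∂σ := by
      refine setIntegral_mono_on (integrable_const _) hki.integrableOn hBm fun u hu => ?_
      have h3 : |ω - u| ≤ 1 / (6 * R) := by
        rw [abs_sub_comm]; exact hu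
      have h4 := half_le_norm_integral_phase hR h3
      simp only [hk]
      gcongr
    rw [setIntegral_const, smul_eq_mul] at h2
    exact h2.trans (setIntegral_le_integral hki (ae_of_all _ fun u => sq_nonneg _))
  rw [← ENNReal.ofReal_toReal (measure_ne_top σ B)]
  refine ENNReal.ofReal_le_ofReal ?_
  change σ.real B ≤ _
  have h5 : 0 < R ^ 2 := by positivity
  rw [div_mul_eq_mul_div, le_div_iff₀ h5]
  change _ ≤ 4 * ∫ u, k u ∂σ
  linarith

end

/-! ### Twisted sums over factors of substituted words -/

section Factors

variable {A L : Type*} {τ : L → ℝ} {v : L → ℂ} {β : A → List L} {D P : ℝ}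

theorem norm_twist_flatMap_le (hD : ∀ c, ‖twist τ v (β c)‖ ≤ D) (W : List A) :
    ‖twist τ v (W.flatMap β)‖ ≤ W.length * D := by
  induction W with
  | nil => simp [twist]
  | cons c W ih =>
    rw [List.flatMap_cons]
    refine (norm_twist_append_le _ _ _ _).trans ?_
    have := hD c
    simp only [List.length_cons]
    push_cast
    linarith

theorem norm_twist_prefix_flatMap_le (hD0 : 0 ≤ D) (hP0 : 0 ≤ P)
    (hD : ∀ c, ‖twist τ v (β c)‖ ≤ D) (hP : ∀ c, ∀ p, p <+: β c → ‖twist τ v p‖ ≤ P)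
    (W : List A) {p : List L} (hp : p <+: W.flatMap β) :
    ‖twist τ v p‖ ≤ W.length * D + P := by
  induction W generalizing p with
  | nil =>
    rw [List.flatMap_nil, List.prefix_nil] at hp
    simpa [hp, twist] using hP0
  | cons c W ih =>
    rw [List.flatMap_cons] at hp
    simp only [List.length_cons]
    push_cast
    have hW : 0 ≤ (W.length : ℝ) * D := by positivity
    rcases List.prefix_or_prefix_of_prefix hp (List.prefix_append _ _) with h | ⟨t, rfl⟩
    · have := hP c p h
      linarith
    · have h1 := ih ((List.prefix_append_right_inj _).1 hp)
      have h2 := hD c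
      have h3 := norm_twist_append_le τ v (β c) t
      linarith

theorem norm_twist_suffix_flatMap_le (hD0 : 0 ≤ D) (hP0 : 0 ≤ P)
    (hD : ∀ c, ‖twist τ v (β c)‖ ≤ D) (hP : ∀ c, ∀ p, p <:+ β c → ‖twist τ v p‖ ≤ P)
    (W : List A) {p : List L} (hp : p <:+ W.flatMap β) :
    ‖twist τ v p‖ ≤ W.length * D + P := by
  induction W generalizing p with
  | nil =>
    rw [List.flatMap_nil, List.suffix_nil] at hp
    simpa [hp, twist] using hP0
  | cons c W ih =>
    rw [List.flatMap_cons] at hp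
    simp only [List.length_cons]
    push_cast
    rcases List.suffix_or_suffix_of_suffix hp (List.suffix_append _ _) with h | ⟨t, rfl⟩
    · have := ih h
      linarith
    · have h1 := hP c t (List.suffix_append_self_iff.1 hp)
      have h2 := norm_twist_flatMap_le hD W
      have h3 := norm_twist_append_le τ v t (W.flatMap β)
      linarith

/-- A factor of a concatenation of blocks that is no longer than any block lies in one block or
meets just two of them. -/
theorem norm_twist_infix_flatMap_le (hP0 : 0 ≤ P)
    (hP : ∀ c, ∀ p, p <+: β c → ‖twist τ v p‖ ≤ P)
    (hP' : ∀ c, ∀ p, p <:+ β c → ‖twist τ v p‖ ≤ P)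
    (W : List A) {w : List L} (hw : w <:+: W.flatMap β) (hlen : ∀ c, w.length ≤ (β c).length) :
    ‖twist τ v w‖ ≤ 2 * P := by
  induction W with
  | nil =>
    rw [List.flatMap_nil, List.infix_nil] at hw
    simpa [hw, twist] using hP0
  | cons c W ih =>
    obtain ⟨p, q, h⟩ := hw
    rw [List.flatMap_cons] at h
    rcases List.append_eq_append_iff.1 h with ⟨e, he, -⟩ | ⟨e, he, hq⟩
    · have h1 := hP c (p ++ w) ⟨e, he.symm⟩
      have h2 := hP c p ⟨w ++ e, by rw [he, List.append_assoc]⟩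
      have h3 := norm_twist_right_le τ v p w
      linarith
    · rcases List.append_eq_append_iff.1 he with ⟨e', he', hw'⟩ | ⟨e', -, hw'⟩
      · have h1 : ‖twist τ v e'‖ ≤ P := hP' c e' ⟨p, he'.symm⟩
        have h2 : ‖twist τ v e‖ ≤ P := by
          cases W with
          | nil =>
            have h3 : e = [] := (List.append_eq_nil_iff.1 hq.symm).1
            simpa [h3, twist] using hP0
          | cons c' W =>
            refine hP c' e ?_
            have h3 : e <+: β c' ++ W.flatMap β := ⟨q, by rw [← hq, List.flatMap_cons]⟩
            refine List.prefix_of_prefix_length_le h3 (List.prefix_append _ _) ?_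
            have h4 := hlen c'
            rw [hw', List.length_append] at h4
            omega
        have h3 := norm_twist_append_le τ v e' e
        rw [hw']
        linarith
      · exact ih ⟨e', q, by rw [hq, hw']⟩

end Factors

section Levels

variable {A L : Type*} (b : ℕ → Substitution A) (θ : A → List L)

/-- The blocks `θ(ζ^{[k]}(c))` of level `k` over the alphabet of labels. -/
def block (k : ℕ) (c : A) : List L := ((iter b k).word c).flatMap θ

theorem block_zero (c : A) : block b θ 0 c = θ c := by
  simp [block, iter, Substitution.one]

theorem block_succ (k : ℕ) (c : A) :
    block b θ (k + 1) c = ((b k).word c).flatMap (block b θ k) := by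
  change (((b k).word c).flatMap (iter b k).word).flatMap θ = _
  rw [List.flatMap_assoc]
  rfl

theorem flatMap_block (k n : ℕ) (c : A) :
    block b θ (k + n) c = ((iter (fun j => b (k + j)) n).word c).flatMap (block b θ k) := by
  rw [block, iter_add]
  change (((iter (fun j => b (k + j)) n).word c).flatMap (iter b k).word).flatMap θ = _
  rw [List.flatMap_assoc]
  rfl

variable {b θ} {τ : L → ℝ} {v : L → ℂ} {ℓ D : ℕ → ℝ} {P : ℝ}

/-- A prefix or suffix of a block of level `k` splits into complete blocks of the levels
`j < k`, at most `ℓ j` of each, and an incomplete block of level `0`. -/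
theorem norm_twist_prefix_suffix_block_le (hℓ : ∀ k c, (((b k).word c).length : ℝ) ≤ ℓ k)
    (hD0 : ∀ k, 0 ≤ D k) (hD : ∀ k c, ‖twist τ v (block b θ k c)‖ ≤ D k) (hP0 : 0 ≤ P)
    (hP : ∀ c p, p <+: θ c ∨ p <:+ θ c → ‖twist τ v p‖ ≤ P) (k : ℕ) (c : A) (p : List L)
    (hp : p <+: block b θ k c ∨ p <:+ block b θ k c) :
    ‖twist τ v p‖ ≤ P + ∑ j ∈ Finset.range k, ℓ j * D j := by
  have hsum : ∀ k, 0 ≤ P + ∑ j ∈ Finset.range k, ℓ j * D j := fun k =>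
    add_nonneg hP0 (Finset.sum_nonneg fun j _ =>
      mul_nonneg ((Nat.cast_nonneg _).trans (hℓ j c)) (hD0 j))
  induction k generalizing c p with
  | zero =>
    rw [block_zero] at hp
    simpa using hP c p hp
  | succ k ih =>
    rw [block_succ] at hp
    rw [Finset.sum_range_succ]
    have h1 : ‖twist τ v p‖ ≤ ((b k).word c).length * D k +
        (P + ∑ j ∈ Finset.range k, ℓ j * D j) := by
      rcases hp with hp | hp
      · exact norm_twist_prefix_flatMap_le (hD0 k) (hsum k) (hD k)
          (fun c p h => ih c p (Or.inl h)) _ hp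
      · exact norm_twist_suffix_flatMap_le (hD0 k) (hsum k) (hD k)
          (fun c p h => ih c p (Or.inr h)) _ hp
    have h2 := mul_le_mul_of_nonneg_right (hℓ k c) (hD0 k)
    linarith

theorem length_le_length_block (hθ : ∀ c, θ c ≠ []) (k : ℕ) (c : A) :
    ((iter b k).word c).length ≤ (block b θ k c).length := by
  rw [block, List.length_flatMap]
  have h := List.card_nsmul_le_sum (((iter b k).word c).map fun d => (θ d).length) 1 ?_
  · simpa using h
  · intro n hn
    obtain ⟨d, -, rfl⟩ := List.mem_map.1 hn
    exact List.length_pos_iff.2 (hθ d)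

end Levels

/-! ### Twisted integrals of labelled functions -/

/-- The labels of `x, Tx, …, T^{N-1}x`. -/
def labelWord {A L : Type*} (lab : (ℤ → A) → L) (x : ℤ → A) (N : ℕ) : List L :=
  (List.range N).map fun j : ℕ => lab (shift (j : ℤ) x)

/-- The labelling `lab` of sequences is adapted, at the point `x`, to the blocks `θ` over the
sequence of substitutions `b`, and the label determines the roof: `τ (lab (T^n x)) = s_{x_n}`. -/
structure IsAdapted {A L : Type*} (b : ℕ → Substitution A) (θ : A → List L) (s : A → ℝ)
    (τ : L → ℝ) (lab : (ℤ → A) → L) (x : ℤ → A) : Prop where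
  infix_block : ∀ N K : ℕ, ∃ n ≥ K, ∃ c, labelWord lab x N <:+: block b θ n c
  roof_eq : ∀ n : ℕ, τ (lab (shift n x)) = s (x n)

section Labelled

variable {A : Type*} {L : Type*} {s : A → ℝ} {δ S : ℝ}

theorem labelWord_succ (lab : (ℤ → A) → L) (x : ℤ → A) (N : ℕ) :
    labelWord lab x (N + 1) = labelWord lab x N ++ [lab (shift N x)] := by
  simp [labelWord, List.range_succ]

/-- The twisted integral of a labelled function over one letter. -/
def letterIntegral (τ : L → ℝ) (ψ : L → ℝ → ℂ) (ω : ℝ) (d : L) : ℂ :=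
  ∫ t in Set.Ioo 0 (τ d), phase (ω * t) * ψ d t

variable [MeasurableSpace A] [DiscreteMeasurableSpace A]

/-- A twisted integral of a labelled function is a twisted sum over a word of labels, up to the
two incomplete letters at its ends. -/
theorem exists_norm_twistedIntegral_le (hδ : 0 < δ) (hs : ∀ c, δ ≤ s c) (hS : ∀ c, s c ≤ S)
    {τ : L → ℝ} {lab : (ℤ → A) → L} {ψ : L → ℝ → ℂ} {M : ℝ} (hψ : ∀ d t, ‖ψ d t‖ ≤ M)
    (hf : Measurable fun p : (ℤ → A) × ℝ => ψ (lab p.1) p.2)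
    {R : ℝ} (hR : 0 < R) (ω : ℝ) {x : ℤ → A} {u : ℝ} (hu0 : 0 ≤ u) (hu : u < s (x 0))
    (hτ : ∀ n : ℕ, τ (lab (shift n x)) = s (x n)) :
    ∃ N : ℕ, δ * N ≤ R + S ∧
      ‖twistedIntegral (flow s) (fun p => ψ (lab p.1) p.2) R ω (x, u)‖ ≤
        2 * (M * S) + ‖twist (ω • τ) (letterIntegral τ ψ ω) (labelWord lab x N)‖ := by
  have hM : 0 ≤ M := (norm_nonneg _).trans (hψ (lab x) 0)
  set f : (ℤ → A) × ℝ → ℂ := fun p => ψ (lab p.1) p.2 with hfdef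
  set F : ℝ → ℂ := fun t => phase (ω * t) * f (orbit s x t) with hF
  have hFb : ∀ t, ‖F t‖ ≤ M := fun t => by
    simp only [hF, norm_mul, norm_phase, one_mul]
    exact hψ _ _
  have hFm : Measurable F := by
    have h1 : Measurable fun t : ℝ => (x, t) := by fun_prop
    have h2 := hf.comp ((measurable_orbit hδ hs).comp h1)
    have h3 : Measurable fun t : ℝ => phase (ω * t) :=
      (continuous_phase.comp (by fun_prop)).measurable
    exact h3.mul h2
  have hFi : ∀ α β, IntervalIntegrable F volume α β := by
    intro α β
    refine (intervalIntegrable_const (c := M)).mono_fun hFm.aestronglyMeasurable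
      (ae_of_all _ fun t => ?_)
    rw [Real.norm_of_nonneg hM]
    exact hFb t
  have hmain : ∀ N : ℕ, ((labelWord lab x N).map (ω • τ)).sum = ω * roofSum s x N ∧
      ∫ t in (0 : ℝ)..roofSum s x N, F t =
        twist (ω • τ) (letterIntegral τ ψ ω) (labelWord lab x N) := by
    intro N
    induction N with
    | zero => simp [labelWord, twist, roofSum_zero]
    | succ N ih =>
      obtain ⟨ih1, ih2⟩ := ih
      have hstep : roofSum s x ((N + 1 : ℕ) : ℤ) = roofSum s x N + s (x N) := by
        rw [← roofSum_add_one]; push_cast; rfl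
      rw [labelWord_succ]
      constructor
      · rw [List.map_append, List.sum_append, ih1, hstep]
        simp only [List.map_cons, List.map_nil, List.sum_cons, List.sum_nil, Pi.smul_apply,
          smul_eq_mul, hτ]
        ring
      · rw [twist_append, ← ih2, ih1,
          ← intervalIntegral.integral_add_adjacent_intervals (hFi 0 (roofSum s x N))
            (hFi _ (roofSum s x ((N + 1 : ℕ) : ℤ)))]
        congr 1
        simp only [twist, mul_zero, add_zero]
        have hs0 : 0 ≤ s (x N) := hδ.le.trans (hs _)
        have h1 : ∫ t in roofSum s x N..roofSum s x ((N + 1 : ℕ) : ℤ), F t =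
            ∫ t in (0 : ℝ)..s (x N), F (roofSum s x N + t) := by
          rw [intervalIntegral.integral_comp_add_left F, add_zero, hstep]
        rw [h1, intervalIntegral.integral_of_le hs0, integral_Ioc_eq_integral_Ioo, letterIntegral,
          hτ, ← integral_const_mul]
        refine setIntegral_congr_fun measurableSet_Ioo fun t ht => ?_
        simp only [hF, hfdef]
        rw [orbit_eq hδ hs (n := N) (by linarith [ht.1])
          (by rw [roofSum_add_one]; linarith [ht.2]), mul_add, phase_add]
        simp only [add_sub_cancel_left]
        ring
  set k := levelIndex s x (u + R) with hk
  obtain ⟨hk1, hk2⟩ := levelIndex_spec hδ hs (x := x) (u + R)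
  have hk0 : 0 ≤ k := by
    by_contra hlt
    have h1 : k + 1 ≤ 0 := by omega
    have h2 := (strictMono_roofSum hδ hs (x := x)).monotone h1
    rw [roofSum_zero] at h2
    linarith
  obtain ⟨N, hN⟩ := Int.eq_ofNat_of_zero_le hk0
  rw [← hk, hN] at hk1 hk2
  rw [roofSum_add_one] at hk2
  refine ⟨N, ?_, ?_⟩
  · have h1 := mul_sub_le_roofSum_sub (x := x) hs (k := 0) (n := N) (by omega)
    rw [roofSum_zero] at h1
    push_cast at h1
    linarith [hS (x 0)]
  · have h1 : ‖twistedIntegral (flow s) f R ω (x, u)‖ = ‖∫ t in u..(u + R), F t‖ := by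
      have h2 : ∫ t in u..(u + R), F t = phase (ω * u) * twistedIntegral (flow s) f R ω (x, u) := by
        have h3 := intervalIntegral.integral_comp_add_left (a := 0) (b := R) F u
        rw [add_zero] at h3
        rw [← h3, twistedIntegral, intervalIntegral.integral_of_le hR.le, ← integral_const_mul]
        refine setIntegral_congr_fun measurableSet_Ioc fun t _ => ?_
        simp only [hF]
        rw [flow_eq_orbit, mul_add, phase_add]
        ring
      rw [h2, norm_mul, norm_phase, one_mul]
    rw [h1, ← (hmain N).2,
      ← intervalIntegral.integral_add_adjacent_intervals (hFi u 0) (hFi 0 (u + R)),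
      ← intervalIntegral.integral_add_adjacent_intervals (hFi 0 (roofSum s x N))
        (hFi _ (u + R))]
    have h4 : ‖∫ t in u..(0 : ℝ), F t‖ ≤ M * S := by
      refine (intervalIntegral.norm_integral_le_of_norm_le_const fun t _ => hFb t).trans ?_
      gcongr
      rw [zero_sub, abs_neg, abs_of_nonneg hu0]
      exact hu.le.trans (hS _)
    have h5 : ‖∫ t in roofSum s x N..(u + R), F t‖ ≤ M * S := by
      refine (intervalIntegral.norm_integral_le_of_norm_le_const fun t _ => hFb t).trans ?_
      gcongr
      rw [abs_of_nonneg (by linarith)]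
      linarith [hS (x N)]
    refine (norm_add_le _ _).trans ?_
    have h6 := norm_add_le (∫ t in (0 : ℝ)..roofSum s x N, F t)
      (∫ t in roofSum s x N..(u + R), F t)
    linarith

end Labelled

section Bound

variable {A : Type*} [Fintype A]

/-- The least length of a word of level `k`. -/
def minLength [Nonempty A] (b : ℕ → Substitution A) (k : ℕ) : ℕ :=
  Finset.univ.inf' Finset.univ_nonempty fun c => ((iter b k).word c).length

theorem minLength_le [Nonempty A] (b : ℕ → Substitution A) (k : ℕ) (c : A) :
    minLength b k ≤ ((iter b k).word c).length :=
  Finset.inf'_le _ (Finset.mem_univ c)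

theorem exists_minLength_eq [Nonempty A] (b : ℕ → Substitution A) (k : ℕ) :
    ∃ c, minLength b k = ((iter b k).word c).length := by
  obtain ⟨c, -, hc⟩ := Finset.exists_mem_eq_inf' (Finset.univ_nonempty (α := A))
    fun c => ((iter b k).word c).length
  exact ⟨c, hc⟩

theorem HasGrowth.tendsto_minLength [Nonempty A] {b : ℕ → Substitution A} {lam : ℝ}
    (h : HasGrowth b lam) : Tendsto (fun k => (minLength b k : ℝ)) atTop atTop := by
  refine tendsto_atTop.2 fun M => ?_
  filter_upwards [h.length_large M] with k hk
  obtain ⟨c, hc⟩ := exists_minLength_eq b k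
  rw [hc]
  exact hk c

/-- If the cocycle grows at a rate below `lam / 2`, then the squares of the twisted integrals over
times `R` are `o(R)`, uniformly over the adapted points, along a sequence of times `R` that does
not depend on the frequency. -/
theorem eventually_normSq_twistedIntegral_le [Nonempty A] [DecidableEq A] [MeasurableSpace A]
    [DiscreteMeasurableSpace A] {L : Type*} {s : A → ℝ} {δ S : ℝ}
    (hδ : 0 < δ) (hs : ∀ c, δ ≤ s c) (hS : ∀ c, s c ≤ S)
    {b : ℕ → Substitution A} {lam : ℝ} (hb : HasGrowth b lam)
    {θ : A → List L} (hθ : ∀ c, θ c ≠ []) {τ : L → ℝ} (hτS : ∀ d, τ d ≤ S)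
    {lab : (ℤ → A) → L} {ψ : L → ℝ → ℂ} {M : ℝ} (hψ : ∀ d t, ‖ψ d t‖ ≤ M)
    (hf : Measurable fun p : (ℤ → A) × ℝ => ψ (lab p.1) p.2) {ω : ℝ}
    (hχ : upperLyapunov b (ω • fun c => ((θ c).map τ).sum) < ((lam / 2 : ℝ) : EReal))
    {η : ℝ} (hη : 0 < η) :
    ∀ᶠ k : ℕ in atTop, ∀ (x : ℤ → A) (u : ℝ), IsAdapted b θ s τ lab x → 0 ≤ u → u < s (x 0) →
      ‖twistedIntegral (flow s) (fun p => ψ (lab p.1) p.2) (δ / 2 * minLength b k) ω (x, u)‖ ^ 2 ≤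
        η * (δ / 2 * minLength b k) := by
  classical
  rcases isEmpty_or_nonempty L with hL | ⟨⟨d₀⟩⟩
  · exact Eventually.of_forall fun k x => hL.elim (lab x)
  have hM : 0 ≤ M := (norm_nonneg _).trans (hψ d₀ 0)
  obtain ⟨c₀⟩ := ‹Nonempty A›
  have : Nonempty A := ⟨c₀⟩
  have hS0 : 0 ≤ S := hδ.le.trans ((hs c₀).trans (hS c₀))
  obtain ⟨β, hβ, C, hC⟩ := exists_forall_le_of_upperLyapunov_lt b _ hχ
  have hC0 : 0 ≤ C := by
    have := (NNReal.coe_nonneg _).trans (hC 0)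
    simpa using this
  set ε : ℝ := (lam / 2 - β) / 2 with hε
  have hε0 : 0 < ε := by rw [hε]; linarith
  have hβε : β + ε < lam / 2 := by rw [hε]; linarith
  obtain ⟨E, hE0, hE⟩ := hb.length_subexp ε hε0
  obtain ⟨B, hB⟩ : ∃ B : ℕ, ∀ c, (θ c).length ≤ B := by
    obtain ⟨B, hB⟩ := (Set.finite_range fun c => (θ c).length).bddAbove
    exact ⟨B, fun c => hB ⟨c, rfl⟩⟩
  set v : L → ℂ := letterIntegral τ ψ ω with hv
  have hvb : ∀ d, ‖v d‖ ≤ M * S := by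
    intro d
    refine (norm_setIntegral_le_of_norm_le_const (C := M) (by simp) fun t _ => ?_).trans ?_
    · rw [norm_mul, norm_phase, one_mul]
      exact hψ d t
    · refine mul_le_mul_of_nonneg_left ?_ hM
      rw [measureReal_def, Real.volume_Ioo, sub_zero, ENNReal.toReal_ofReal']
      exact max_le (hτS d) hS0
  set Q : ℝ := B * (M * S) with hQ
  have hQ0 : 0 ≤ Q := by positivity
  have hMS : 0 ≤ M * S := mul_nonneg hM hS0
  have hsub : ∀ c (p : List L), p.length ≤ (θ c).length → ‖twist (ω • τ) v p‖ ≤ Q := by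
    intro c p hp
    refine (norm_twist_le_mul_length _ _ p fun d _ => hvb d).trans ?_
    refine mul_le_mul_of_nonneg_right ?_ hMS
    exact_mod_cast hp.trans (hB c)
  set D : ℕ → ℝ := fun j => Fintype.card A * (C * Real.exp (j * β)) * Q with hD
  have hD0 : ∀ j, 0 ≤ D j := fun j => by positivity
  have hDb : ∀ j c, ‖twist (ω • τ) v (block b θ j c)‖ ≤ D j := by
    intro j c
    rw [block, twist_flatMap]
    refine (norm_twist_word_le _ _ _ (fun c => hsub c (θ c) le_rfl) c).trans ?_
    have hξ : (fun c => ((θ c).map (ω • τ)).sum) = ω • fun c => ((θ c).map τ).sum := by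
      funext c
      simp only [Pi.smul_apply, smul_eq_mul]
      rw [← List.sum_map_mul_left]
      rfl
    rw [hξ, ← cocycle_eq]
    have h1 := hC j
    change _ ≤ Fintype.card A * (C * Real.exp (j * β)) * Q
    gcongr
  have hlenD : ∀ j : ℕ, E * Real.exp (j * ε) * D j =
      E * (Fintype.card A * C * Q) * Real.exp (j * (β + ε)) := by
    intro j
    rw [mul_add, Real.exp_add]
    simp only [hD]
    ring
  have hev := hb.eventually_sq_le hβε (M * S + Q) (E * (Fintype.card A * C * Q))
    (by positivity) (by positivity) (show 0 < η * δ / 8 by positivity)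
  have hlarge := hb.tendsto_minLength.eventually_ge_atTop (2 * S / δ)
  have hpos := hb.tendsto_minLength.eventually_gt_atTop 0
  filter_upwards [hev, hlarge, hpos] with k hk hk2 hk3 x u hx hu0 hu
  have hR : 0 < δ / 2 * minLength b k := by positivity
  obtain ⟨N, hN, hI⟩ := exists_norm_twistedIntegral_le hδ hs hS hψ hf hR ω hu0 hu hx.roof_eq
  -- The factor `δ / 2` in the time keeps the number of letters met below the least length of the
  -- blocks of level `k`, so that at most two of these blocks are met.
  have hNle : N ≤ minLength b k := by
    rw [div_le_iff₀ hδ] at hk2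
    have h1 : δ * N ≤ δ * minLength b k := by linarith
    exact_mod_cast le_of_mul_le_mul_left h1 hδ
  obtain ⟨n, hn, c, hinf⟩ := hx.infix_block N k
  obtain ⟨r, rfl⟩ := Nat.exists_eq_add_of_le hn
  rw [flatMap_block] at hinf
  set T : ℝ := ∑ j ∈ Finset.range k, E * Real.exp (j * ε) * D j with hT
  have hT0 : 0 ≤ T := Finset.sum_nonneg fun j _ =>
    mul_nonneg (mul_nonneg hE0 (Real.exp_pos _).le) (hD0 j)
  have hps := norm_twist_prefix_suffix_block_le (b := b) (θ := θ) (τ := ω • τ) (v := v)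
    (ℓ := fun j => E * Real.exp (j * ε)) (D := D) (P := Q) hE hD0 hDb hQ0
    (fun c p hp => hsub c p (by
      rcases hp with hp | hp
      · exact hp.length_le
      · exact hp.length_le)) k
  have htw : ‖twist (ω • τ) v (labelWord lab x N)‖ ≤ 2 * (Q + T) := by
    refine norm_twist_infix_flatMap_le (add_nonneg hQ0 hT0) (fun c p h => hps c p (Or.inl h))
      (fun c p h => hps c p (Or.inr h)) _ hinf fun c => ?_
    simp only [labelWord, List.length_map, List.length_range]
    exact hNle.trans ((minLength_le b k c).trans (length_le_length_block hθ k c))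
  obtain ⟨c₁, hc₁⟩ := exists_minLength_eq b k
  have hk4 := hk c₁
  rw [← hc₁] at hk4
  simp only [← hlenD] at hk4
  rw [← hT] at hk4
  have hI2 : ‖twistedIntegral (flow s) (fun p => ψ (lab p.1) p.2) (δ / 2 * minLength b k) ω
      (x, u)‖ ≤ 2 * (M * S + Q + T) := by linarith
  calc _ ≤ (2 * (M * S + Q + T)) ^ 2 := by gcongr
    _ = 4 * (M * S + Q + T) ^ 2 := by ring
    _ ≤ 4 * (η * δ / 8 * minLength b k) := by gcongr
    _ = _ := by ring

end Bound

/-! ### The exponent is at least `lam / 2` almost everywhere for the spectral measures -/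

theorem tendsto_one_div_six_mul {R : ℕ → ℝ} (hR : Tendsto R atTop atTop) :
    Tendsto (fun k => 1 / (6 * R k)) atTop (𝓝[>] 0) := by
  refine tendsto_nhdsWithin_iff.2 ⟨?_, ?_⟩
  · simp only [one_div]
    exact tendsto_inv_atTop_zero.comp (hR.const_mul_atTop (by norm_num))
  · filter_upwards [hR.eventually_gt_atTop 0] with k hk
    show 0 < 1 / (6 * R k)
    positivity

/-- A finite measure on `ℝ` gives no mass to the points around which it is `o(r)` on intervals of
radius `r`, along a sequence of radii: at almost all points the density of Lebesgue measure with
respect to it is finite. -/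
theorem ae_notMem_of_measure_closedBall_le (σ : Measure ℝ) [IsFiniteMeasure σ] {R : ℕ → ℝ}
    (hR : Tendsto R atTop atTop) {E : Set ℝ}
    (hE : ∀ ω ∈ E, ∀ η : ℝ, 0 < η → ∀ᶠ k in atTop,
      σ (Metric.closedBall ω (1 / (6 * R k))) ≤ ENNReal.ofReal (η / R k)) :
    ∀ᵐ ω ∂σ, ω ∉ E := by
  filter_upwards [Besicovitch.ae_tendsto_rnDeriv volume σ, Measure.rnDeriv_lt_top volume σ]
    with ω hω hfin hmem
  obtain ⟨c, hc1, hc2⟩ := ENNReal.lt_iff_exists_nnreal_btwn.1 hfin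
  have hc0 : 0 < (c : ENNReal) := zero_le.trans_lt hc1
  have hr := tendsto_one_div_six_mul hR
  have h1 := (hω.comp hr).eventually_lt_const hc1
  have hc0' : (0 : ℝ) < c := by exact_mod_cast hc0
  have h2 := hE ω hmem (1 / (6 * c)) (by positivity)
  obtain ⟨k, hk1, hk2, hk3⟩ := (h1.and (h2.and (hR.eventually_gt_atTop 0))).exists
  have h3 := (ENNReal.div_le_iff_le_mul (Or.inr ENNReal.coe_ne_top) (Or.inr hc0.ne')).1 hk1.le
  rw [Real.volume_closedBall] at h3
  have h4 := h3.trans (mul_le_mul_right hk2 _)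
  rw [← ENNReal.ofReal_coe_nnreal, ← ENNReal.ofReal_mul hc0'.le,
    ENNReal.ofReal_le_ofReal_iff (by positivity)] at h4
  change 2 * (1 / (6 * R k)) ≤ _ at h4
  have h5 : (c : ℝ) * (1 / (6 * c) / R k) = 1 / (6 * R k) := by field_simp
  rw [h5] at h4
  have h6 : 0 < 1 / (6 * R k) := by positivity
  linarith

section

variable {A : Type*} [Fintype A] [MeasurableSpace A] [DiscreteMeasurableSpace A]

omit [Fintype A] in
theorem isMeasureFlow_flow {s : A → ℝ} {δ : ℝ} (hδ : 0 < δ) (hs : ∀ b, δ ≤ s b)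
    {μ : Measure (ℤ → A)} [IsFiniteMeasure μ] (hinv : MeasurePreserving (shift 1) μ μ) :
    IsMeasureFlow (suspensionMeasure s μ) (flow s) where
  measurable := measurable_flow_uncurry hδ hs
  preserving _ ht := measurePreserving_flow hδ hs hinv ht
  add := flow_flow hδ hs

/-- The mean squares of the twisted integrals of a labelled function over times `R` are `o(R)` if
the cocycle grows at a rate below `lam / 2`. -/
theorem eventually_integral_normSq_twistedIntegral_le [Nonempty A] [DecidableEq A] {L : Type*}
    {s : A → ℝ} {δ S : ℝ} (hδ : 0 < δ) (hs : ∀ c, δ ≤ s c) (hS : ∀ c, s c ≤ S)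
    {μ : Measure (ℤ → A)} [IsFiniteMeasure μ]
    {b : ℕ → Substitution A} {lam : ℝ} (hb : HasGrowth b lam)
    {θ : A → List L} (hθ : ∀ c, θ c ≠ []) {τ : L → ℝ} (hτS : ∀ d, τ d ≤ S)
    {lab : (ℤ → A) → L} {ψ : L → ℝ → ℂ} {M : ℝ} (hψ : ∀ d t, ‖ψ d t‖ ≤ M)
    (hf : Measurable fun p : (ℤ → A) × ℝ => ψ (lab p.1) p.2)
    (hadapt : ∀ᵐ x ∂μ, IsAdapted b θ s τ lab x) {ω : ℝ}
    (hχ : upperLyapunov b (ω • fun c => ((θ c).map τ).sum) < ((lam / 2 : ℝ) : EReal))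
    {η : ℝ} (hη : 0 < η) :
    ∀ᶠ k : ℕ in atTop, ∫ p, ‖twistedIntegral (flow s) (fun p => ψ (lab p.1) p.2)
      (δ / 2 * minLength b k) ω p‖ ^ 2 ∂(suspensionMeasure s μ) ≤ η * (δ / 2 * minLength b k) := by
  have := isFiniteMeasure_suspensionMeasure (s := s) μ
  set V : ℝ := (suspensionMeasure s μ).real Set.univ with hV
  have hV0 : 0 ≤ V := measureReal_nonneg
  have hae := ae_suspensionMeasure (s := s) μ hadapt
  have hη' : 0 < η / (V + 1) := by positivity
  filter_upwards [eventually_normSq_twistedIntegral_le hδ hs hS hb hθ hτS hψ hf hχ hη'] with k hk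
  have h1 : ∀ᵐ p ∂(suspensionMeasure s μ),
      ‖twistedIntegral (flow s) (fun p => ψ (lab p.1) p.2) (δ / 2 * minLength b k) ω p‖ ^ 2 ≤
        η / (V + 1) * (δ / 2 * minLength b k) := by
    filter_upwards [hae] with p hp
    exact hk p.1 p.2 hp.1 hp.2.1 hp.2.2
  refine (integral_mono_of_nonneg (ae_of_all _ fun p => sq_nonneg _) (integrable_const _)
    h1).trans ?_
  rw [integral_const, smul_eq_mul, ← hV]
  have h2 : V * (η / (V + 1)) ≤ η := by
    rw [mul_div_assoc', div_le_iff₀ (by positivity)]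
    nlinarith
  rw [← mul_assoc]
  exact mul_le_mul_of_nonneg_right h2 (by positivity)

omit [Fintype A] [MeasurableSpace A] [DiscreteMeasurableSpace A] in
/-- Every letter occurs in a word of the next substitution, so the factors of the blocks of one
level are factors of the blocks of all later levels. -/
theorem exists_infix_block {L : Type*} {b : ℕ → Substitution A} (hadm : ∀ n, (b n).IsAdmissible)
    (θ : A → List L) {w : List L} {n : ℕ} {c : A} (h : w <:+: block b θ n c) (K : ℕ) :
    ∃ n' ≥ K, ∃ c', w <:+: block b θ n' c' := by
  have key : ∀ r, ∃ c', w <:+: block b θ (n + r) c' := by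
    intro r
    induction r with
    | zero => exact ⟨c, h⟩
    | succ r ih =>
      obtain ⟨c', hc'⟩ := ih
      obtain ⟨d, hd⟩ := (hadm (n + r)).1 c'
      refine ⟨d, hc'.trans ?_⟩
      rw [← add_assoc, block_succ]
      obtain ⟨l₁, l₂, h12⟩ := List.append_of_mem hd
      rw [h12, List.flatMap_append, List.flatMap_cons]
      exact ⟨_, _, List.append_assoc _ _ _⟩
  obtain ⟨c', hc'⟩ := key K
  exact ⟨n + K, Nat.le_add_left _ _, c', hc'⟩

omit [Fintype A] [MeasurableSpace A] [DiscreteMeasurableSpace A] in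
theorem isAdapted_letter {b : ℕ → Substitution A} (hadm : ∀ n, (b n).IsAdmissible) (s : A → ℝ)
    {x : ℤ → A} (hx : x ∈ space b) :
    IsAdapted b (fun c => [c]) s s (fun x => x 0) x := by
  refine ⟨fun N K => ?_, fun n => by simp [shift]⟩
  obtain ⟨n, -, c, h⟩ := hx 0 N
  refine exists_infix_block hadm _ (n := n) (c := c) ?_ K
  have h1 : block b (fun c => [c]) n c = (iter b n).word c := by
    simp [block]
  have h2 : labelWord (fun x : ℤ → A => x 0) x N = List.ofFn fun j : Fin N => x (0 + (j : ℕ)) := by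
    refine List.ext_getElem (by simp [labelWord]) fun i h1 h2 => ?_
    simp [labelWord, shift]
  rw [h1, h2]
  exact h

theorem ae_le_upperLyapunov [Nonempty A] [DecidableEq A] {b : ℕ → Substitution A} {lam : ℝ}
    (hadm : ∀ n, (b n).IsAdmissible) (hb : HasGrowth b lam) {s : A → ℝ} (hs : ∀ c, 0 < s c)
    {μ : Measure (ℤ → A)} (hμ : IsInvariantProbability b μ) {ψ : A → ℝ → ℂ}
    (hψ : IsLipFamily s ψ) {σ : Measure ℝ}
    (hσ : IsSpectralMeasure (suspensionMeasure s μ) (flow s) (cylindrical ψ) σ) :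
    ∀ᵐ ω ∂σ, ((lam / 2 : ℝ) : EReal) ≤ upperLyapunov b (ω • s) := by
  have := hμ.prob
  have := hσ.1
  obtain ⟨c₀, hδs⟩ := Finite.exists_min s
  obtain ⟨c₁, hS⟩ := Finite.exists_max s
  have hδ := hs c₀
  set δ := s c₀ with hδdef
  have hflow := isMeasureFlow_flow hδ hδs hμ.invariant
  have := isFiniteMeasure_suspensionMeasure (s := s) μ
  -- The functions `ψ_b` matter only on `[0, s_b)`; elsewhere they need not even be measurable.
  set φ : A → ℝ → ℂ := fun c => (Set.Ico 0 (s c)).indicator (ψ c) with hφ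
  have hcont : ∀ c, ContinuousOn (ψ c) (Set.Icc 0 (s c)) := fun c =>
    (hψ c).choose_spec.continuousOn
  have hφm : ∀ c, Measurable (φ c) := fun c => by
    have h1 : Measurable ((Set.Ico 0 (s c)).indicator (ψ c)) := by
      refine measurable_of_restrict_of_restrict_compl (s := Set.Ico 0 (s c))
        measurableSet_Ico ?_ ?_
      · have h1 := ((hcont c).mono Set.Ico_subset_Icc_self).domRestrict.measurable
        convert h1 using 1
        funext t
        exact Set.indicator_of_mem t.2 _
      · convert measurable_const (a := (0 : ℂ)) using 1
        funext t
        exact Set.indicator_of_notMem t.2 _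
    exact h1
  obtain ⟨M, hM⟩ : ∃ M : ℝ, ∀ c t, ‖φ c t‖ ≤ M := by
    have h1 : ∀ c, ∃ M : ℝ, 0 ≤ M ∧ ∀ t ∈ Set.Icc 0 (s c), ‖ψ c t‖ ≤ M := by
      intro c
      obtain ⟨M, hM⟩ := isCompact_Icc.exists_bound_of_continuousOn (hcont c)
      exact ⟨max M 0, le_max_right _ _, fun t ht => (hM t ht).trans (le_max_left _ _)⟩
    choose M hM0 hM using h1
    refine ⟨∑ c, M c, fun c t => ?_⟩
    have h2 : M c ≤ ∑ c, M c := Finset.single_le_sum (fun c _ => hM0 c) (Finset.mem_univ c)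
    by_cases ht : t ∈ Set.Ico 0 (s c)
    · simp only [hφ, Set.indicator_of_mem ht]
      exact (hM c t (Set.Ico_subset_Icc_self ht)).trans h2
    · simp only [hφ, Set.indicator_of_notMem ht, norm_zero]
      exact (hM0 c).trans h2
  have hfm : Measurable fun p : (ℤ → A) × ℝ => φ (p.1 0) p.2 := by
    have h1 : Measurable fun q : ℝ × A => φ q.2 q.1 := measurable_from_prod_countable_left hφm
    have h2 : Measurable fun p : (ℤ → A) × ℝ => (p.2, p.1 0) :=
      measurable_snd.prodMk ((measurable_pi_apply 0).comp measurable_fst)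
    have h3 := h1.comp h2
    exact h3
  have hf2 : MemLp (fun p : (ℤ → A) × ℝ => φ (p.1 0) p.2) 2 (suspensionMeasure s μ) :=
    MemLp.of_bound hfm.aestronglyMeasurable M (ae_of_all _ fun p => hM _ _)
  have heq : ∀ p : (ℤ → A) × ℝ, 0 ≤ p.2 ∧ p.2 < s (p.1 0) → cylindrical ψ p = φ (p.1 0) p.2 := by
    intro p hp
    have hp' : p.2 ∈ Set.Ico 0 (s (p.1 0)) := hp
    simp only [hφ, Set.indicator_of_mem hp']
    rfl
  have hσ' : IsSpectralMeasure (suspensionMeasure s μ) (flow s)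
      (fun p => φ (p.1 0) p.2) σ := by
    refine ⟨hσ.1, fun t => (hσ.2 t).trans ?_⟩
    refine integral_congr_ae ?_
    filter_upwards [ae_suspensionMeasure (s := s) μ hμ.ae_mem] with p hp
    rw [heq p hp.2, heq (flow s t p) (orbit_mem hδ hδs (p.2 + t))]
  have hR : Tendsto (fun k => δ / 2 * (minLength b k : ℝ)) atTop atTop :=
    hb.tendsto_minLength.const_mul_atTop (by positivity)
  have hadapt : ∀ᵐ x ∂μ, IsAdapted b (fun c => [c]) s s (fun x => x 0) x := by
    filter_upwards [hμ.ae_mem] with x hx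
    exact isAdapted_letter hadm s hx
  have key := ae_notMem_of_measure_closedBall_le σ hR
    (E := {ω | upperLyapunov b (ω • s) < ((lam / 2 : ℝ) : EReal)}) ?_
  · filter_upwards [key] with ω hω
    exact not_lt.1 hω
  · intro ω hω η hη
    have hξ : (fun c : A => ([c].map s).sum) = s := by
      funext c; simp
    have hχ : upperLyapunov b (ω • fun c : A => ([c].map s).sum) < ((lam / 2 : ℝ) : EReal) := by
      rw [hξ]; exact hω
    have h1 := eventually_integral_normSq_twistedIntegral_le hδ hδs hS hb
      (θ := fun c : A => [c]) (by simp) (τ := s) hS (lab := fun x => x 0) hM hfm hadapt hχ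
      (show 0 < η / 4 by positivity)
    filter_upwards [h1, hR.eventually_gt_atTop 0] with k hk hk0
    refine (measure_closedBall_le hflow hfm hf2 (fun t _ => hσ'.2 t) hk0 ω).trans
      (ENNReal.ofReal_le_ofReal ?_)
    set R := δ / 2 * (minLength b k : ℝ) with hRdef
    calc _ ≤ 4 / R ^ 2 * (η / 4 * R) := by gcongr
      _ = η / R := by field_simp

end

/-! ### Substitutions acting on two-sided sequences -/

section Apply

variable {A : Type*} (ζ : Substitution A) (y : ℤ → A)

/-- The position in `ζ(y)` at which the word `ζ(y_n)` begins. -/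
def wordPos (n : ℤ) : ℤ :=
  ∑ i ∈ Finset.Ico 0 n, ((ζ.word (y i)).length : ℤ) -
    ∑ i ∈ Finset.Ico n 0, ((ζ.word (y i)).length : ℤ)

theorem wordPos_cast (n : ℤ) :
    (wordPos ζ y n : ℝ) = roofSum (fun c => ((ζ.word c).length : ℝ)) y n := by
  simp [wordPos, roofSum]

theorem wordPos_zero : wordPos ζ y 0 = 0 := by simp [wordPos]

theorem wordPos_add_one (n : ℤ) :
    wordPos ζ y (n + 1) = wordPos ζ y n + (ζ.word (y n)).length := by
  have h := roofSum_add_one (fun c => ((ζ.word c).length : ℝ)) y n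
  rw [← wordPos_cast, ← wordPos_cast] at h
  exact_mod_cast h

theorem wordPos_shift (k n : ℤ) :
    wordPos ζ (shift k y) n = wordPos ζ y (n + k) - wordPos ζ y k := by
  have h := roofSum_shift (fun c => ((ζ.word c).length : ℝ)) y k n
  rw [← wordPos_cast, ← wordPos_cast, ← wordPos_cast] at h
  exact_mod_cast h

theorem one_le_length (c : A) : (1 : ℝ) ≤ ((ζ.word c).length : ℝ) := by
  exact_mod_cast List.length_pos_iff.2 (ζ.word_ne_nil c)

/-- Every position of `ζ(y)` lies in a unique word `ζ(y_j)`; here is the existence. -/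
theorem exists_eq_wordPos_add (i : ℤ) :
    ∃ (j : ℤ) (k : ℕ), k < (ζ.word (y j)).length ∧ i = wordPos ζ y j + k := by
  obtain ⟨h1, h2⟩ := levelIndex_spec (s := fun c => ((ζ.word c).length : ℝ)) (x := y)
    one_pos (one_le_length ζ) (i : ℝ)
  set j := levelIndex (fun c => ((ζ.word c).length : ℝ)) y (i : ℝ)
  rw [← wordPos_cast] at h1 h2
  have h1' : wordPos ζ y j ≤ i := by exact_mod_cast h1
  have h2' : i < wordPos ζ y (j + 1) := by exact_mod_cast h2
  rw [wordPos_add_one] at h2'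
  refine ⟨j, (i - wordPos ζ y j).toNat, by omega, by omega⟩

theorem getElem?_flatMap_range {w : ℕ → List A} {n N k : ℕ} (hn : n < N)
    (hk : k < (w n).length) :
    ((List.range N).flatMap w)[((List.range n).flatMap w).length + k]? = (w n)[k]? := by
  obtain ⟨r, rfl⟩ := Nat.exists_eq_add_of_le (Nat.succ_le_of_lt hn)
  rw [List.range_add, List.range_succ, List.flatMap_append, List.flatMap_append, List.append_assoc,
    List.getElem?_append_right (Nat.le_add_right _ _), Nat.add_sub_cancel_left]
  simp only [List.flatMap_cons, List.flatMap_nil, List.append_nil]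
  rw [List.getElem?_append_left hk]

theorem le_length_flatMap_range {w : ℕ → List A} (hw : ∀ i, w i ≠ []) (n : ℕ) :
    n ≤ ((List.range n).flatMap w).length := by
  cases n with
  | zero => simp
  | succ n => exact Substitution.lt_length_flatMap_range w hw n

theorem wordPos_natCast (n : ℕ) :
    wordPos ζ y n = (((List.range n).flatMap fun i : ℕ => ζ.word (y (i : ℤ))).length : ℕ) := by
  induction n with
  | zero => simp [wordPos_zero]
  | succ n ih =>
    push_cast
    rw [wordPos_add_one, ih, List.range_succ, List.flatMap_append, List.length_append]
    simp

theorem wordPos_negSucc (n : ℕ) :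
    wordPos ζ y (Int.negSucc n) =
      -((((List.range n).flatMap fun i : ℕ => (ζ.word (y (Int.negSucc i))).reverse).length : ℕ) +
        ((ζ.word (y (Int.negSucc n))).length : ℕ) : ℤ) := by
  induction n with
  | zero =>
    have h := wordPos_add_one ζ y (Int.negSucc 0)
    have e : Int.negSucc 0 + 1 = 0 := rfl
    rw [e, wordPos_zero] at h
    simp only [List.range_zero, List.flatMap_nil, List.length_nil]
    omega
  | succ n ih =>
    have h := wordPos_add_one ζ y (Int.negSucc (n + 1))
    have e : Int.negSucc (n + 1) + 1 = Int.negSucc n := by omega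
    rw [e, ih] at h
    rw [List.range_succ, List.flatMap_append, List.length_append]
    simp only [List.flatMap_cons, List.flatMap_nil, List.append_nil, List.length_reverse]
    push_cast
    omega

theorem apply_wordPos_add (j : ℤ) {k : ℕ} (hk : k < (ζ.word (y j)).length) :
    ζ.apply y (wordPos ζ y j + k) = (ζ.word (y j))[k] := by
  cases j with
  | ofNat n =>
    have hk' : k < (ζ.word (y (n : ℤ))).length := hk
    set w : ℕ → List A := fun i => ζ.word (y (i : ℤ)) with hw
    have h1 : wordPos ζ y (Int.ofNat n) + k =
        Int.ofNat (((List.range n).flatMap w).length + k) := by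
      rw [Int.ofNat_eq_natCast, wordPos_natCast]
      rfl
    rw [h1, Substitution.apply]
    have h2 := getElem?_flatMap_range (w := w) (n := n)
      (N := ((List.range n).flatMap w).length + k + 1) (k := k)
      (by have := le_length_flatMap_range (w := w) (fun i => ζ.word_ne_nil _) n; omega) hk'
    rw [List.getElem?_eq_getElem hk', List.getElem?_eq_some_iff] at h2
    obtain ⟨_, h2⟩ := h2
    exact h2
  | negSucc n =>
    set w : ℕ → List A := fun i => (ζ.word (y (Int.negSucc i))).reverse with hw
    set l := (ζ.word (y (Int.negSucc n))).length with hl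
    have h1 : wordPos ζ y (Int.negSucc n) + k =
        Int.negSucc (((List.range n).flatMap w).length + (l - 1 - k)) := by
      have h0 : wordPos ζ y (Int.negSucc n) =
          -(((((List.range n).flatMap w).length + l : ℕ)) : ℤ) := by
        rw [wordPos_negSucc]
        push_cast
        rfl
      omega
    rw [h1, Substitution.apply]
    have hk' : l - 1 - k < (w n).length := by
      simp only [hw, List.length_reverse]; omega
    have h2 := getElem?_flatMap_range (w := w) (n := n)
      (N := ((List.range n).flatMap w).length + (l - 1 - k) + 1) (k := l - 1 - k)
      (by
        have := le_length_flatMap_range (w := w) (fun i => by simpa [hw] using ζ.word_ne_nil _) n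
        omega) hk'
    rw [List.getElem?_eq_getElem hk', List.getElem?_eq_some_iff] at h2
    obtain ⟨_, h2⟩ := h2
    refine h2.trans ?_
    simp only [hw, List.getElem_reverse]
    congr 1
    omega

theorem apply_shift (j : ℤ) : ζ.apply (shift j y) = shift (wordPos ζ y j) (ζ.apply y) := by
  funext i
  obtain ⟨n, k, hk, rfl⟩ := exists_eq_wordPos_add ζ (shift j y) i
  rw [apply_wordPos_add ζ (shift j y) n hk, wordPos_shift]
  have hk' : k < (ζ.word (y (n + j))).length := hk
  have h := apply_wordPos_add ζ y (n + j) hk'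
  have e : wordPos ζ y (n + j) - wordPos ζ y j + k + wordPos ζ y j = wordPos ζ y (n + j) + k := by
    ring
  change _ = ζ.apply y (wordPos ζ y (n + j) - wordPos ζ y j + k + wordPos ζ y j)
  rw [e, h]
  rfl

theorem apply_natCast {k : ℕ} (hk : k < (ζ.word (y 0)).length) :
    ζ.apply y k = (ζ.word (y 0))[k] := by
  have h := apply_wordPos_add ζ y 0 hk
  rwa [wordPos_zero, zero_add] at h

variable {y} in
/-- A letter of `ζ(y)` depends only on finitely many letters of `y`. -/
theorem apply_congr {z : ℤ → A} (j : ℤ) (h : ∀ i : ℤ, |i| ≤ |j| + 1 → y i = z i) :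
    ζ.apply y j = ζ.apply z j := by
  cases j with
  | ofNat k =>
    have e : ((List.range (k + 1)).flatMap fun i : ℕ => ζ.word (y (i : ℤ))) =
        (List.range (k + 1)).flatMap fun i : ℕ => ζ.word (z (i : ℤ)) := by
      refine List.flatMap_congr fun i hi => ?_
      rw [List.mem_range] at hi
      rw [h i (by simp only [Int.ofNat_eq_natCast, Nat.abs_cast]; omega)]
    simp only [Substitution.apply, e]
  | negSucc k =>
    have e : ((List.range (k + 1)).flatMap fun i : ℕ => (ζ.word (y (Int.negSucc i))).reverse) =
        (List.range (k + 1)).flatMap fun i : ℕ => (ζ.word (z (Int.negSucc i))).reverse := by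
      refine List.flatMap_congr fun i hi => ?_
      rw [List.mem_range] at hi
      rw [h (Int.negSucc i) (by
        rw [abs_of_neg (Int.negSucc_lt_zero _), abs_of_neg (Int.negSucc_lt_zero _)]; omega)]
    simp only [Substitution.apply, e]

theorem exists_append_of_lt_length_flatMap {L : Type*} (β : A → List L) (W : List A) {p : ℕ}
    (hp : p < (W.flatMap β).length) :
    ∃ W₁ d W₂ k, W = W₁ ++ d :: W₂ ∧ k < (β d).length ∧ p = (W₁.flatMap β).length + k := by
  induction W generalizing p with
  | nil => simp at hp
  | cons c W ih =>
    rw [List.flatMap_cons, List.length_append] at hp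
    by_cases h : p < (β c).length
    · exact ⟨[], c, W, p, rfl, h, by simp⟩
    · obtain ⟨W₁, d, W₂, k, h1, h2, h3⟩ := ih (p := p - (β c).length) (by omega)
      refine ⟨c :: W₁, d, W₂, k, by rw [h1]; rfl, h2, ?_⟩
      rw [List.flatMap_cons, List.length_append]
      omega

/-- The two-sided sequence with the letters of the word `W` at the positions `0, …, |W| - 1` and
the letter `d` elsewhere. -/
def extendWord (W : List A) (d : A) (i : ℤ) : A := if 0 ≤ i then (W[i.toNat]?).getD d else d

theorem extendWord_natCast (W : List A) (d : A) {i : ℕ} (hi : i < W.length) :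
    extendWord W d i = W[i] := by
  simp [extendWord, hi]

theorem wordPos_extendWord (W₁ W₂ : List A) (d : A) :
    wordPos ζ (extendWord (W₁ ++ W₂) d) W₁.length = (W₁.flatMap ζ.word).length := by
  rw [wordPos_natCast]
  congr 2
  have h : W₁ = (List.range W₁.length).map fun i : ℕ => extendWord (W₁ ++ W₂) d (i : ℤ) := by
    refine List.ext_getElem (by simp) fun i h1 h2 => ?_
    rw [List.getElem_map, List.getElem_range, extendWord_natCast _ _ (by simp; omega),
      List.getElem_append_left h1]
  conv_rhs => rw [h]
  rw [List.flatMap_map]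

theorem apply_extendWord (W : List A) (d : A) {p : ℕ} (hp : p < (W.flatMap ζ.word).length) :
    ζ.apply (extendWord W d) p = (W.flatMap ζ.word)[p] := by
  obtain ⟨W₁, c, W₂, k, rfl, hk, rfl⟩ := exists_append_of_lt_length_flatMap ζ.word W hp
  have hc : extendWord (W₁ ++ c :: W₂) d W₁.length = c := by
    rw [extendWord_natCast _ _ (by simp)]
    simp
  have h := apply_wordPos_add ζ (extendWord (W₁ ++ c :: W₂) d) W₁.length (k := k)
    (by rw [hc]; exact hk)
  rw [wordPos_extendWord] at h
  push_cast
  rw [h]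
  simp only [hc, List.flatMap_append, List.flatMap_cons]
  rw [List.getElem_append_right (Nat.le_add_right _ _)]
  simp only [Nat.add_sub_cancel_left]
  rw [List.getElem_append_left hk]

end Apply

section Space

variable {A : Type*} {a : ℕ → Substitution A}

theorem shift_mem_space {x : ℤ → A} (hx : x ∈ space a) (k : ℤ) : shift k x ∈ space a := by
  intro i l
  obtain ⟨n, hn, b, h⟩ := hx (i + k) l
  refine ⟨n, hn, b, ?_⟩
  have e : (List.ofFn fun j : Fin l => shift k x (i + (j : ℕ))) =
      List.ofFn fun j : Fin l => x (i + k + (j : ℕ)) := by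
    congr 1
    funext j
    simp only [shift]
    congr 1
    ring
  rw [e]
  exact h

theorem length_flatMap_le {β : A → List A} {B : ℕ} (hB : ∀ c, (β c).length ≤ B) (W : List A) :
    (W.flatMap β).length ≤ W.length * B := by
  rw [List.length_flatMap]
  refine (List.sum_le_card_nsmul _ B fun n hn => ?_).trans (by simp)
  obtain ⟨c, -, rfl⟩ := List.mem_map.1 hn
  exact hB c

/-- Approximate desubstitution: a long central window of a point of `X_a` is covered by a
substituted sequence whose central letters form a word of the shifted sequence. -/
theorem exists_approx_desubstitution (hadm : ∀ n, (a n).IsAdmissible) (l : ℕ) {B : ℕ}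
    (hB : ∀ c, ((iter a l).word c).length ≤ B) {x : ℤ → A} (hx : x ∈ space a) (N : ℕ) :
    ∃ (y : ℤ → A) (k : ℕ), k < ((iter a l).word (y 0)).length ∧
      (∀ i : ℤ, |i| ≤ N → x i = (iter a l).apply y (i + k)) ∧
      ∀ M : ℕ, (M + 1) * B ≤ N → ∀ (i : ℤ) (r : ℕ), -(M : ℤ) ≤ i → i + r ≤ M →
        ∃ n ≥ 1, ∃ c, (List.ofFn fun j : Fin r => y (i + (j : ℕ))) <:+:
          (iter (fun j => a (l + j)) n).word c := by
  set ζ := iter a l with hζ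
  obtain ⟨n₀, -, c₀, hw₀⟩ := hx (-(N : ℤ)) (2 * N + 1)
  obtain ⟨n, hn, c, hw⟩ := exists_infix_block hadm (fun c => [c]) (n := n₀) (c := c₀)
    (w := List.ofFn fun j : Fin (2 * N + 1) => x (-(N : ℤ) + (j : ℕ)))
    (by simpa [block] using hw₀) (l + 1)
  obtain ⟨n', rfl⟩ := Nat.exists_eq_add_of_le hn
  set W := (iter (fun j => a (l + j)) (1 + n')).word c with hW
  have hblock : block a (fun c => [c]) (l + 1 + n') c = W.flatMap ζ.word := by
    have hid : block a (fun c => [c]) l = (iter a l).word := by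
      funext d
      simp [block]
    rw [add_assoc, flatMap_block, hid]
  rw [hblock] at hw
  obtain ⟨u, v, huv⟩ := hw
  have hlen := congrArg List.length huv
  simp only [List.length_append, List.length_ofFn] at hlen
  have hflat : ∀ i : ℤ, |i| ≤ N → ∃ h : (u.length + N + i).toNat < (W.flatMap ζ.word).length,
      (W.flatMap ζ.word)[(u.length + N + i).toNat] = x i := by
    intro i hi
    rw [abs_le] at hi
    have h1 : (u.length + N + i).toNat < (W.flatMap ζ.word).length := by omega
    refine ⟨h1, ?_⟩
    simp only [← huv]
    rw [List.getElem_append_left (by simp; omega), List.getElem_append_right (by omega),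
      List.getElem_ofFn]
    congr 1
    simp only
    omega
  obtain ⟨W₁, d, W₂, k, hWd, hk, hp⟩ := exists_append_of_lt_length_flatMap ζ.word W
    (p := u.length + N) (by omega)
  have hd : shift W₁.length (extendWord W d) 0 = d := by
    rw [shift, zero_add, extendWord_natCast _ _ (by simp [hWd])]
    simp [hWd]
  refine ⟨shift W₁.length (extendWord W d), k, by rw [hd]; exact hk, fun i hi => ?_,
    fun M hM i r hi hr => ?_⟩
  · have hpos : wordPos ζ (extendWord W d) W₁.length = (W₁.flatMap ζ.word).length := by
      rw [hWd]
      exact wordPos_extendWord ζ W₁ (d :: W₂) d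
    rw [apply_shift, hpos, shift]
    obtain ⟨h1, h2⟩ := hflat i hi
    have h3 := apply_extendWord ζ W d h1
    rw [abs_le] at hi
    have e : ((u.length + N + i).toNat : ℤ) = i + k + (W₁.flatMap ζ.word).length := by omega
    rw [e] at h3
    rw [h3, h2]
  · refine ⟨1 + n', by omega, c, ?_⟩
    have h1 := length_flatMap_le hB W₁
    have h2 := length_flatMap_le hB W₂
    have h3 : (W.flatMap ζ.word).length =
        (W₁.flatMap ζ.word).length + ((ζ.word d).length + (W₂.flatMap ζ.word).length) := by
      rw [hWd, List.flatMap_append, List.flatMap_cons, List.length_append, List.length_append]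
    have h4 := hB d
    have h5 : M ≤ W₁.length := by
      by_contra hlt
      have h6 : (W₁.length + 1) * B ≤ M * B := Nat.mul_le_mul_right _ (by omega)
      have h7 : M * B ≤ (M + 1) * B := Nat.mul_le_mul_right _ (by omega)
      rw [add_mul] at h6
      omega
    have h8 : M ≤ W₂.length := by
      by_contra hlt
      have h6 : (W₂.length + 1) * B ≤ M * B := Nat.mul_le_mul_right _ (by omega)
      have h7 : M * B ≤ (M + 1) * B := Nat.mul_le_mul_right _ (by omega)
      rw [add_mul] at h6
      omega
    have hWlen : W.length = W₁.length + (1 + W₂.length) := by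
      rw [hWd]; simp; omega
    have e : (List.ofFn fun j : Fin r => shift W₁.length (extendWord W d) (i + (j : ℕ))) =
        (W.drop (W₁.length + i).toNat).take r := by
      refine List.ext_getElem ?_ fun q hq1 hq2 => ?_
      · simp; omega
      · simp only [List.length_ofFn] at hq1
        rw [List.getElem_ofFn, List.getElem_take, List.getElem_drop, shift]
        have e1 : i + (q : ℤ) + W₁.length = (((W₁.length + i).toNat + q : ℕ) : ℤ) := by
          push_cast; omega
        simp only
        rw [e1, extendWord_natCast _ _ (by omega)]
    rw [e]
    exact (List.take_prefix _ _).isInfix.trans (List.drop_suffix _ _).isInfix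

/-- Every point of `X_a` has a representation `T^k(ζ^{[l]}(y))` with `y ∈ X_{σ^l a}`: a limit of
approximate desubstitutions along an ultrafilter. -/
theorem exists_desubstitution [Finite A] (hadm : ∀ n, (a n).IsAdmissible) (l : ℕ) {x : ℤ → A}
    (hx : x ∈ space a) :
    ∃ y ∈ space (fun j => a (l + j)), ∃ k : ℕ, k < ((iter a l).word (y 0)).length ∧
      x = shift k ((iter a l).apply y) := by
  obtain ⟨B, hB⟩ : ∃ B : ℕ, ∀ c, ((iter a l).word c).length ≤ B := by
    obtain ⟨B, hB⟩ := (Set.finite_range fun c => ((iter a l).word c).length).bddAbove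
    exact ⟨B, fun c => hB ⟨c, rfl⟩⟩
  choose z k hk hz hspace using exists_approx_desubstitution hadm l hB hx
  have hkB : ∀ N, k N < B := fun N => (hk N).trans_le (hB _)
  set U := hyperfilter ℕ with hU
  have hge : ∀ n : ℕ, ∀ᶠ N in (U : Filter ℕ), n ≤ N := fun n =>
    Nat.hyperfilter_le_atTop (eventually_ge_atTop n)
  have hlim : ∀ i : ℤ, ∃ c, ∀ᶠ N in (U : Filter ℕ), z N i = c := by
    intro i
    obtain ⟨c, hc⟩ := (U.map fun N => z N i).eq_pure_of_finite
    refine ⟨c, ?_⟩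
    have h1 : {c} ∈ U.map fun N => z N i := by rw [hc]; exact Ultrafilter.mem_pure.2 rfl
    exact h1
  choose y hy using hlim
  obtain ⟨κ, hκ⟩ : ∃ κ : ℕ, ∀ᶠ N in (U : Filter ℕ), k N = κ := by
    obtain ⟨c, hc⟩ := (U.map fun N => (⟨k N, hkB N⟩ : Fin B)).eq_pure_of_finite
    refine ⟨c, ?_⟩
    have h1 : {c} ∈ U.map fun N => (⟨k N, hkB N⟩ : Fin B) := by
      rw [hc]; exact Ultrafilter.mem_pure.2 rfl
    have h2 : ∀ᶠ N in (U : Filter ℕ), (⟨k N, hkB N⟩ : Fin B) = c := h1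
    filter_upwards [h2] with N hN
    exact congrArg Fin.val hN
  have hagree : ∀ J : ℤ, ∀ᶠ N in (U : Filter ℕ), ∀ i : ℤ, |i| ≤ J → z N i = y i := by
    intro J
    have h1 : ∀ᶠ N in (U : Filter ℕ), ∀ i ∈ Finset.Icc (-J) J, z N i = y i :=
      (Filter.eventually_all_finset _).2 fun i _ => hy i
    filter_upwards [h1] with N hN i hi
    exact hN i (Finset.mem_Icc.2 (abs_le.1 hi))
  refine ⟨y, fun i r => ?_, κ, ?_, ?_⟩
  · set M : ℕ := i.natAbs + r with hM
    obtain ⟨N, hN1, hN2⟩ := ((hge ((M + 1) * B)).and (hagree M)).exists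
    obtain ⟨n, hn, c, h⟩ := hspace N M hN1 i r (by omega) (by omega)
    refine ⟨n, hn, c, ?_⟩
    have e : (List.ofFn fun j : Fin r => y (i + (j : ℕ))) =
        List.ofFn fun j : Fin r => z N (i + (j : ℕ)) := by
      congr 1
      funext j
      refine (hN2 _ ?_).symm
      rw [abs_le]
      have := j.2
      omega
    rw [e]
    exact h
  · obtain ⟨N, hN1, hN2⟩ := (hκ.and (hy 0)).exists
    rw [← hN1, ← hN2]
    exact hk N
  · funext i
    obtain ⟨N, hN1, hN2, hN3⟩ :=
      ((hge i.natAbs).and (hκ.and (hagree (|i + κ| + 1)))).exists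
    rw [hz N i (by rw [Int.abs_eq_natAbs]; exact_mod_cast hN1), hN2, shift]
    exact apply_congr _ _ fun j hj => hN3 j hj

end Space

/-! ### Labelling the points of the space by their position at a given level -/

section Label

variable {A : Type*} {a : ℕ → Substitution A} {l : ℕ}

/-- The label of level `l` of `x = T^k (ζ^{[l]}(y))`, where `y ∈ X_{σ^l a}` and
`0 ≤ k < |ζ^{[l]}(y₀)|`: the pair `(y₀, k)`. Outside of `X_a` the value `(x₀, 0)` is arbitrary. -/
def label (a : ℕ → Substitution A) (l : ℕ) (x : ℤ → A) : A × ℕ := by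
  classical
  exact if h : x ∈ space a ∧ ∃ p : (ℤ → A) × ℕ, p.1 ∈ space (fun j => a (l + j)) ∧
      p.2 < ((iter a l).word (p.1 0)).length ∧ x = shift p.2 ((iter a l).apply p.1) then
    (h.2.choose.1 0, h.2.choose.2) else (x 0, 0)

theorem label_eq (hrec : IsRecognizable a) (hl : 1 ≤ l) {y : ℤ → A}
    (hy : y ∈ space fun j => a (l + j)) {k : ℕ} (hk : k < ((iter a l).word (y 0)).length)
    {x : ℤ → A} (hx : x ∈ space a) (hxy : x = shift k ((iter a l).apply y)) :
    label a l x = (y 0, k) := by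
  have h : x ∈ space a ∧ ∃ p : (ℤ → A) × ℕ, p.1 ∈ space (fun j => a (l + j)) ∧
      p.2 < ((iter a l).word (p.1 0)).length ∧ x = shift p.2 ((iter a l).apply p.1) :=
    ⟨hx, (y, k), hy, hk, hxy⟩
  rw [label, dif_pos h]
  obtain ⟨h1, h2, h3⟩ := h.2.choose_spec
  obtain ⟨h4, h5⟩ := hrec l hl x hx _ h1 y hy _ _ h2 hk h3 hxy
  rw [h4, h5]

theorem label_of_notMem {x : ℤ → A} (hx : x ∉ space a) : label a l x = (x 0, 0) := by
  rw [label, dif_neg fun h => hx h.1]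

/-- The labels of level `l` along the word `ζ^{[l]}(c)`. -/
def labelBlock (a : ℕ → Substitution A) (l : ℕ) (c : A) : List (A × ℕ) :=
  (List.range ((iter a l).word c).length).map fun k => (c, k)

theorem labelBlock_ne_nil (a : ℕ → Substitution A) (l : ℕ) (c : A) : labelBlock a l c ≠ [] := by
  simp [labelBlock, (iter a l).word_ne_nil c]

/-- The value of the roof function at the points with a given label. -/
def labelRoof (a : ℕ → Substitution A) (l : ℕ) (s : A → ℝ) (d : A × ℕ) : ℝ :=
  s ((((iter a l).word d.1)[d.2]?).getD d.1)

theorem sum_labelRoof (a : ℕ → Substitution A) (l : ℕ) (s : A → ℝ) (c : A) :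
    ((labelBlock a l c).map (labelRoof a l s)).sum = (((iter a l).word c).map s).sum := by
  congr 1
  refine List.ext_getElem (by simp [labelBlock]) fun i h1 h2 => ?_
  have h3 : i < ((iter a l).word c).length := by simpa using h2
  simp [labelBlock, labelRoof, h3]

theorem labelWord_add {L : Type*} (lab : (ℤ → A) → L) (x : ℤ → A) (p q : ℕ) :
    labelWord lab x (p + q) = labelWord lab x p ++ labelWord lab (shift (p : ℤ) x) q := by
  simp only [labelWord, List.range_add, List.map_append, List.map_map]
  congr 1
  refine List.map_congr_left fun j _ => ?_
  simp only [Function.comp_apply, shift_shift]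
  congr 2
  push_cast
  ring

/-- The labels along `ζ^{[l]}(y)` are read off from `y` by replacing each letter by its block. -/
theorem labelWord_apply (hrec : IsRecognizable a) (hl : 1 ≤ l) {y : ℤ → A}
    (hy : y ∈ space fun j => a (l + j)) (hx : (iter a l).apply y ∈ space a) (J : ℕ) :
    labelWord (label a l) ((iter a l).apply y) (wordPos (iter a l) y J).toNat =
      ((List.range J).map fun j : ℕ => y (j : ℤ)).flatMap (labelBlock a l) := by
  induction J with
  | zero => simp [wordPos_zero, labelWord]
  | succ J ih =>
    have h0 : 0 ≤ wordPos (iter a l) y J := by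
      rw [wordPos_natCast]; positivity
    have h1 : (wordPos (iter a l) y ((J + 1 : ℕ) : ℤ)).toNat =
        (wordPos (iter a l) y J).toNat + ((iter a l).word (y J)).length := by
      push_cast
      rw [wordPos_add_one]
      omega
    rw [h1, labelWord_add, ih, List.range_succ, List.map_append, List.flatMap_append]
    congr 1
    rw [Int.toNat_of_nonneg h0, ← apply_shift]
    simp only [List.map_cons, List.map_nil, List.flatMap_cons, List.flatMap_nil, List.append_nil,
      labelWord, labelBlock]
    refine List.map_congr_left fun k hk => ?_
    rw [List.mem_range] at hk
    have hk' : k < ((iter a l).word (shift (J : ℤ) y 0)).length := by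
      simpa [shift] using hk
    refine (label_eq hrec hl (shift_mem_space hy J) hk' ?_ rfl).trans ?_
    · rw [apply_shift]
      exact shift_mem_space (shift_mem_space hx _) _
    · simp [shift]

/-- The labels of level `l` are adapted to the sequence `σ^l a`. -/
theorem isAdapted_label [Finite A] (hadm : ∀ n, (a n).IsAdmissible) (hrec : IsRecognizable a)
    (hl : 1 ≤ l) (s : A → ℝ) {x : ℤ → A} (hx : x ∈ space a) :
    IsAdapted (fun j => a (l + j)) (labelBlock a l) s (labelRoof a l s) (label a l) x := by
  constructor
  · intro N K
    obtain ⟨y, hy, k, hk, hxy⟩ := exists_desubstitution hadm l hx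
    have hζ : (iter a l).apply y ∈ space a := by
      have h1 := shift_mem_space hx (-(k : ℤ))
      rw [hxy, shift_shift] at h1
      simpa [shift_zero] using h1
    obtain ⟨n, -, c, h⟩ := hy 0 (k + N)
    refine exists_infix_block (fun n => hadm (l + n)) _ (n := n) (c := c) ?_ K
    have h1 : (List.ofFn fun j : Fin (k + N) => y (0 + (j : ℕ))) =
        (List.range (k + N)).map fun j : ℕ => y (j : ℤ) := by
      refine List.ext_getElem (by simp) fun i h1 h2 => by simp
    rw [h1] at h
    obtain ⟨u, v, huv⟩ := h
    have h2 : (List.flatMap (labelBlock a l) ((List.range (k + N)).map fun j : ℕ => y (j : ℤ))) <:+: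
        block (fun j => a (l + j)) (labelBlock a l) n c := by
      rw [block, ← huv, List.flatMap_append, List.flatMap_append]
      exact ⟨_, _, rfl⟩
    refine List.IsInfix.trans ?_ h2
    rw [← labelWord_apply hrec hl hy hζ]
    have h3 : k + N ≤ (wordPos (iter a l) y ((k + N : ℕ) : ℤ)).toNat := by
      rw [wordPos_natCast, Int.toNat_natCast]
      exact le_length_flatMap_range (fun i => (iter a l).word_ne_nil _) _
    obtain ⟨r, hr⟩ := Nat.exists_eq_add_of_le h3
    rw [hr, add_assoc, labelWord_add, labelWord_add, ← hxy]
    exact ⟨_, _, List.append_assoc _ _ _⟩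
  · intro n
    have hn := shift_mem_space hx (n : ℤ)
    obtain ⟨y, hy, k, hk, hxy⟩ := exists_desubstitution hadm l hn
    rw [label_eq hrec hl hy hk hn hxy, labelRoof]
    have h1 : x n = ((iter a l).word (y 0))[k] := by
      rw [← apply_natCast _ _ hk]
      have h2 := congrFun hxy 0
      simpa [shift] using h2
    simp [hk, h1]

/-- The bi-infinite sequence `⋯ c c . w c c ⋯` with `w = ζ^{[l]}(c)`, shifted by `k`; near its
centre it agrees with the sequences labelled `(c, k)`. -/
def labelSeq (a : ℕ → Substitution A) (l : ℕ) (d : A × ℕ) : ℤ → A :=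
  shift d.2 (extendWord ((iter a l).word d.1) d.1)

/-- The points of `X_a` at which a word of level `l` begins. -/
def cutSet (a : ℕ → Substitution A) (l : ℕ) : Set (ℤ → A) := {x | x ∈ space a ∧ (label a l x).2 = 0}

variable [Finite A] (hadm : ∀ n, (a n).IsAdmissible) (hrec : IsRecognizable a) (hl : 1 ≤ l)
include hadm hrec hl

/-- A point with no cut at distance at most `N` from the origin lies deep inside one word of level
`l`, and is determined by its label on the window `[-N, N]`. -/
theorem labelSeq_label_eq {x : ℤ → A} (hx : x ∈ space a) {N : ℕ}
    (hN : ∀ i : ℤ, |i| ≤ N → shift i x ∉ cutSet a l) {i : ℤ} (hi : |i| ≤ N) :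
    labelSeq a l (label a l x) i = x i := by
  obtain ⟨y, hy, k, hk, hxy⟩ := exists_desubstitution hadm l hx
  rw [label_eq hrec hl hy hk hx hxy]
  have hζ : shift (-(k : ℤ)) x = (iter a l).apply y := by
    rw [hxy, shift_shift]
    simp [shift_zero]
  have hk1 : N < k := by
    by_contra! h
    refine hN (-(k : ℤ)) (by rw [abs_neg, Nat.abs_cast]; exact_mod_cast h)
      ⟨shift_mem_space hx _, ?_⟩
    rw [label_eq hrec hl (k := 0) hy (by omega) (shift_mem_space hx _)
      (by rw [hζ, Nat.cast_zero, shift_zero])]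
  have hk2 : k + N < ((iter a l).word (y 0)).length := by
    by_contra! h
    set q := ((iter a l).word (y 0)).length with hq
    refine hN ((q - k : ℕ) : ℤ) (by rw [Nat.abs_cast]; exact_mod_cast (by omega))
      ⟨shift_mem_space hx _, ?_⟩
    rw [label_eq hrec hl (k := 0) (y := shift 1 y) (shift_mem_space hy _)
      (List.length_pos_iff.2 ((iter a l).word_ne_nil _)) (shift_mem_space hx _) ?_]
    rw [apply_shift, Nat.cast_zero, shift_zero, hxy, shift_shift]
    congr 1
    have h1 := wordPos_add_one (iter a l) y 0
    rw [zero_add, wordPos_zero] at h1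
    omega
  rw [abs_le] at hi
  have h1 : (i + k).toNat < ((iter a l).word (y 0)).length := by omega
  have h2 : i + k = ((i + k).toNat : ℤ) := by omega
  simp only [labelSeq, hxy, shift]
  rw [h2, extendWord_natCast _ _ h1, apply_natCast _ _ h1]

/-- Words of level `l` begin at distances of at least the least length of such words. -/
theorem shift_cutSet_disjoint {x : ℤ → A} {m i j : ℕ}
    (hm : ∀ c, m ≤ ((iter a l).word c).length) (hi : i < m) (hj : j < m)
    (hxi : shift (-(i : ℤ)) x ∈ cutSet a l) (hxj : shift (-(j : ℤ)) x ∈ cutSet a l) : i = j := by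
  have key : ∀ i : ℕ, i < m → shift (-(i : ℤ)) x ∈ cutSet a l → (label a l x).2 = i := by
    intro i hi h
    obtain ⟨y, hy, k, hk, hxy⟩ := exists_desubstitution hadm l h.1
    have h1 := h.2
    rw [label_eq hrec hl hy hk h.1 hxy] at h1
    have h1 : k = 0 := h1
    subst h1
    have h2 : x = shift (i : ℤ) (shift (-(i : ℤ)) x) := by
      rw [shift_shift]; simp [shift_zero]
    rw [Nat.cast_zero, shift_zero] at hxy
    rw [hxy] at h2
    have hx : x ∈ space a := by
      have := shift_mem_space h.1 (i : ℤ)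
      rwa [hxy, ← h2] at this
    rw [label_eq hrec hl hy (hi.trans_le (hm _)) hx h2]
  rw [← key i hi hxi, key j hj hxj]

end Label

section Topology

variable {A : Type*} [TopologicalSpace A] [DiscreteTopology A] {a : ℕ → Substitution A}

theorem isClosed_space (a : ℕ → Substitution A) : IsClosed (space a) := by
  have h : space a = ⋂ (i : ℤ) (l : ℕ), (fun (x : ℤ → A) (j : Fin l) => x (i + (j : ℕ))) ⁻¹'
      {w | ∃ n ≥ 1, ∃ b, List.ofFn w <:+: (iter a n).word b} := by
    ext x
    simp [space]
  rw [h]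
  refine isClosed_iInter fun i => isClosed_iInter fun l => ?_
  exact (isClosed_discrete _).preimage (continuous_pi fun j => continuous_apply _)

omit [DiscreteTopology A] in
theorem continuous_shift (k : ℤ) : Continuous (shift k : (ℤ → A) → ℤ → A) :=
  continuous_pi fun n => continuous_apply (n + k)

theorem continuous_apply_substitution (ζ : Substitution A) : Continuous ζ.apply := by
  refine continuous_pi fun j => continuous_iff_continuousAt.2 fun y => ?_
  have h : ∀ᶠ z in 𝓝 y, ∀ i ∈ Finset.Icc (-(|j| + 1)) (|j| + 1), y i = z i := by
    refine (eventually_all_finset _).2 fun i _ => ?_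
    have h1 : IsOpen ((fun z : ℤ → A => z i) ⁻¹' {y i}) :=
      (isOpen_discrete _).preimage (continuous_apply i)
    filter_upwards [h1.mem_nhds rfl] with z hz
    exact hz.symm
  refine tendsto_const_nhds.congr' ?_
  filter_upwards [h] with z hz
  exact apply_congr ζ j fun i hi => hz i (Finset.mem_Icc.2 (abs_le.1 hi))

variable [Finite A] [MeasurableSpace A] [DiscreteMeasurableSpace A]

omit [Finite A] in
theorem borelSpace_of_discrete : BorelSpace A where
  measurable_eq := by
    rw [borel_eq_top_of_discrete]
    exact MeasurableSpace.ext fun s => ⟨fun _ => trivial, fun _ => .of_discrete⟩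

theorem measurableSet_of_isClosed {C : Set (ℤ → A)} (hC : IsClosed C) : MeasurableSet C :=
  have : BorelSpace A := borelSpace_of_discrete
  hC.measurableSet

/-- The points of `X_a` with a given label form a compact set, the image of a closed set of
sequences under the substitution and a shift. -/
theorem measurable_label (hadm : ∀ n, (a n).IsAdmissible) (hrec : IsRecognizable a) {l : ℕ}
    (hl : 1 ≤ l) : Measurable (label a l) := by
  have hspace : MeasurableSet (space a) := measurableSet_of_isClosed (isClosed_space a)
  refine measurable_to_countable' fun d => ?_
  set C : Set (ℤ → A) := (fun y => shift d.2 ((iter a l).apply y)) ''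
    {y | y ∈ space (fun j => a (l + j)) ∧ y 0 = d.1} with hCdef
  have hC : MeasurableSet C := by
    refine measurableSet_of_isClosed (IsCompact.isClosed (IsCompact.image ?_
      ((continuous_shift _).comp (continuous_apply_substitution _))))
    have h1 : IsClosed {y : ℤ → A | y 0 = d.1} :=
      (isClosed_discrete {d.1}).preimage (continuous_apply (A := fun _ : ℤ => A) 0)
    exact ((isClosed_space _).inter h1).isCompact
  have h2 : label a l ⁻¹' {d} =
      (space a ∩ (C ∩ {_x | d.2 < ((iter a l).word d.1).length})) ∪
        ((space a)ᶜ ∩ {x | x 0 = d.1 ∧ d.2 = 0}) := by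
    ext x
    simp only [Set.mem_preimage, Set.mem_singleton_iff, Set.mem_union, Set.mem_inter_iff,
      Set.mem_ofPred_eq, Set.mem_compl_iff]
    by_cases hx : x ∈ space a
    · simp only [hx, true_and, not_true_eq_false, false_and, or_false]
      constructor
      · intro h
        obtain ⟨y, hy, k, hk, hxy⟩ := exists_desubstitution hadm l hx
        rw [label_eq hrec hl hy hk hx hxy] at h
        subst h
        exact ⟨⟨y, ⟨hy, rfl⟩, hxy.symm⟩, hk⟩
      · rintro ⟨⟨y, ⟨hy, hy0⟩, hxy⟩, hk⟩
        rw [← hy0] at hk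
        rw [label_eq hrec hl hy hk hx hxy.symm, hy0]
    · simp only [hx, false_and, not_false_eq_true, true_and, false_or]
      rw [label_of_notMem hx, Prod.ext_iff]
      simp [eq_comm]
  rw [h2]
  refine (hspace.inter (hC.inter (MeasurableSet.const _))).union (hspace.compl.inter ?_)
  refine MeasurableSet.inter ?_ (MeasurableSet.const _)
  exact measurable_pi_apply (X := fun _ : ℤ => A) 0 (MeasurableSet.of_discrete (s := {d.1}))

theorem measurableSet_cutSet (hadm : ∀ n, (a n).IsAdmissible) (hrec : IsRecognizable a) {l : ℕ}
    (hl : 1 ≤ l) : MeasurableSet (cutSet a l) :=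
  (measurableSet_of_isClosed (isClosed_space a)).inter
    (measurable_snd.comp (measurable_label hadm hrec hl) (measurableSet_singleton 0))

end Topology

/-! ### Labelled functions are dense -/

section Density

variable {A : Type*} [MeasurableSpace A]

theorem measure_preimage_shift {μ : Measure (ℤ → A)} (hinv : MeasurePreserving (shift 1) μ μ)
    (k : ℤ) {C : Set (ℤ → A)} (hC : MeasurableSet C) : μ (shift k ⁻¹' C) = μ C := by
  have key : ∀ n : ℕ, MeasurePreserving (shift (n : ℤ)) μ μ := by
    intro n
    induction n with
    | zero =>
      have h : (shift ((0 : ℕ) : ℤ) : (ℤ → A) → ℤ → A) = id := by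
        funext x; simp [shift_zero]
      rw [h]
      exact MeasurePreserving.id μ
    | succ n ih =>
      have h : (shift ((n + 1 : ℕ) : ℤ) : (ℤ → A) → ℤ → A) = shift 1 ∘ shift (n : ℤ) := by
        funext x
        simp only [Function.comp_apply, shift_shift]
        congr 1
        push_cast
        ring
      rw [h]
      exact hinv.comp ih
  rcases Int.eq_nat_or_neg k with ⟨n, rfl | rfl⟩
  · exact (key n).measure_preimage hC.nullMeasurableSet
  · rw [← (key n).measure_preimage ((measurable_shift _) hC).nullMeasurableSet]
    congr 1
    ext x
    simp [shift_shift, shift_zero]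

theorem integral_normSq_le_of_eLpNorm_le {Y : Type*} [MeasurableSpace Y] {ν : Measure Y}
    {h : Y → ℂ} (hh : MemLp h 2 ν) {ε : ℝ} (hε : 0 ≤ ε) (hle : eLpNorm h 2 ν ≤ ENNReal.ofReal ε) :
    ∫ y, ‖h y‖ ^ 2 ∂ν ≤ ε ^ 2 := by
  rw [hh.eLpNorm_eq_integral_rpow_norm (by norm_num) (by norm_num),
    ENNReal.ofReal_le_ofReal_iff hε] at hle
  simp only [ENNReal.toReal_ofNat, Real.rpow_ofNat] at hle
  have h0 : 0 ≤ ∫ y, ‖h y‖ ^ 2 ∂ν := integral_nonneg fun y => sq_nonneg _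
  have h1 := pow_le_pow_left₀ (Real.rpow_nonneg h0 _) hle 2
  rwa [← Real.rpow_natCast, ← Real.rpow_mul h0, Nat.cast_ofNat, inv_mul_cancel₀ two_ne_zero,
    Real.rpow_one] at h1

variable [TopologicalSpace A] [DiscreteTopology A] [Fintype A] [DiscreteMeasurableSpace A]
  {a : ℕ → Substitution A}

/-- The set of cuts has measure at most the reciprocal of the least length of the words of level
`l`: its translates by fewer steps are disjoint. -/
theorem measure_cutSet_le (hadm : ∀ n, (a n).IsAdmissible) (hrec : IsRecognizable a)
    {μ : Measure (ℤ → A)} (hμ : IsInvariantProbability a μ) {l m : ℕ} (hl : 1 ≤ l)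
    (hm : ∀ c, m ≤ ((iter a l).word c).length) : m * μ (cutSet a l) ≤ 1 := by
  have := hμ.prob
  have hC := measurableSet_cutSet hadm hrec hl
  have h1 : μ (⋃ i ∈ Finset.range m, shift (-(i : ℤ)) ⁻¹' cutSet a l) =
      ∑ i ∈ Finset.range m, μ (shift (-(i : ℤ)) ⁻¹' cutSet a l) := by
    refine measure_biUnion_finset (fun i hi j hj hij => ?_) fun i _ => measurable_shift _ hC
    refine Set.disjoint_left.2 fun x hxi hxj => hij ?_
    exact shift_cutSet_disjoint hadm hrec hl hm (by simpa using hi) (by simpa using hj) hxi hxj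
  simp only [measure_preimage_shift hμ.invariant _ hC, Finset.sum_const, Finset.card_range,
    nsmul_eq_mul] at h1
  rw [← h1]
  exact prob_le_one

/-- Along a suitable sequence of levels, at almost every point the words of these levels around
the origin exhaust the sequence. -/
theorem exists_tendsto_labelSeq [Nonempty A] (hadm : ∀ n, (a n).IsAdmissible)
    (hrec : IsRecognizable a) {lam : ℝ} (ha : HasGrowth a lam)
    {μ : Measure (ℤ → A)} (hμ : IsInvariantProbability a μ) :
    ∃ l : ℕ → ℕ, (∀ N, 1 ≤ l N) ∧
      ∀ᵐ x ∂μ, Tendsto (fun N => labelSeq a (l N) (label a (l N) x)) atTop (𝓝 x) := by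
  have hex : ∀ N : ℕ, ∃ l, 1 ≤ l ∧ ((2 * N + 1) * 2 ^ N : ℝ) ≤ minLength a l := fun N =>
    ((eventually_ge_atTop 1).and (ha.tendsto_minLength.eventually_ge_atTop _)).exists
  -- With this choice the cuts at distance at most `N` from the origin have summable measure.
  choose l hl hlN using hex
  refine ⟨l, hl, ?_⟩
  set bad : ℕ → Set (ℤ → A) := fun N =>
    ⋃ i ∈ Finset.Icc (-(N : ℤ)) N, shift i ⁻¹' cutSet a (l N) with hbad
  have hcut : ∀ N, μ (bad N) ≤ (1 / 2) ^ N := by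
    intro N
    have h1 : μ (bad N) ≤ (2 * N + 1 : ℕ) * μ (cutSet a (l N)) := by
      refine (measure_biUnion_finset_le _ _).trans ?_
      simp only [measure_preimage_shift hμ.invariant _ (measurableSet_cutSet hadm hrec (hl N)),
        Finset.sum_const, nsmul_eq_mul, Int.card_Icc]
      have h2 : ((N : ℤ) + 1 - -(N : ℤ)).toNat = 2 * N + 1 := by omega
      rw [h2]
    have h2 : (2 * N + 1) * 2 ^ N ≤ minLength a (l N) := by exact_mod_cast hlN N
    have h3 := measure_cutSet_le hadm hrec hμ (hl N) (m := (2 * N + 1) * 2 ^ N)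
      fun c => h2.trans (minLength_le a _ c)
    have h4 : (2 : ENNReal) ^ N * μ (bad N) ≤ 1 := by
      refine le_trans ?_ h3
      push_cast at h1 ⊢
      calc (2 : ENNReal) ^ N * μ (bad N) ≤ 2 ^ N * ((2 * N + 1) * μ (cutSet a (l N))) := by gcongr
        _ = _ := by ring
    rw [one_div, ENNReal.inv_pow.symm]
    exact ENNReal.le_inv_iff_mul_le.2 (by rwa [mul_comm])
  have hsum : ∑' N, μ (bad N) ≠ ⊤ := by
    refine ne_top_of_le_ne_top ?_ (ENNReal.tsum_le_tsum hcut)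
    rw [one_div, ENNReal.tsum_geometric]
    simp
  filter_upwards [ae_eventually_notMem hsum, hμ.ae_mem] with x hx hxa
  refine tendsto_pi_nhds.2 fun i => ?_
  refine tendsto_const_nhds.congr' ?_
  filter_upwards [hx, eventually_ge_atTop i.natAbs] with N hN hiN
  refine (labelSeq_label_eq hadm hrec (hl N) hxa (N := N) (fun j hj hmem => hN ?_) ?_).symm
  · simp only [hbad, Set.mem_iUnion]
    exact ⟨j, Finset.mem_Icc.2 (abs_le.1 hj), hmem⟩
  · rw [Int.abs_eq_natAbs]
    exact_mod_cast hiN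

/-- The bounded functions of the height and of a label of some level are dense in `L²`: composing a
bounded continuous function with `labelSeq` changes it little at most points. -/
theorem exists_labelled_approx [Nonempty A] (hadm : ∀ n, (a n).IsAdmissible)
    (hrec : IsRecognizable a) {lam : ℝ} (ha : HasGrowth a lam)
    {μ : Measure (ℤ → A)} (hμ : IsInvariantProbability a μ) {s : A → ℝ}
    {f : (ℤ → A) × ℝ → ℂ} (hf : MemLp f 2 (suspensionMeasure s μ)) {ε : ℝ} (hε : 0 < ε) :
    ∃ l ≥ 1, ∃ (ψ : A × ℕ → ℝ → ℂ) (M : ℝ), (∀ d t, ‖ψ d t‖ ≤ M) ∧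
      Measurable (fun p : (ℤ → A) × ℝ => ψ (label a l p.1) p.2) ∧
      ∫ p, ‖f p - ψ (label a l p.1) p.2‖ ^ 2 ∂(suspensionMeasure s μ) ≤ ε := by
  have := hμ.prob
  have := isFiniteMeasure_suspensionMeasure (s := s) μ
  have hA : BorelSpace A := borelSpace_of_discrete
  set ν := suspensionMeasure s μ with hν
  set ε' : ℝ := Real.sqrt (ε / 4) with hε'
  have hε'0 : 0 < ε' := Real.sqrt_pos.2 (by positivity)
  have hε'2 : ε' ^ 2 = ε / 4 := Real.sq_sqrt (by positivity)
  obtain ⟨g, hg1, hg2⟩ := hf.exists_boundedContinuous_eLpNorm_sub_le (by norm_num)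
    (ENNReal.ofReal_pos.2 hε'0).ne'
  have hfg := integral_normSq_le_of_eLpNorm_le (hf.sub hg2) hε'0.le hg1
  rw [hε'2] at hfg
  obtain ⟨l, hl, hlim⟩ := exists_tendsto_labelSeq hadm hrec ha hμ
  have hmeas : ∀ N, Measurable fun p : (ℤ → A) × ℝ =>
      g (labelSeq a (l N) (label a (l N) p.1), p.2) := by
    intro N
    have h1 : Measurable (labelSeq a (l N)) := Measurable.of_discrete
    have h2 : Measurable fun p : (ℤ → A) × ℝ => (labelSeq a (l N) (label a (l N) p.1), p.2) :=
      ((h1.comp (measurable_label hadm hrec (hl N))).comp measurable_fst).prodMk measurable_snd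
    exact g.continuous.measurable.comp h2
  have hDCT : Tendsto (fun N => ∫ p, ‖g p - g (labelSeq a (l N) (label a (l N) p.1), p.2)‖ ^ 2 ∂ν)
      atTop (𝓝 (∫ _p, (0 : ℝ) ∂ν)) := by
    refine tendsto_integral_of_dominated_convergence (fun _ => (‖g‖ + ‖g‖) ^ 2) (fun N => ?_)
      (integrable_const _) (fun N => ae_of_all _ fun p => ?_) ?_
    · exact ((g.continuous.measurable.sub (hmeas N)).norm.pow_const 2).aestronglyMeasurable
    · rw [Real.norm_of_nonneg (sq_nonneg _)]
      have := (norm_sub_le (g p) (g (labelSeq a (l N) (label a (l N) p.1), p.2))).trans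
        (add_le_add (g.norm_coe_le_norm _) (g.norm_coe_le_norm _))
      gcongr
    · filter_upwards [ae_suspensionMeasure (s := s) μ hlim] with p hp
      have h1 := (hp.1.prodMk_nhds (tendsto_const_nhds (x := p.2)))
      have h2 := (g.continuous.tendsto (p.1, p.2)).comp h1
      have h3 := ((tendsto_const_nhds (x := g p)).sub h2).norm.pow 2
      simpa using h3
  rw [integral_zero] at hDCT
  obtain ⟨N, hN⟩ := (hDCT.eventually_le_const (show 0 < ε / 4 by positivity)).exists
  refine ⟨l N, hl N, fun d t => g (labelSeq a (l N) d, t), ‖g‖, fun d t => g.norm_coe_le_norm _,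
    hmeas N, ?_⟩
  have hgl : MemLp (fun p : (ℤ → A) × ℝ => g (labelSeq a (l N) (label a (l N) p.1), p.2)) 2 ν :=
    MemLp.of_bound (hmeas N).aestronglyMeasurable ‖g‖ (ae_of_all _ fun p => g.norm_coe_le_norm _)
  have hi1 : Integrable (fun p => ‖f p - g p‖ ^ 2) ν :=
    (hf.sub hg2).integrable_norm_pow (by norm_num)
  have hi2 : Integrable (fun p => ‖g p - g (labelSeq a (l N) (label a (l N) p.1), p.2)‖ ^ 2) ν :=
    (hg2.sub hgl).integrable_norm_pow (by norm_num)
  calc ∫ p, ‖f p - g (labelSeq a (l N) (label a (l N) p.1), p.2)‖ ^ 2 ∂ν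
      ≤ ∫ p, (2 * ‖f p - g p‖ ^ 2 +
          2 * ‖g p - g (labelSeq a (l N) (label a (l N) p.1), p.2)‖ ^ 2) ∂ν := by
        refine integral_mono ((hf.sub hgl).integrable_norm_pow (by norm_num))
          ((hi1.const_mul 2).add (hi2.const_mul 2)) fun p => ?_
        have h1 := norm_sub_le_norm_sub_add_norm_sub (f p) (g p)
          (g (labelSeq a (l N) (label a (l N) p.1), p.2))
        have h2 := norm_nonneg (f p - g (labelSeq a (l N) (label a (l N) p.1), p.2))
        have h3 := pow_le_pow_left₀ h2 h1 2
        refine h3.trans ?_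
        nlinarith [sq_nonneg (‖f p - g p‖ -
          ‖g p - g (labelSeq a (l N) (label a (l N) p.1), p.2)‖)]
    _ = 2 * (∫ p, ‖f p - g p‖ ^ 2 ∂ν) +
        2 * ∫ p, ‖g p - g (labelSeq a (l N) (label a (l N) p.1), p.2)‖ ^ 2 ∂ν := by
        rw [integral_add (hi1.const_mul 2) (hi2.const_mul 2), integral_const_mul,
          integral_const_mul]
    _ ≤ ε := by
        have : ∫ p, ‖f p - g p‖ ^ 2 ∂ν ≤ ε / 4 := hfg
        linarith

end Density

/-! ### The exponents of the shifted sequences of substitutions -/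

section ShiftedExponent

variable {A : Type*} [Fintype A] [DecidableEq A]

/-- If the cocycle is invertible at time `l`, then passing to the sequence `σ^l a` does not change
its growth rate. -/
theorem upperLyapunov_shift_lt (a : ℕ → Substitution A) (ξ : A → ℝ) {l : ℕ}
    (hdet : (cocycle a ξ l).det ≠ 0) {β : ℝ} (h : upperLyapunov a ξ < (β : EReal)) :
    upperLyapunov (fun j => a (l + j)) (Matrix.mulVec (iter a l).matrix.transpose ξ) <
      (β : EReal) := by
  obtain ⟨β', hβ', C, hC⟩ := exists_forall_le_of_upperLyapunov_lt a ξ h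
  obtain ⟨γ, hγ1, hγ2⟩ := exists_between hβ'
  set M := cocycle a ξ l with hM
  set D : ℝ := C * Real.exp (l * β') * matrixNorm M⁻¹ with hD
  refine lt_of_le_of_lt (upperLyapunov_le_of_eventually_le (β := γ) _ _ ?_)
    (by exact_mod_cast hγ2)
  have hlarge : ∀ᶠ n : ℕ in atTop, D ≤ Real.exp (n * (γ - β')) := by
    have h1 : Tendsto (fun n : ℕ => (n : ℝ) * (γ - β')) atTop atTop :=
      tendsto_natCast_atTop_atTop.atTop_mul_const (sub_pos.2 hγ1)
    exact (Real.tendsto_exp_atTop.comp h1).eventually_ge_atTop D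
  filter_upwards [hlarge] with n hn
  have h1 : cocycle (fun j => a (l + j)) (Matrix.mulVec (iter a l).matrix.transpose ξ) n =
      cocycle a ξ (l + n) * M⁻¹ := by
    rw [cocycle_add, ← hM, Matrix.mul_assoc, Matrix.mul_nonsing_inv _ (isUnit_iff_ne_zero.2 hdet),
      Matrix.mul_one]
  rw [h1]
  calc (matrixNorm (cocycle a ξ (l + n) * M⁻¹) : ℝ)
      ≤ matrixNorm (cocycle a ξ (l + n)) * matrixNorm M⁻¹ := by
        exact_mod_cast matrixNorm_mul_le _ _
    _ ≤ C * Real.exp ((l + n : ℕ) * β') * matrixNorm M⁻¹ := by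
        gcongr
        exact hC (l + n)
    _ = D * Real.exp (n * β') := by
        rw [hD]
        push_cast
        rw [add_mul, Real.exp_add]
        ring
    _ ≤ Real.exp (n * (γ - β')) * Real.exp (n * β') := by gcongr
    _ = Real.exp (n * γ) := by
        rw [← Real.exp_add]
        congr 1
        ring

/-- The determinant of the cocycle along a line is a trigonometric polynomial, so that it vanishes
identically or almost nowhere. -/
theorem ae_det_cocycle_ne_zero (a : ℕ → Substitution A) (s : A → ℝ) (l : ℕ)
    (h : ∃ ω : ℝ, (cocycle a (ω • s) l).det ≠ 0) :
    ∀ᵐ ω : ℝ, (cocycle a (ω • s) l).det ≠ 0 := by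
  obtain ⟨ω₀, hω₀⟩ := h
  have hentry : ∀ i j, AnalyticOnNhd ℝ (fun ω : ℝ => cocycle a (ω • s) l i j) Set.univ := by
    intro i j ω _
    simp only [cocycle_eq, spectralMatrix, Matrix.of_apply]
    refine Finset.analyticAt_fun_sum _ fun k _ => ?_
    split_ifs
    · have h1 : ∀ ω : ℝ, ((((iter a l).word i).take k).map (ω • s)).sum =
          ω * ((((iter a l).word i).take k).map s).sum := by
        intro ω
        rw [← List.sum_map_mul_left]
        rfl
      simp only [h1]
      refine (analyticAt_cexp.restrictScalars (𝕜 := ℝ)).comp_of_eq ?_ rfl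
      have h2 : AnalyticAt ℝ (fun ω : ℝ => (ω : ℂ)) ω := Complex.ofRealCLM.analyticAt ω
      push_cast
      exact analyticAt_const.mul (h2.mul analyticAt_const)
    · exact analyticAt_const
  have hdet : AnalyticOnNhd ℝ (fun ω : ℝ => (cocycle a (ω • s) l).det) Set.univ := by
    intro ω _
    simp only [Matrix.det_apply']
    refine Finset.analyticAt_fun_sum _ fun p _ => analyticAt_const.mul ?_
    exact Finset.analyticAt_fun_prod _ fun i _ => hentry _ _ ω trivial
  have h1 := hdet.preimage_zero_mem_codiscrete hω₀
  have h2 := ae_restrict_le_codiscreteWithin (μ := volume) MeasurableSet.univ h1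
  rw [Measure.restrict_univ] at h2
  exact h2

end ShiftedExponent

/-! ### The absolutely continuous part of a spectral measure -/

section Density

variable {Y : Type*} [MeasurableSpace Y] {ν : Measure Y} [IsFiniteMeasure ν] {h : ℝ → Y → Y}

/-- If `g` has twisted integrals with mean squares `o(R)` at almost every frequency, then the
density of the spectral measure of `f` is controlled by the distance from `f` to `g`. -/
theorem lintegral_gauss_mul_rnDeriv_le (hh : IsMeasureFlow ν h) {f g : Y → ℂ} (hf : Measurable f)
    (hf2 : MemLp f 2 ν) (hg : Measurable g) (hg2 : MemLp g 2 ν) {σ : Measure ℝ} [IsFiniteMeasure σ]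
    (hσ : ∀ t : ℝ, 0 ≤ t → ∫ ω : ℝ, Complex.exp (2 * Real.pi * Complex.I * ω * t) ∂σ =
      ∫ y, f (h t y) * (starRingEnd ℂ) (f y) ∂ν)
    {R : ℕ → ℝ} (hR : Tendsto R atTop atTop)
    (hgR : ∀ᵐ ω : ℝ, ∀ η : ℝ, 0 < η → ∀ᶠ k in atTop,
      ∫ y, ‖twistedIntegral h g (R k) ω y‖ ^ 2 ∂ν ≤ η * R k) :
    ∫⁻ ω : ℝ, ENNReal.ofReal (gauss ω) * σ.rnDeriv volume ω ≤
      ENNReal.ofReal (24 * ∫ y, ‖f y - g y‖ ^ 2 ∂ν) := by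
  set V : ℕ → ℝ → ℝ := fun k ω =>
    gauss ω * ∫ y, ‖twistedIntegral h (f - g) (R k) ω y‖ ^ 2 ∂ν with hV
  have hV0 : ∀ k ω, 0 ≤ V k ω := fun k ω =>
    mul_nonneg (gauss_pos ω).le (integral_nonneg fun y => sq_nonneg _)
  have hr := tendsto_one_div_six_mul hR
  have hpoint : ∀ᵐ ω : ℝ, ENNReal.ofReal (gauss ω) * σ.rnDeriv volume ω ≤
      liminf (fun k => ENNReal.ofReal (24 / R k * V k ω)) atTop := by
    filter_upwards [Besicovitch.ae_tendsto_rnDeriv σ volume, hgR] with ω hω hgω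
    set G : ℕ → ℝ := fun k => ∫ y, ‖twistedIntegral h g (R k) ω y‖ ^ 2 ∂ν with hG
    have hw : Tendsto (fun k => ENNReal.ofReal (24 / R k * (gauss ω * G k))) atTop (𝓝 0) := by
      rw [← ENNReal.ofReal_zero]
      refine ENNReal.tendsto_ofReal ?_
      refine tendsto_order.2 ⟨fun c hc => ?_, fun c hc => ?_⟩
      · filter_upwards [hR.eventually_gt_atTop 0] with k hk
        have : 0 ≤ G k := integral_nonneg fun y => sq_nonneg _
        have := gauss_pos ω
        exact hc.trans_le (by positivity)
      · have hgp := gauss_pos ω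
        filter_upwards [hR.eventually_gt_atTop 0, hgω (c / (48 * gauss ω)) (by positivity)]
          with k hk hk2
        calc 24 / R k * (gauss ω * G k) ≤ 24 / R k * (gauss ω * (c / (48 * gauss ω) * R k)) := by
              gcongr
          _ = c / 2 := by field_simp; norm_num
          _ < c := by linarith
    have hlim := ENNReal.Tendsto.const_mul (a := ENNReal.ofReal (gauss ω)) (hω.comp hr)
      (Or.inr ENNReal.ofReal_ne_top)
    have hsub := ENNReal.Tendsto.sub hlim hw (Or.inr ENNReal.zero_ne_top)
    rw [tsub_zero] at hsub
    rw [← hsub.liminf_eq]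
    refine liminf_le_liminf ?_
    filter_upwards [hR.eventually_gt_atTop 0] with k hk
    have hVk : 0 ≤ 24 / R k * V k ω := mul_nonneg (by positivity) (hV0 k ω)
    have hGk : 0 ≤ 24 / R k * (gauss ω * G k) := by
      have : 0 ≤ G k := integral_nonneg fun y => sq_nonneg _
      have := gauss_pos ω
      positivity
    rw [tsub_le_iff_right, ← ENNReal.ofReal_add hVk hGk]
    have h1 := measure_closedBall_le hh hf hf2 hσ hk ω
    have h2 := integral_normSq_twistedIntegral_le_add hh hf hf2 hg hg2 (R k) ω
    simp only [Function.comp_apply]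
    rw [Real.volume_closedBall]
    calc ENNReal.ofReal (gauss ω) *
          (σ (Metric.closedBall ω (1 / (6 * R k))) / ENNReal.ofReal (2 * (1 / (6 * R k))))
        ≤ ENNReal.ofReal (gauss ω) * (ENNReal.ofReal (4 / R k ^ 2 *
            ∫ y, ‖twistedIntegral h f (R k) ω y‖ ^ 2 ∂ν) /
              ENNReal.ofReal (2 * (1 / (6 * R k)))) := by gcongr
      _ = ENNReal.ofReal (gauss ω * (4 / R k ^ 2 *
            (∫ y, ‖twistedIntegral h f (R k) ω y‖ ^ 2 ∂ν) / (2 * (1 / (6 * R k))))) := by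
          rw [← ENNReal.ofReal_div_of_pos (by positivity), ← ENNReal.ofReal_mul (gauss_pos ω).le]
      _ ≤ _ := by
          refine ENNReal.ofReal_le_ofReal ?_
          have hgp := gauss_pos ω
          calc gauss ω * (4 / R k ^ 2 *
                (∫ y, ‖twistedIntegral h f (R k) ω y‖ ^ 2 ∂ν) / (2 * (1 / (6 * R k))))
              = 12 / R k * (gauss ω * ∫ y, ‖twistedIntegral h f (R k) ω y‖ ^ 2 ∂ν) := by
                field_simp; ring
            _ ≤ 12 / R k * (gauss ω *
                (2 * (∫ y, ‖twistedIntegral h (f - g) (R k) ω y‖ ^ 2 ∂ν) + 2 * G k)) := by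
                gcongr
            _ = _ := by
                simp only [hV]
                ring
  refine (lintegral_mono_ae hpoint).trans ((lintegral_liminf_le' fun k => ?_).trans ?_)
  · exact ((integrable_gauss_normSq_twistedIntegral hh (hf.sub hg) (hf2.sub hg2)
      (R k)).aestronglyMeasurable.aemeasurable.const_mul _).ennreal_ofReal
  · refine (liminf_le_limsup).trans (limsup_le_of_le (by isBoundedDefault) ?_)
    filter_upwards [hR.eventually_gt_atTop 0] with k hk
    have hc : 0 ≤ 24 / R k := by positivity
    simp only [ENNReal.ofReal_mul hc]
    rw [lintegral_const_mul' _ _ ENNReal.ofReal_ne_top]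
    refine (mul_le_mul_right (lintegral_gauss_normSq_twistedIntegral_le hh (hf.sub hg)
      (hf2.sub hg2) hk.le) _).trans (le_of_eq ?_)
    rw [← ENNReal.ofReal_mul hc]
    congr 1
    simp only [Pi.sub_apply]
    field_simp

/-- A spectral measure is singular if the function can be approximated by functions whose twisted
integrals have mean squares `o(R)` at almost every frequency. -/
theorem mutuallySingular_of_approx (hh : IsMeasureFlow ν h) {f : Y → ℂ} (hf : Measurable f)
    (hf2 : MemLp f 2 ν) {σ : Measure ℝ} [IsFiniteMeasure σ]
    (hσ : ∀ t : ℝ, 0 ≤ t → ∫ ω : ℝ, Complex.exp (2 * Real.pi * Complex.I * ω * t) ∂σ =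
      ∫ y, f (h t y) * (starRingEnd ℂ) (f y) ∂ν)
    (happrox : ∀ ε : ℝ, 0 < ε → ∃ g : Y → ℂ, Measurable g ∧ MemLp g 2 ν ∧
      ∫ y, ‖f y - g y‖ ^ 2 ∂ν ≤ ε ∧ ∃ R : ℕ → ℝ, Tendsto R atTop atTop ∧
        ∀ᵐ ω : ℝ, ∀ η : ℝ, 0 < η → ∀ᶠ k in atTop,
          ∫ y, ‖twistedIntegral h g (R k) ω y‖ ^ 2 ∂ν ≤ η * R k) :
    σ ⟂ₘ volume := by
  have hzero : ∫⁻ ω : ℝ, ENNReal.ofReal (gauss ω) * σ.rnDeriv volume ω = 0 := by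
    refine le_antisymm (ENNReal.le_of_forall_pos_le_add fun ε hε _ => ?_) zero_le
    have hε' : (0 : ℝ) < ε := by exact_mod_cast hε
    obtain ⟨g, hg, hg2, hfg, R, hR, hgR⟩ := happrox (ε / 24) (by positivity)
    refine (lintegral_gauss_mul_rnDeriv_le hh hf hf2 hg hg2 hσ hR hgR).trans ?_
    rw [zero_add, ← ENNReal.ofReal_coe_nnreal]
    exact ENNReal.ofReal_le_ofReal (by linarith)
  have hm : Measurable fun ω : ℝ => ENNReal.ofReal (gauss ω) * σ.rnDeriv volume ω :=
    continuous_gauss.measurable.ennreal_ofReal.mul (Measure.measurable_rnDeriv _ _)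
  rw [← Measure.rnDeriv_eq_zero]
  filter_upwards [(lintegral_eq_zero_iff hm).1 hzero] with ω hω
  rcases mul_eq_zero.1 hω with h1 | h1
  · exact absurd (ENNReal.ofReal_eq_zero.1 h1) (not_le.2 (gauss_pos ω))
  · exact h1

end Density

/-! ### Singular spectrum -/

section Singular

variable {A : Type*} [Fintype A] [MeasurableSpace A] [DiscreteMeasurableSpace A] [Nonempty A]
  [DecidableEq A] {a : ℕ → Substitution A} {lam : ℝ} {s : A → ℝ} {μ : Measure (ℤ → A)}

theorem mutuallySingular_cylindrical (hadm : ∀ n, (a n).IsAdmissible) (ha : HasGrowth a lam)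
    (hs : ∀ c, 0 < s c) (hμ : IsInvariantProbability a μ)
    (hχ : ∀ᵐ ω : ℝ, upperLyapunov a (ω • s) < ((lam / 2 : ℝ) : EReal)) {ψ : A → ℝ → ℂ}
    (hψ : IsLipFamily s ψ) {σ : Measure ℝ}
    (hσ : IsSpectralMeasure (suspensionMeasure s μ) (flow s) (cylindrical ψ) σ) : σ ⟂ₘ volume := by
  refine Measure.MutuallySingular.mk
    (s := {ω | upperLyapunov a (ω • s) < ((lam / 2 : ℝ) : EReal)})
    (t := {ω | ¬ upperLyapunov a (ω • s) < ((lam / 2 : ℝ) : EReal)}) ?_ hχ fun ω _ => em _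
  have h1 := ae_le_upperLyapunov hadm ha hs hμ hψ hσ
  rw [ae_iff] at h1
  simpa only [not_le] using h1

variable [TopologicalSpace A] [DiscreteTopology A]

/-- If the exponent is below `lam / 2` almost everywhere, then so are those of the sequences
`σ^l a`, and the functions of the labels of level `l` have small twisted integrals. -/
theorem hasPurelySingularSpectrum (hadm : ∀ n, (a n).IsAdmissible) (hrec : IsRecognizable a)
    (ha : HasGrowth a lam) (hs : ∀ c, 0 < s c) (hμ : IsInvariantProbability a μ)
    (hχ : ∀ᵐ ω : ℝ, upperLyapunov a (ω • s) < ((lam / 2 : ℝ) : EReal))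
    (hdet : ∀ l : ℕ, 1 ≤ l → ∃ ω : ℝ, (cocycle a (ω • s) l).det ≠ 0) :
    HasPurelySingularSpectrum (suspensionMeasure s μ) (flow s) := by
  intro f hf σ hσ
  have := hμ.prob
  have := hσ.1
  obtain ⟨c₀, hδs⟩ := Finite.exists_min s
  obtain ⟨c₁, hS⟩ := Finite.exists_max s
  have hδ := hs c₀
  set δ := s c₀ with hδdef
  have hflow := isMeasureFlow_flow hδ hδs hμ.invariant
  have := isFiniteMeasure_suspensionMeasure (s := s) μ
  set ν := suspensionMeasure s μ with hν
  -- Twisted integrals are formed pointwise along orbits, so `f` is replaced by a measurable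
  -- version.
  set f' : (ℤ → A) × ℝ → ℂ := hf.1.mk f with hf'
  have hff' : f =ᵐ[ν] f' := hf.1.ae_eq_mk
  have hf'm : Measurable f' := hf.1.stronglyMeasurable_mk.measurable
  have hf'2 : MemLp f' 2 ν := (memLp_congr_ae hff').1 hf
  have hσ' : ∀ t : ℝ, 0 ≤ t → ∫ ω : ℝ, Complex.exp (2 * Real.pi * Complex.I * ω * t) ∂σ =
      ∫ y, f' (flow s t y) * (starRingEnd ℂ) (f' y) ∂ν := by
    intro t ht
    rw [hσ.2 t]
    refine integral_congr_ae ?_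
    filter_upwards [hff', (hflow.preserving t ht).quasiMeasurePreserving.ae hff'] with y h1 h2
    rw [h1, h2]
  refine mutuallySingular_of_approx hflow hf'm hf'2 hσ' fun ε hε => ?_
  obtain ⟨l, hl, ψ, M, hψ, hg, hfg⟩ := exists_labelled_approx hadm hrec ha hμ hf'2 hε
  refine ⟨_, hg, MemLp.of_bound hg.aestronglyMeasurable M (ae_of_all _ fun p => hψ _ _), hfg,
    fun k => δ / 2 * minLength (fun j => a (l + j)) k,
    (ha.shift l).tendsto_minLength.const_mul_atTop (by positivity), ?_⟩
  filter_upwards [hχ, ae_det_cocycle_ne_zero a s l (hdet l hl)] with ω h1 h2 η hη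
  have hξ : (ω • fun c => ((labelBlock a l c).map (labelRoof a l s)).sum) =
      Matrix.mulVec (iter a l).matrix.transpose (ω • s) := by
    rw [Matrix.mulVec_smul, transpose_mulVec_eq']
    simp only [sum_labelRoof]
  refine eventually_integral_normSq_twistedIntegral_le hδ hδs hS (ha.shift l)
    (labelBlock_ne_nil a l) (τ := labelRoof a l s) (fun d => hS _) hψ hg ?_ ?_ hη
  · filter_upwards [hμ.ae_mem] with x hx
    exact isAdapted_label hadm hrec hl s hx
  · rw [hξ]
    exact upperLyapunov_shift_lt a (ω • s) h2 h1

end Singular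

end

end SAdic

open SAdic in
theorem corollary4p4 {m : ℕ} (a : ℕ → Substitution (Fin m)) (lam : ℝ)
    (hadm : ∀ n, (a n).IsAdmissible)
    (hA1 : ConditionA1' a) (hA2 : ConditionA2 a lam) (hA3 : ConditionA3 a)
    (haper : IsAperiodic a) (hrec : IsRecognizable a)
    (s : Fin m → ℝ) (hs : ∀ b, 0 < s b)
    (μ : Measure (ℤ → Fin m)) (hμ : IsInvariantProbability a μ) :
    ((∀ᵐ ω : ℝ, upperLyapunov a (ω • s) ≤ ((lam / 2 : ℝ) : EReal)) ∧
      ∀ ψ : Fin m → ℝ → ℂ, IsLipFamily s ψ → ∀ σ : Measure ℝ,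
        IsSpectralMeasure (suspensionMeasure s μ) (flow s) (cylindrical ψ) σ →
          ∀ᵐ ω ∂σ, ((lam / 2 : ℝ) : EReal) ≤ upperLyapunov a (ω • s)) ∧
    ((∀ᵐ ω : ℝ, upperLyapunov a (ω • s) < ((lam / 2 : ℝ) : EReal)) →
      ∀ ψ : Fin m → ℝ → ℂ, IsLipFamily s ψ → ∀ σ : Measure ℝ,
        IsSpectralMeasure (suspensionMeasure s μ) (flow s) (cylindrical ψ) σ → σ ⟂ₘ volume) ∧
    ((∀ᵐ ω : ℝ, upperLyapunov a (ω • s) < ((lam / 2 : ℝ) : EReal)) →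
      (∀ l : ℕ, 1 ≤ l → ∃ ω : ℝ, (cocycle a (ω • s) l).det ≠ 0) →
        HasPurelySingularSpectrum (suspensionMeasure s μ) (flow s)) := by
  have := hμ.prob
  have hne : Nonempty (Fin m) := by
    obtain ⟨x⟩ := nonempty_of_isProbabilityMeasure μ
    exact ⟨x 0⟩
  have ha := hasGrowth_of_conditions hadm hA1 hA2 hA3
  exact ⟨⟨ae_upperLyapunov_le a lam hA2 s hs,
      fun _ hψ _ hσ => ae_le_upperLyapunov hadm ha hs hμ hψ hσ⟩,
    fun hχ _ hψ _ hσ => mutuallySingular_cylindrical hadm ha hs hμ hχ hψ hσ,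
    fun hχ hdet => hasPurelySingularSpectrum hadm hrec ha hs hμ hχ hdet⟩
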